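/- **Conventions.** $\mathscr F f(\xi)=\int_{\mathbb R^n} f(x)e^{-2\pi i x\cdot\xi}\,dx$, extended to the tempered distributions $\mathscr S'=\mathscr S'(\mathbb R^n)$; $\langle x\rangle=(1+|x|^2)^{1/2}$; for $u\in\mathscr S'$, $\|u\|_{L^p}=\infty$ if $u$ is not an $L^p$ function. For $0\le\alpha<1$, fix constants $0<C_1<C_2$ and Schwartz functions $\eta_k^\alpha$, $k\in\mathbb Z^n$, with $|\eta_k^\alpha(\xi)|=1$ if $|\xi-\langle k\rangle^{\frac{\alpha}{1-\alpha}}k|\le C_1\langle k\rangle^{\frac{\alpha}{1-\alpha}}$; $\operatorname{supp}\eta_k^\alpha\subset\{\xi:|\xi-\langle k\rangle^{\frac{\alpha}{1-\alpha}}k|\le C_2\langle k\rangle^{\frac{\alpha}{1-\alpha}}\}$; $\sum_k\eta_k^\alpha\equiv1$; and $|\partial^\gamma\eta_k^\alpha(\xi)|\le C_{|\gamma|}\langle k\rangle^{-\frac{\alpha|\gamma|}{1-\alpha}}$ for all $k$, $\xi$, $\gamma$. For $1\le p,q\le\infty$ and $s\in\mathbb R$, $M^{p,q}_{s,\alpha}$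 is the space of all $f\in\mathscr S'$ with $$\|f\|_{M^{p,q}_{s,\alpha}}=\Big(\sum_{k\in\mathbb Z^n}\langle k\rangle^{\frac{sq}{1-\alpha}}\|\mathscr F^{-1}\eta_k^\alpha\mathscr F f\|_{L^p}^q\Big)^{1/q}<\infty$$ (a supremum if $q=\infty$). For $\alpha=1$, $M^{p,q}_{s,1}$ is the inhomogeneous Besov space $B^{p,q}_s$, with norm $\big(\sum_{j\ge0}2^{jsq}\|\mathscr F^{-1}\phi_j\mathscr F f\|_{L^p}^q\big)^{1/q}$, where $\phi_0=\varphi:\mathbb R^n\to[0,1]$ is smooth, supported in $\{|\xi|\le 3/2\}$ and equal to $1$ on $\{|\xi|\le4/3\}$, and $\phi_j(\xi)=\varphi(2^{-j}\xi)-\varphi(2^{1-j}\xi)$ for $j\ge1$. A function $g$ is in $\mathscr F M^{p,q}_{s,\alpha}$ if $g\in\mathscr S'$ and $\mathscr F^{-1}g\in M^{p,q}_{s,\alpha}$. For a continuous function $m$ and $f,g\in\mathscr S'$, we write $g=m(D)f$ if $\mathscr F g=m\,\mathscr F f$, the product being understood locally as follows: for all $\varphi,\psi\in C_c^\infty(\mathbb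 R^n)$, $$\langle\mathscr F g,\varphi\psi\rangle=\int_{\mathbb R^n}\mathscr F(\varphi m)(x)\,\big(\mathscr F^{-1}(\psi\,\mathscr F f)\big)(x)\,dx ,$$ with an absolutely convergent integral ($\mathscr F^{-1}(\psi\mathscr F f)$ is a smooth function). This determines $g$. **Theorem 1.1.** Let $1\le p,q\le\infty$, $s\in\mathbb R$ and $\alpha\in[0,1]$. Let $\mu\in C^2(\mathbb R^n)$ be real-valued with $\partial^\gamma\mu\in\mathscr F M^{1,\infty}_{2\alpha-2s,\alpha}$ for every multi-index $\gamma$ with $|\gamma|=2$. Let $\delta\ge|1/p-1/2|\max\{2s,0\}$. Then the unimodular multiplier $e^{i\mu(D)}$ is bounded from $M^{p,q}_{\delta n,\alpha}$ to $M^{p,q}_{0,\alpha}$: for every $f\in M^{p,q}_{\delta n,\alpha}$ there is exactly one $g=e^{i\mu(D)}f\in\mathscr S'$ in the above sense, it depends linearly on $f$ and belongs to $M^{p,q}_{0,\alpha}$, and $\|e^{i\mu(D)}f\|_{M^{p,q}_{0,\alpha}}\le C\|f\|_{M^{p,q}_{\delta n,\alpha}}$ with a constant $C$ independent of $f$. 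-/

import Mathlib

open MeasureTheory FourierTransform
open scoped SchwartzMap ENNReal NNReal

noncomputable section

namespace AlphaMod

/-- The Euclidean space `ℝⁿ`. -/
abbrev E (n : ℕ) : Type := EuclideanSpace ℝ (Fin n)

/-! ### The building blocks of the norms -/

/-- The `Lᵖ` norm of a tempered distribution: the norm of the `Lᵖ` function which represents it, and
`∞` if there is no such function. -/
def distLpNorm {n : ℕ} (p : ℝ≥0∞) [Fact (1 ≤ p)] (u : 𝓢'(E n, ℂ)) : ℝ≥0∞ :=
  ⨅ (h : Lp ℂ p (volume : Measure (E n))) (_ : Lp.toTemperedDistribution h = u), ‖h‖ₑ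

/-- The `ℓ^q` norm of a family of extended nonnegative numbers. -/
def lqNorm {ι : Type} (q : ℝ≥0∞) (a : ι → ℝ≥0∞) : ℝ≥0∞ :=
  if q = ∞ then ⨆ k, a k else (∑' k, a k ^ q.toReal) ^ (1 / q.toReal)

/-- The data of a frequency decomposition of `ℝⁿ`: an index set, the size `weight k` of the
frequencies in the `k`-th piece, and the Schwartz function `symbol k` which localizes to it. -/
structure FreqDecomp (n : ℕ) where
  Index : Type
  weight : Index → ℝ
  symbol : Index → 𝓢(E n, ℂ)

/-- The norm `‖ (weight k ^ s * ‖𝓕⁻¹ (symbol k) 𝓕 f‖_{Lᵖ})_k ‖_{ℓ^q}`. -/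
def FreqDecomp.norm {n : ℕ} (D : FreqDecomp n) (p q : ℝ≥0∞) [Fact (1 ≤ p)] (s : ℝ)
    (f : 𝓢'(E n, ℂ)) : ℝ≥0∞ :=
  lqNorm q fun k => ENNReal.ofReal (D.weight k ^ s) *
    distLpNorm p (TemperedDistribution.fourierMultiplierCLM ℂ (D.symbol k) f)

/-! ### The two kinds of decompositions -/

/-- The Japanese bracket `⟨x⟩ = (1 + |x|²)^{1/2}`. -/
def japanese {n : ℕ} (x : E n) : ℝ := √(1 + ‖x‖ ^ 2)

/-- A lattice point `k ∈ ℤⁿ` as a point of `ℝⁿ`. -/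
def latticePt {n : ℕ} (k : Fin n → ℤ) : E n := WithLp.toLp 2 fun i => (k i : ℝ)

/-- The scale `⟨k⟩^{α/(1-α)}` of the `k`-th piece. -/
def scale {n : ℕ} (α : ℝ) (k : Fin n → ℤ) : ℝ := japanese (latticePt k) ^ (α / (1 - α))

/-- `η` is a smooth partition of unity adapted to the `α`-covering of `ℝⁿ`, `0 ≤ α < 1`. -/
def IsAlphaPartition {n : ℕ} (α : ℝ) (η : (Fin n → ℤ) → 𝓢(E n, ℂ)) : Prop :=
  (∃ C₁ C₂ : ℝ, 0 < C₁ ∧ C₁ < C₂ ∧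
    (∀ k ξ, ‖ξ - scale α k • latticePt k‖ ≤ C₁ * scale α k → ‖η k ξ‖ = 1) ∧
    (∀ k, tsupport (η k) ⊆ {ξ | ‖ξ - scale α k • latticePt k‖ ≤ C₂ * scale α k})) ∧
  (∀ ξ, HasSum (fun k => η k ξ) 1) ∧
  ∀ m : ℕ, ∃ C : ℝ, ∀ k ξ, ‖iteratedFDeriv ℝ m (η k) ξ‖ ≤
    C * japanese (latticePt k) ^ (-(α * m / (1 - α)))

/-- `φ j`, `j ∈ ℕ`, are the functions of a dyadic (Littlewood-Paley) decomposition: they come from a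
smooth `φ₀ : ℝⁿ → [0,1]` with support in `|ξ| ≤ 3/2` and equal to `1` on `|ξ| ≤ 4/3`, through
`φ j = φ₀ (2⁻ʲ ·) - φ₀ (2¹⁻ʲ ·)` for `j ≥ 1`. -/
def IsDyadicPartition {n : ℕ} (φ : ℕ → 𝓢(E n, ℂ)) : Prop :=
  (∀ ξ, ∃ r : ℝ, 0 ≤ r ∧ r ≤ 1 ∧ φ 0 ξ = (r : ℂ)) ∧
  tsupport (φ 0) ⊆ {ξ | ‖ξ‖ ≤ 3 / 2} ∧
  (∀ ξ : E n, ‖ξ‖ ≤ 4 / 3 → φ 0 ξ = 1) ∧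
  ∀ j : ℕ, ∀ ξ : E n, φ (j + 1) ξ =
    φ 0 (((2 : ℝ) ^ (j + 1))⁻¹ • ξ) - φ 0 ((2 : ℝ) • ((2 : ℝ) ^ (j + 1))⁻¹ • ξ)

/-- The decomposition underlying the `α`-modulation norm, `0 ≤ α < 1`; here
`weight k ^ s = ⟨k⟩^{s/(1-α)}`. -/
def alphaDecomp {n : ℕ} (α : ℝ) (η : (Fin n → ℤ) → 𝓢(E n, ℂ)) : FreqDecomp n where
  Index := Fin n → ℤ
  weight k := japanese (latticePt k) ^ (1 / (1 - α))
  symbol := η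

/-- The decomposition underlying the inhomogeneous Besov norm. -/
def dyadicDecomp {n : ℕ} (φ : ℕ → 𝓢(E n, ℂ)) : FreqDecomp n where
  Index := ℕ
  weight j := 2 ^ j
  symbol := φ

/-- `D` is one of the decompositions which define the `α`-modulation spaces, `0 ≤ α ≤ 1`; for
`α = 1` these are by convention the inhomogeneous Besov spaces. -/
def FreqDecomp.IsAdmissible {n : ℕ} (α : ℝ) (D : FreqDecomp n) : Prop :=
  (0 ≤ α ∧ α < 1 ∧ ∃ η, IsAlphaPartition α η ∧ D = alphaDecomp α η) ∨
  (α = 1 ∧ ∃ φ, IsDyadicPartition φ ∧ D = dyadicDecomp φ)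

/-! ### The spaces -/

lemma distLpNorm_lt_top {n : ℕ} {p : ℝ≥0∞} [Fact (1 ≤ p)] {u : 𝓢'(E n, ℂ)}
    (h : distLpNorm p u < ∞) :
    ∃ g : Lp ℂ p (volume : Measure (E n)), Lp.toTemperedDistribution g = u := by
  simp only [distLpNorm, iInf_lt_iff] at h
  obtain ⟨g, hg, -⟩ := h
  exact ⟨g, hg⟩

lemma distLpNorm_zero {n : ℕ} (p : ℝ≥0∞) [Fact (1 ≤ p)] :
    distLpNorm p (0 : 𝓢'(E n, ℂ)) = 0 := by
  refine le_antisymm (iInf₂_le_of_le 0 ?_ ?_) bot_le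
  · rw [← Lp.toTemperedDistributionCLM_apply, map_zero]
  · simp

lemma distLpNorm_add_le {n : ℕ} (p : ℝ≥0∞) [Fact (1 ≤ p)] (u v : 𝓢'(E n, ℂ)) :
    distLpNorm p (u + v) ≤ distLpNorm p u + distLpNorm p v := by
  simp only [distLpNorm, ENNReal.iInf_add, ENNReal.add_iInf]
  refine le_iInf fun g => le_iInf fun hg => le_iInf fun h => le_iInf fun hh => ?_
  refine iInf₂_le_of_le (g + h) ?_ ((enorm_add_le _ _).trans (add_comm _ _).le)
  rw [← Lp.toTemperedDistributionCLM_apply, map_add, Lp.toTemperedDistributionCLM_apply,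
    Lp.toTemperedDistributionCLM_apply, hg, hh, add_comm]

lemma distLpNorm_smul_le {n : ℕ} (p : ℝ≥0∞) [Fact (1 ≤ p)] (c : ℂ) (u : 𝓢'(E n, ℂ)) :
    distLpNorm p (c • u) ≤ ‖c‖ₑ * distLpNorm p u := by
  by_cases hc : c = 0
  · have h0 : c • u = 0 := by rw [hc]; exact zero_smul ℂ u
    rw [h0, distLpNorm_zero]
    exact bot_le
  have hc' : ‖c‖ₑ ≠ 0 := by simpa using hc
  simp only [distLpNorm, ENNReal.mul_iInf_of_ne hc' enorm_ne_top]
  refine le_iInf fun g => le_iInf fun hg => ?_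
  refine iInf₂_le_of_le (c • g) ?_ (enorm_smul _ _).le
  rw [← Lp.toTemperedDistributionCLM_apply, map_smul, Lp.toTemperedDistributionCLM_apply, hg]

lemma lqNorm_mono {ι : Type} {q : ℝ≥0∞} {a b : ι → ℝ≥0∞} (h : ∀ k, a k ≤ b k) :
    lqNorm q a ≤ lqNorm q b := by
  unfold lqNorm
  split_ifs
  · exact iSup_mono h
  · have := h
    gcongr
    exact h _

lemma lqNorm_add_lt_top {ι : Type} {q : ℝ≥0∞} (hq : 1 ≤ q) {a b : ι → ℝ≥0∞}
    (ha : lqNorm q a < ∞) (hb : lqNorm q b < ∞) : lqNorm q (fun k => a k + b k) < ∞ := by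
  unfold lqNorm at *
  split_ifs at * with h
  · exact (iSup_le fun k => add_le_add (le_iSup a k) (le_iSup b k)).trans_lt
      (ENNReal.add_lt_top.2 ⟨ha, hb⟩)
  · have hq1 : 1 ≤ q.toReal := by
      rw [← ENNReal.toReal_one]
      exact ENNReal.toReal_mono h hq
    have hq0 : 0 < 1 / q.toReal := by positivity
    rw [ENNReal.rpow_lt_top_iff_of_pos hq0] at *
    calc ∑' k, (a k + b k) ^ q.toReal
        ≤ ∑' k, 2 ^ (q.toReal - 1) * (a k ^ q.toReal + b k ^ q.toReal) :=
          ENNReal.tsum_le_tsum fun k => ENNReal.rpow_add_le_mul_rpow_add_rpow _ _ hq1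
      _ = 2 ^ (q.toReal - 1) * (∑' k, a k ^ q.toReal + ∑' k, b k ^ q.toReal) := by
          rw [ENNReal.tsum_mul_left, ENNReal.tsum_add]
      _ < ∞ := ENNReal.mul_lt_top
          (ENNReal.rpow_lt_top_of_nonneg (by linarith) (by norm_num))
          (ENNReal.add_lt_top.2 ⟨ha, hb⟩)

lemma lqNorm_mul_lt_top {ι : Type} {q : ℝ≥0∞} (hq : 1 ≤ q) {a : ι → ℝ≥0∞} {c : ℝ≥0∞}
    (hc : c ≠ ∞) (ha : lqNorm q a < ∞) : lqNorm q (fun k => c * a k) < ∞ := by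
  unfold lqNorm at *
  split_ifs at * with h
  · rw [← ENNReal.mul_iSup]
    exact ENNReal.mul_lt_top hc.lt_top ha
  · have hq1 : 1 ≤ q.toReal := by
      rw [← ENNReal.toReal_one]
      exact ENNReal.toReal_mono h hq
    have hq0 : 0 < 1 / q.toReal := by positivity
    rw [ENNReal.rpow_lt_top_iff_of_pos hq0] at *
    have hq2 : 0 ≤ q.toReal := by linarith
    simp only [ENNReal.mul_rpow_of_nonneg _ _ hq2, ENNReal.tsum_mul_left]
    exact ENNReal.mul_lt_top (ENNReal.rpow_lt_top_of_nonneg hq2 hc) ha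

/-- The space of all tempered distributions whose norm with respect to `D` is finite: for an
`α`-admissible `D` this is the `α`-modulation space `M^{p,q}_{s,α}`. -/
def FreqDecomp.space {n : ℕ} (D : FreqDecomp n) (p q : ℝ≥0∞) [Fact (1 ≤ p)] [Fact (1 ≤ q)]
    (s : ℝ) : Submodule ℂ 𝓢'(E n, ℂ) where
  carrier := {f | D.norm p q s f < ∞}
  zero_mem' := by
    have hq : (1 : ℝ≥0∞) ≤ q := Fact.out
    change D.norm p q s 0 < ∞
    simp only [FreqDecomp.norm, map_zero, distLpNorm_zero, mul_zero, lqNorm]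
    split_ifs with h
    · simp
    · have hq1 : 0 < q.toReal := ENNReal.toReal_pos (by positivity) h
      simp [ENNReal.zero_rpow_of_pos hq1, hq1]
  add_mem' := by
    intro f g hf hg
    refine (lqNorm_mono fun k => ?_).trans_lt (lqNorm_add_lt_top Fact.out hf hg)
    rw [map_add, ← mul_add]
    gcongr
    exact distLpNorm_add_le p _ _
  smul_mem' := by
    intro c f hf
    refine (lqNorm_mono fun k => ?_).trans_lt
      (lqNorm_mul_lt_top (c := ‖c‖ₑ) Fact.out enorm_ne_top hf)
    rw [map_smul, mul_left_comm]
    gcongr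
    exact distLpNorm_smul_le p _ _

/-- The continuous function `g` belongs to `𝓕 M^{p,q}_{s,α}`: as a distribution, `g` is a tempered
distribution whose inverse Fourier transform lies in the space of `D`. -/
def FreqDecomp.MemFourier {n : ℕ} (D : FreqDecomp n) (p q : ℝ≥0∞) [Fact (1 ≤ p)] [Fact (1 ≤ q)]
    (s : ℝ) (g : E n → ℂ) : Prop :=
  ∃ u : 𝓢'(E n, ℂ), (∀ φ : 𝓢(E n, ℂ), HasCompactSupport φ → u φ = ∫ ξ, φ ξ * g ξ) ∧
    𝓕⁻ u ∈ D.space p q s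

/-! ### Fourier multipliers with a nonsmooth symbol -/

/-- The character `ξ ↦ e^{2πi x·ξ}`. -/
def character {n : ℕ} (x : E n) (ξ : E n) : ℂ := (Real.fourierChar (inner ℝ x ξ) : ℂ)

lemma fourierChar_hasTemperateGrowth : Function.HasTemperateGrowth (fun t : ℝ => ((Real.fourierChar t : Circle) : ℂ)) := by
  have key : ∀ (m : ℕ), iteratedDeriv m (fun t : ℝ => ((Real.fourierChar t : Circle) : ℂ)) =
      fun t => (2 * Real.pi * Complex.I) ^ m * ((Real.fourierChar t : Circle) : ℂ) := by
    intro m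
    induction m with
    | zero => simp
    | succ m ih =>
      rw [iteratedDeriv_succ, ih]
      funext t
      have := (Real.hasDerivAt_fourierChar t).const_mul ((2 * Real.pi * Complex.I) ^ m)
      rw [this.deriv]; ring
  refine ⟨?_, fun m => ⟨0, (2*Real.pi)^m, fun t => ?_⟩⟩
  · simp only [Real.fourierChar_apply]
    exact ((Complex.ofRealCLM.contDiff.comp (contDiff_const.mul contDiff_id)).mul contDiff_const).cexp
  · rw [norm_iteratedFDeriv_eq_norm_iteratedDeriv, key]
    simp [abs_of_pos Real.pi_pos, Circle.norm_coe]

lemma character_hasTemperateGrowth {n : ℕ} (x : E n) : Function.HasTemperateGrowth (character x) :=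
  fourierChar_hasTemperateGrowth.comp (Function.hasTemperateGrowth_inner_right x)

/-- The function `ψ(D) f = 𝓕⁻¹ (ψ 𝓕 f)`, written pointwise as
`x ↦ ⟨𝓕 f, ψ e^{2πi x·}⟩`; it is a smooth function for every tempered distribution `f`. -/
def cutoff {n : ℕ} (ψ : 𝓢(E n, ℂ)) (f : 𝓢'(E n, ℂ)) (x : E n) : ℂ :=
  (𝓕 f) (SchwartzMap.smulLeftCLM ℂ (character x) ψ)

/-- `g = 𝓕⁻¹ (m 𝓕 f)`, for a continuous function `m`. The product of `m` and the distribution `𝓕 f`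
is taken locally: since `⟨m 𝓕 f, φ ψ⟩ = ⟨ψ 𝓕 f, φ m⟩`, its value at `φ ψ` is the integral of the
function `ψ(D) f` against the Fourier transform of `φ m`, for all test functions `φ` and `ψ`; these
integrals are required to converge absolutely. Because every test function is of the form `φ ψ` and
the test functions are dense in the Schwartz space, `m` and `f` determine `g`. -/
def IsFourierMultiplier {n : ℕ} (m : E n → ℂ) (f g : 𝓢'(E n, ℂ)) : Prop :=
  ∀ φ ψ : 𝓢(E n, ℂ), HasCompactSupport φ → HasCompactSupport ψ →
    Integrable (fun x => 𝓕 (fun ξ => φ ξ * m ξ) x * cutoff ψ f x) ∧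
    (𝓕 g) (SchwartzMap.smulLeftCLM ℂ φ ψ) =
      ∫ x, 𝓕 (fun ξ => φ ξ * m ξ) x * cutoff ψ f x

/-- The second order partial derivative `∂ᵢ∂ⱼ μ`, as a complex-valued function. -/
def secondPartial {n : ℕ} (μ : E n → ℝ) (i j : Fin n) (ξ : E n) : ℂ :=
  ((iteratedFDeriv ℝ 2 μ ξ ![EuclideanSpace.single i 1, EuclideanSpace.single j 1] : ℝ) : ℂ)

end AlphaMod

end

/-! Let W be the weight of a frequency piece, whose diameter is then at most of order W^α. Localized
to the piece, each `secondPartial μ i j` is by hypothesis the Fourier transform of an L¹ function of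
norm O(W^(2s-2α)). On a ball of radius ρ ~ W^(α - max(s,0)) the phase μ is therefore an affine
function plus a Taylor remainder which is bounded in the Banach algebra 𝓕L¹, because the ρ² of the
second order term absorbs W^(2s-2α). The affine part only translates the kernel and multiplies it by
a unimodular constant; the exponential series handles the remainder (`exists_fourierL1_exp_local`).
Averaging over all such balls that meet the piece costs (W^α/ρ)^n ~ W^(n max(s,0)), the number of
balls in a covering, and this bounds the L¹ norm A of the kernel of e^{iμ} on the piece
(`CutoffSystem.exists_fourierL1_exp`).

As μ is real, the localized symbol has modulus at most 1, so the kernel acts on L² with norm at most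
1, and on L¹ and L^∞ with norm at most A. Interpolation gives A^(2|1/p-1/2|) up to a constant
(`exists_eLpNorm_conv_le`), that is W^(n|1/p-1/2|max(2s,0)) ≤ W^(δn), which is the loss allowed by
the norm of the domain. The interpolation is a Marcinkiewicz truncation whose levels are scaled by
A; this scaling keeps the exact power of A.

The ℓ^q sum is then immediate, once the images of the pieces are known to be the pieces of one
tempered distribution. This distribution is the sum of the local images. The sum converges in 𝓢'
because a cutoff to high frequencies gains arbitrary powers in the Schwartz seminorms
(`exists_seminorm_cutoff_le`); uniqueness is density of the test functions. The decomposition enters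
only through a `CutoffSystem`, which exists both for the α-coverings and for the dyadic covering. -/

noncomputable section

namespace AlphaMod

open Filter Topology

/-! ### The Banach algebra of Fourier transforms of integrable functions. -/

section FourierAlgebra

variable {V : Type*} [NormedAddCommGroup V] [InnerProductSpace ℝ V] [FiniteDimensional ℝ V]
  [MeasurableSpace V] [BorelSpace V]

/-- `m` is the Fourier transform of an integrable function with `L¹` norm at most `a`. -/
def FourierL1 (m : V → ℂ) (a : ℝ) : Prop :=
  ∃ K : V → ℂ, Integrable K ∧ (∀ ξ, 𝓕 K ξ = m ξ) ∧ ∫ x, ‖K x‖ ≤ a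

/-- Convolution of complex functions. -/
abbrev conv (K F : V → ℂ) : V → ℂ := convolution K F (ContinuousLinearMap.mul ℂ ℂ) volume

lemma integral_norm_conv_le {K F : V → ℂ} (hK : Integrable K) (hF : Integrable F) :
    ∫ x, ‖conv K F x‖ ≤ (∫ x, ‖K x‖) * ∫ x, ‖F x‖ := by
  have hc := hK.norm.integrable_convolution (ContinuousLinearMap.mul ℝ ℝ) hF.norm
  calc ∫ x, ‖conv K F x‖
      ≤ ∫ x, convolution (fun x => ‖K x‖) (fun x => ‖F x‖) (ContinuousLinearMap.mul ℝ ℝ)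
          volume x := by
        refine integral_mono (hK.integrable_convolution _ hF).norm hc fun x => ?_
        refine (norm_integral_le_integral_norm _).trans (le_of_eq ?_)
        simp [convolution]
    _ = (∫ x, ‖K x‖) * ∫ x, ‖F x‖ := by
        rw [integral_convolution _ hK.norm hF.norm]
        simp

namespace FourierL1

variable {m m' : V → ℂ} {a a' : ℝ}

lemma mono (h : FourierL1 m a) (haa : a ≤ a') : FourierL1 m a' :=
  let ⟨K, hK, hm, ha⟩ := h
  ⟨K, hK, hm, ha.trans haa⟩

lemma congr (h : FourierL1 m a) (hm : ∀ ξ, m' ξ = m ξ) : FourierL1 m' a :=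
  let ⟨K, hK, hK', ha⟩ := h
  ⟨K, hK, fun ξ => (hK' ξ).trans (hm ξ).symm, ha⟩

lemma nonneg (h : FourierL1 m a) : 0 ≤ a :=
  let ⟨_, _, _, ha⟩ := h
  (integral_nonneg fun _ => norm_nonneg _).trans ha

lemma zero : FourierL1 (fun _ : V => 0) 0 :=
  ⟨0, integrable_zero _ _ _, fun ξ => by simp [Real.fourier_eq], by simp⟩

lemma _root_.Real.continuous_fourier_of_integrable {K : V → ℂ} (hK : Integrable K) :
    Continuous (𝓕 K) :=
  VectorFourier.fourierIntegral_continuous Real.continuous_fourierChar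
    (L := innerₗ V) continuous_inner hK

lemma continuous (h : FourierL1 m a) : Continuous m := by
  obtain ⟨K, hK, hm, -⟩ := h
  rw [← funext hm]
  exact Real.continuous_fourier_of_integrable hK

lemma _root_.Real.integrable_fourier_integrand {K : V → ℂ} (hK : Integrable K) (ξ : V) :
    Integrable fun x => Real.fourierChar (-inner ℝ x ξ) • K x :=
  (Real.fourierIntegral_convergent_iff ξ).2 hK

lemma add (h : FourierL1 m a) (h' : FourierL1 m' a') :
    FourierL1 (fun ξ => m ξ + m' ξ) (a + a') := by
  obtain ⟨K, hK, hm, ha⟩ := h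
  obtain ⟨K', hK', hm', ha'⟩ := h'
  refine ⟨fun x => K x + K' x, hK.add hK', fun ξ => ?_, ?_⟩
  · beta_reduce
    rw [← hm, ← hm', Real.fourier_eq, Real.fourier_eq, Real.fourier_eq, ← integral_add]
    · simp only [smul_add]
    · exact Real.integrable_fourier_integrand hK ξ
    · exact Real.integrable_fourier_integrand hK' ξ
  · calc ∫ x, ‖K x + K' x‖ ≤ ∫ x, (‖K x‖ + ‖K' x‖) :=
          integral_mono (hK.add hK').norm (hK.norm.add hK'.norm) fun x => norm_add_le _ _
      _ ≤ a + a' := by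
          rw [integral_add hK.norm hK'.norm]
          exact add_le_add ha ha'

lemma const_mul (h : FourierL1 m a) (c : ℂ) : FourierL1 (fun ξ => c * m ξ) (‖c‖ * a) := by
  obtain ⟨K, hK, hm, ha⟩ := h
  refine ⟨fun x => c * K x, hK.const_mul c, fun ξ => ?_, ?_⟩
  · beta_reduce
    rw [← hm, Real.fourier_eq, Real.fourier_eq, ← integral_const_mul]
    simp only [mul_smul_comm]
  · simp only [norm_mul, integral_const_mul]
    gcongr

lemma sum {ι : Type*} (s : Finset ι) {m : ι → V → ℂ} {a : ι → ℝ}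
    (h : ∀ i ∈ s, FourierL1 (m i) (a i)) :
    FourierL1 (fun ξ => ∑ i ∈ s, m i ξ) (∑ i ∈ s, a i) := by
  classical
  induction s using Finset.induction_on with
  | empty => simpa using zero
  | insert i s hi ih =>
    simp only [Finset.sum_insert hi]
    exact (h i (Finset.mem_insert_self i s)).add
      (ih fun j hj => h j (Finset.mem_insert_of_mem hj))

/-- Multiplying symbols is convolving kernels, and L¹ is a convolution algebra. -/
lemma mul (h : FourierL1 m a) (h' : FourierL1 m' a') :
    FourierL1 (fun ξ => m ξ * m' ξ) (a * a') := by
  have ha0 := h.nonneg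
  obtain ⟨K, hK, hm, ha⟩ := h
  obtain ⟨K', hK', hm', ha'⟩ := h'
  refine ⟨conv K K', hK.integrable_convolution _ hK', fun ξ => ?_,
    (integral_norm_conv_le hK hK').trans ?_⟩
  · rw [Real.fourier_mul_convolution_eq hK hK', hm, hm']
  · have : 0 ≤ ∫ x, ‖K' x‖ := integral_nonneg fun _ => norm_nonneg _
    gcongr

/-- Completeness of L¹: the kernels themselves are summed, and the series converges absolutely
almost everywhere because the sum of their norms has a finite integral. -/
lemma tsum {m : ℕ → V → ℂ} {a : ℕ → ℝ} (h : ∀ i, FourierL1 (m i) (a i)) (ha : Summable a) :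
    FourierL1 (fun ξ => ∑' i, m i ξ) (∑' i, a i) := by
  choose K hK hm hKa using h
  have hs : Summable fun i => ∫ x, ‖K i x‖ :=
    ha.of_nonneg_of_le (fun i => integral_nonneg fun _ => norm_nonneg _) hKa
  have hfin : ∑' i, ∫⁻ x, ‖K i x‖ₑ ≠ ∞ := by
    have h1 : ∀ i, ∫⁻ x, ‖K i x‖ₑ = ENNReal.ofReal (∫ x, ‖K i x‖) := fun i => by
      rw [ofReal_integral_norm_eq_lintegral_enorm (hK i)]
    simp only [h1]
    rw [← ENNReal.ofReal_tsum_of_nonneg (fun i => integral_nonneg fun _ => norm_nonneg _) hs]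
    exact ENNReal.ofReal_ne_top
  have hmeas : ∀ i, AEMeasurable (fun x => ‖K i x‖ₑ) volume := fun i => (hK i).1.enorm
  have hfin' : ∫⁻ x, ∑' i, ‖K i x‖ₑ ≠ ∞ := by rwa [lintegral_tsum hmeas]
  have hae : ∀ᵐ x, Summable fun i => ‖K i x‖ := by
    filter_upwards [ae_lt_top' (AEMeasurable.tsum hmeas) hfin'] with x hx
    rw [← tsum_enorm_ne_top_iff_summable_norm]
    exact hx.ne
  have hint : Integrable fun x => ∑' i, K i x := by
    refine ⟨?_, ?_⟩
    · refine aestronglyMeasurable_of_tendsto_ae atTop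
        (f := fun N x => ∑ i ∈ Finset.range N, K i x)
        (fun N => Finset.aestronglyMeasurable_fun_sum _ fun i _ => (hK i).1) ?_
      filter_upwards [hae] with x hx
      exact hx.of_norm.hasSum.tendsto_sum_nat
    · refine lt_of_le_of_lt (lintegral_mono_ae ?_) hfin'.lt_top
      filter_upwards [hae] with x hx
      exact enorm_tsum_le_tsum_enorm
  refine ⟨_, hint, fun ξ => ?_, ?_⟩
  · have hh : HasSum (fun i => ∫ x, Real.fourierChar (-inner ℝ x ξ) • K i x)
        (∫ x, ∑' i, Real.fourierChar (-inner ℝ x ξ) • K i x) := by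
      refine hasSum_integral_of_summable_integral_norm
        (fun i => Real.integrable_fourier_integrand (hK i) ξ) ?_
      simpa only [Circle.norm_smul] using hs
    have h2 : ∀ i, m i ξ = ∫ x, Real.fourierChar (-inner ℝ x ξ) • K i x := fun i => by
      rw [← hm, Real.fourier_eq]
    simp only [h2]
    rw [hh.tsum_eq, Real.fourier_eq]
    refine integral_congr_ae ?_
    filter_upwards [hae] with x hx
    simp only [Circle.smul_def]
    rw [tsum_const_smul'']
  · have hh := hasSum_integral_of_summable_integral_norm (fun i => (hK i).norm) (by simpa using hs)
    calc ∫ x, ‖∑' i, K i x‖ ≤ ∫ x, ∑' i, ‖K i x‖ := by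
          refine integral_mono_ae hint.norm ?_ ?_
          · refine ⟨?_, ?_⟩
            · refine aestronglyMeasurable_of_tendsto_ae atTop
                (f := fun N x => ∑ i ∈ Finset.range N, ‖K i x‖)
                (fun N => Finset.aestronglyMeasurable_fun_sum _ fun i _ => (hK i).1.norm) ?_
              filter_upwards [hae] with x hx
              exact hx.hasSum.tendsto_sum_nat
            · refine lt_of_le_of_lt (lintegral_mono_ae ?_) hfin'.lt_top
              filter_upwards [hae] with x hx
              refine enorm_tsum_le_tsum_enorm.trans ?_
              simp
          · filter_upwards [hae] with x hx
            exact norm_tsum_le_tsum_norm hx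
      _ = ∑' i, ∫ x, ‖K i x‖ := hh.tsum_eq.symm
      _ ≤ ∑' i, a i := hs.tsum_le_tsum hKa ha

lemma mul_pow (h : FourierL1 m a) (h' : FourierL1 m' a') (j : ℕ) :
    FourierL1 (fun ξ => m ξ * m' ξ ^ j) (a * a' ^ j) := by
  induction j with
  | zero => simpa using h
  | succ j ih =>
    simp only [pow_succ, ← mul_assoc]
    exact ih.mul h'

/-- The exponential series in the algebra. The factor `m` stands in for a unit: the constant 1, the
zeroth term of the series, is in general not the Fourier transform of an integrable function. -/
lemma mul_exp (h : FourierL1 m a) (h' : FourierL1 m' a') :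
    FourierL1 (fun ξ => m ξ * Complex.exp (m' ξ)) (a * Real.exp a') := by
  have hs : HasSum (fun j : ℕ => a * ((a' ^ j) / (j.factorial : ℝ))) (a * Real.exp a') := by
    rw [Real.exp_eq_exp_ℝ]
    exact (NormedSpace.expSeries_div_hasSum_exp a').mul_left a
  have key := tsum (m := fun j ξ => ((j.factorial : ℂ)⁻¹) * (m ξ * m' ξ ^ j))
    (a := fun j => a * ((a' ^ j) / (j.factorial : ℝ))) (fun j => by
      refine ((h.mul_pow h' j).const_mul _).mono (le_of_eq ?_)
      simp only [norm_inv, Complex.norm_natCast]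
      ring) hs.summable
  rw [hs.tsum_eq] at key
  refine key.congr fun ξ => ?_
  have h2 : HasSum (fun j : ℕ => (m' ξ ^ j) / (j.factorial : ℂ)) (Complex.exp (m' ξ)) := by
    rw [Complex.exp_eq_exp_ℂ]
    exact NormedSpace.expSeries_div_hasSum_exp (m' ξ)
  rw [← (h2.mul_left (m ξ)).tsum_eq]
  exact tsum_congr fun j => by ring

lemma comp_add (h : FourierL1 m a) (b : V) : FourierL1 (fun ξ => m (ξ + b)) a := by
  obtain ⟨K, hK, hm, ha⟩ := h
  refine ⟨fun x => Real.fourierChar (-inner ℝ x b) • K x,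
    Real.integrable_fourier_integrand hK b, fun ξ => ?_, by simpa only [Circle.norm_smul] using ha⟩
  beta_reduce
  rw [← hm, Real.fourier_eq, Real.fourier_eq]
  refine integral_congr_ae (ae_of_all _ fun x => ?_)
  simp only [smul_smul, inner_add_right, neg_add, AddChar.map_add_eq_mul]

/-- The function whose Fourier transform is `ξ ↦ 𝓕 K (t ξ)`. -/
def dilate (K : V → ℂ) (t : ℝ) (x : V) : ℂ :=
  ((|(t ^ Module.finrank ℝ V)⁻¹| : ℝ) : ℂ) * K (t⁻¹ • x)

lemma integrable_dilate {K : V → ℂ} (hK : Integrable K) {t : ℝ} (ht : t ≠ 0) :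
    Integrable (dilate K t) :=
  ((integrable_comp_smul_iff volume K (inv_ne_zero ht)).2 hK).const_mul _

lemma fourier_dilate (K : V → ℂ) {t : ℝ} (ht : t ≠ 0) (ξ : V) :
    𝓕 (dilate K t) ξ = 𝓕 K (t • ξ) := by
  have := Measure.integral_comp_smul (volume : Measure V)
    (fun x => Real.fourierChar (-inner ℝ x (t • ξ)) • K x) t⁻¹
  rw [Real.fourier_eq, Real.fourier_eq]
  have h1 : ∀ x : V, Real.fourierChar (-inner ℝ x ξ) • dilate K t x
      = ((|(t ^ Module.finrank ℝ V)⁻¹| : ℝ) : ℂ) *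
        (Real.fourierChar (-inner ℝ (t⁻¹ • x) (t • ξ)) • K (t⁻¹ • x)) := fun x => by
    rw [inner_smul_left, inner_smul_right, dilate, mul_smul_comm]
    simp [ht]
  simp only [h1]
  rw [integral_const_mul, this, inv_pow, inv_inv, Complex.real_smul, ← mul_assoc,
    ← Complex.ofReal_mul, ← abs_mul, inv_mul_cancel₀ (pow_ne_zero _ ht)]
  simp

lemma integral_norm_dilate (K : V → ℂ) {t : ℝ} (ht : t ≠ 0) :
    ∫ x, ‖dilate K t x‖ = ∫ x, ‖K x‖ := by
  have := Measure.integral_comp_smul (volume : Measure V) (fun x => ‖K x‖) t⁻¹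
  simp only [dilate, norm_mul, Complex.norm_real, Real.norm_eq_abs, abs_abs]
  rw [integral_const_mul, this, inv_pow, inv_inv, smul_eq_mul, ← mul_assoc, ← abs_mul,
    inv_mul_cancel₀ (pow_ne_zero _ ht)]
  simp

lemma comp_smul (h : FourierL1 m a) {t : ℝ} (ht : t ≠ 0) : FourierL1 (fun ξ => m (t • ξ)) a := by
  obtain ⟨K, hK, hm, ha⟩ := h
  exact ⟨dilate K t, integrable_dilate hK ht, fun ξ => by rw [fourier_dilate K ht, hm],
    (integral_norm_dilate K ht).le.trans ha⟩

/-- Modulating the symbol translates the kernel. This is why the linear part of a phase costs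
nothing. -/
lemma mul_character (h : FourierL1 m a) (v : V) :
    FourierL1 (fun ξ => ((Real.fourierChar (inner ℝ v ξ) : Circle) : ℂ) * m ξ) a := by
  obtain ⟨K, hK, hm, ha⟩ := h
  refine ⟨fun x => K (x + v), hK.comp_add_right v, fun ξ => ?_, ?_⟩
  · have := integral_add_right_eq_self (μ := (volume : Measure V))
      (fun x => Real.fourierChar (-inner ℝ (x - v) ξ) • K x) v
    simp only [add_sub_cancel_right] at this
    beta_reduce
    rw [← hm, Real.fourier_eq, Real.fourier_eq, this, ← integral_const_mul]
    refine integral_congr_ae (ae_of_all _ fun x => ?_)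
    beta_reduce
    rw [inner_sub_left, neg_sub, sub_eq_add_neg, AddChar.map_add_eq_mul, Circle.smul_def,
      Circle.coe_mul, smul_eq_mul, mul_assoc, Circle.smul_def, smul_eq_mul]
  · rwa [integral_add_right_eq_self (μ := (volume : Measure V)) (fun x => ‖K x‖) v]

/-- Superposition of a measurable family. -/
lemma superposition {T : Type*} [MeasurableSpace T] {ν : Measure T} [SFinite ν] {K : T → V → ℂ}
    (hK : Integrable (Function.uncurry K) (ν.prod volume)) :
    FourierL1 (fun ξ => ∫ t, 𝓕 (K t) ξ ∂ν) (∫ t, (∫ x, ‖K t x‖) ∂ν) := by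
  refine ⟨fun x => ∫ t, K t x ∂ν, hK.integral_prod_right, fun ξ => ?_, ?_⟩
  · simp only [Real.fourier_eq]
    have hc : Integrable (fun z : T × V => Real.fourierChar (-inner ℝ z.2 ξ) • K z.1 z.2)
        (ν.prod volume) := by
      refine hK.mono ?_ (ae_of_all _ fun z => by simp [Function.uncurry])
      refine AEStronglyMeasurable.fun_smul ?_ hK.1
      have hc : Continuous fun x : V => Real.fourierChar (-inner ℝ x ξ) :=
        Real.continuous_fourierChar.comp (by fun_prop)
      exact (hc.stronglyMeasurable.comp_measurable measurable_snd).aestronglyMeasurable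
    rw [integral_integral_swap hc]
    refine integral_congr_ae (ae_of_all _ fun x => ?_)
    simp only [Circle.smul_def]
    rw [integral_smul]
  · calc ∫ x, ‖∫ t, K t x ∂ν‖ ≤ ∫ x, ∫ t, ‖K t x‖ ∂ν := by
          refine integral_mono hK.integral_prod_right.norm hK.norm.integral_prod_right fun x => ?_
          exact norm_integral_le_integral_norm _
      _ = ∫ t, (∫ x, ‖K t x‖) ∂ν := by
          rw [integral_integral_swap (f := fun t x => ‖K t x‖) hK.norm]

/-- The average `∫₀¹ (1 - t) m(t ξ) dt` which occurs in Taylor's formula. -/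
lemma taylor_average (h : FourierL1 m a) :
    FourierL1 (fun ξ => ∫ t in (0 : ℝ)..1, ((1 - t : ℝ) : ℂ) * m (t • ξ)) a := by
  have ha0 := h.nonneg
  obtain ⟨K₀, hK₀, hm₀, ha₀⟩ := h
  -- A strongly measurable representative is needed so that `(t, x) ↦ K (t⁻¹ • x)` is jointly
  -- measurable.
  set K := hK₀.1.mk K₀ with hKdef
  have hKm : StronglyMeasurable K := hK₀.1.stronglyMeasurable_mk
  have hae : K₀ =ᵐ[volume] K := hK₀.1.ae_eq_mk
  have hK : Integrable K := hK₀.congr hae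
  have hm : ∀ ξ, 𝓕 K ξ = m ξ := fun ξ => by rw [← hm₀, Real.fourier_congr_ae hae]
  have ha : ∫ x, ‖K x‖ ≤ a := by
    refine le_trans (le_of_eq (integral_congr_ae ?_)) ha₀
    filter_upwards [hae] with x hx
    rw [hx]
  -- The half-open interval leaves out t = 0, where the dilation degenerates; for t > 0 it preserves
  -- the L¹ norm.
  set ν : Measure ℝ := volume.restrict (Set.Ioc 0 1)
  set L : ℝ → V → ℂ := fun t x => ((1 - t : ℝ) : ℂ) * dilate K t x with hL
  have hpos : ∀ᵐ t ∂ν, t ∈ Set.Ioc (0 : ℝ) 1 := ae_restrict_mem measurableSet_Ioc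
  have hLm : AEStronglyMeasurable (Function.uncurry L) (ν.prod volume) := by
    refine StronglyMeasurable.aestronglyMeasurable ?_
    have hd : Measurable fun t : ℝ => ((1 - t : ℝ) : ℂ) *
        ((|(t ^ Module.finrank ℝ V)⁻¹| : ℝ) : ℂ) := by fun_prop
    have hKc : StronglyMeasurable fun z : ℝ × V => K (z.1⁻¹ • z.2) :=
      hKm.comp_measurable ((measurable_fst.inv).smul measurable_snd)
    have h2 := (hd.comp measurable_fst).stronglyMeasurable.mul hKc
    have h3 : Function.uncurry L = ((fun t : ℝ => ((1 - t : ℝ) : ℂ) *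
        ((|(t ^ Module.finrank ℝ V)⁻¹| : ℝ) : ℂ)) ∘ Prod.fst) *
        fun z : ℝ × V => K (z.1⁻¹ • z.2) := by
      funext z
      simp only [Function.uncurry, hL, dilate, Pi.mul_apply, Function.comp_apply, mul_assoc]
    rwa [h3]
  have hnorm : ∀ t ∈ Set.Ioc (0 : ℝ) 1, ∫ x, ‖L t x‖ = (1 - t) * ∫ x, ‖K x‖ := fun t ht => by
    simp only [hL, norm_mul, Complex.norm_real, Real.norm_eq_abs]
    rw [integral_const_mul, integral_norm_dilate K ht.1.ne', abs_of_nonneg (by linarith [ht.2])]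
  have hLi : Integrable (Function.uncurry L) (ν.prod volume) := by
    rw [integrable_prod_iff hLm]
    refine ⟨?_, ?_⟩
    · filter_upwards [hpos] with t ht
      exact (integrable_dilate hK ht.1.ne').const_mul ((1 - t : ℝ) : ℂ)
    · have h1 : Integrable (fun t : ℝ => (1 - t) * ∫ x, ‖K x‖) ν :=
        ((by fun_prop : Continuous fun t : ℝ => (1 - t) * ∫ x, ‖K x‖).integrableOn_Icc
          (a := 0) (b := 1)).mono_set Set.Ioc_subset_Icc_self
      refine h1.congr ?_
      filter_upwards [hpos] with t ht
      exact (hnorm t ht).symm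
  refine ((superposition hLi).mono ?_).congr fun ξ => ?_
  · have hν : ν.real Set.univ = 1 := by simp [ν, Measure.real]
    calc ∫ t, (∫ x, ‖L t x‖) ∂ν ≤ ∫ _, a ∂ν := by
          refine integral_mono_ae hLi.norm.integral_prod_left ?_ ?_
          · have : IsFiniteMeasure ν := ⟨by simp [ν]⟩
            exact integrable_const a
          · filter_upwards [hpos] with t ht
            refine (hnorm t ht).le.trans ?_
            have := mul_le_mul (sub_le_self 1 ht.1.le) ha (integral_nonneg fun _ => norm_nonneg _)
              zero_le_one
            simpa using this
      _ = a := by rw [integral_const, hν, one_smul]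
  · rw [intervalIntegral.integral_of_le zero_le_one]
    refine integral_congr_ae ?_
    filter_upwards [hpos] with t ht
    have hf := fourier_dilate K ht.1.ne' ξ
    rw [hm] at hf
    rw [← hf, Real.fourier_eq, Real.fourier_eq, ← integral_const_mul]
    simp only [hL, mul_smul_comm]

end FourierL1

/-- Self-adjointness of the Fourier transform on integrable functions. -/
lemma integral_fourier_mul {f g : V → ℂ} (hf : Integrable f) (hg : Integrable g) :
    ∫ ξ, 𝓕 f ξ * g ξ = ∫ x, f x * 𝓕 g x := by
  have := VectorFourier.integral_fourierIntegral_smul_eq_flip (μ := volume) (ν := volume)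
    Real.continuous_fourierChar (L := innerₗ V) continuous_inner hf hg
  rw [flip_innerₗ] at this
  exact this

lemma integral_fourierInv_mul {f g : V → ℂ} (hf : Integrable f) (hg : Integrable g) :
    ∫ ξ, 𝓕⁻ f ξ * g ξ = ∫ x, f x * 𝓕⁻ g x := by
  have h1 := integral_fourier_mul hf hg.comp_neg
  rw [← integral_neg_eq_self] at h1
  simp only [neg_neg] at h1
  rw [Real.fourierInv_eq_fourier_comp_neg g]
  simpa only [Real.fourierInv_eq_fourier_neg] using h1

/-- Locally integrable functions are determined by their integrals against test functions. -/
lemma ae_eq_of_forall_integral_mul {f g : V → ℂ} (hf : LocallyIntegrable f)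
    (hg : LocallyIntegrable g)
    (h : ∀ Φ : 𝓢(V, ℂ), HasCompactSupport Φ → ∫ x, Φ x * f x = ∫ x, Φ x * g x) :
    f =ᵐ[volume] g := by
  refine ae_eq_of_integral_contDiff_smul_eq hf hg fun φ hφ hφc => ?_
  have h1 : HasCompactSupport (Complex.ofRealCLM ∘ φ) := hφc.comp_left rfl
  have h2 : ContDiff ℝ (⊤ : ℕ∞) (Complex.ofRealCLM ∘ φ) := by fun_prop
  have := h (h1.toSchwartzMap h2) h1
  simpa using this

/-- The kernel need not be continuous, so inversion holds only almost everywhere. It follows by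
duality from inversion on test functions, using self-adjointness twice. -/
lemma fourierInv_fourier_ae {K : V → ℂ} (hK : Integrable K) (hK' : Integrable (𝓕 K)) :
    𝓕⁻ (𝓕 K) =ᵐ[volume] K := by
  have hc : Continuous (𝓕⁻ (𝓕 K)) := by
    rw [Real.fourierInv_eq_fourier_comp_neg]
    exact Real.continuous_fourier_of_integrable hK'.comp_neg
  refine ae_eq_of_forall_integral_mul hc.locallyIntegrable hK.locallyIntegrable fun Φ _ => ?_
  rw [← integral_fourierInv_mul Φ.integrable hK', ← SchwartzMap.fourierInv_coe]
  simp only [mul_comm _ (𝓕 K _)]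
  rw [integral_fourier_mul hK (𝓕⁻ Φ).integrable, ← SchwartzMap.fourier_coe,
    fourier_fourierInv_eq]
  simp only [mul_comm]

namespace FourierL1

variable {m : V → ℂ} {a : ℝ}

/-- `FourierL1` only asserts that some kernel exists. For an integrable symbol this kernel is almost
everywhere the inverse Fourier integral, which gives a canonical choice. -/
lemma integrable_fourierInv (h : FourierL1 m a) (hm : Integrable m) :
    Integrable (𝓕⁻ m) ∧ ∫ x, ‖𝓕⁻ m x‖ ≤ a := by
  obtain ⟨K, hK, hKm, ha⟩ := h
  have hKm' : 𝓕 K = m := funext hKm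
  have h1 : 𝓕⁻ m =ᵐ[volume] K := by
    rw [← hKm']
    exact fourierInv_fourier_ae hK (by rwa [hKm'])
  refine ⟨hK.congr h1.symm, le_of_eq_of_le (integral_congr_ae ?_) ha⟩
  filter_upwards [h1] with x hx
  rw [hx]

lemma fourier_fourierInv (h : FourierL1 m a) (hm : Integrable m) : 𝓕 (𝓕⁻ m) = m := by
  refine h.continuous.fourier_fourierInv_eq hm ?_
  have := (h.integrable_fourierInv hm).1.comp_neg
  simpa only [Real.fourierInv_eq_fourier_neg, neg_neg] using this

lemma of_schwartz (Φ : 𝓢(V, ℂ)) : FourierL1 Φ (∫ x, ‖(𝓕⁻ Φ : 𝓢(V, ℂ)) x‖) :=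
  ⟨⇑(𝓕⁻ Φ : 𝓢(V, ℂ)), (𝓕⁻ Φ).integrable,
    fun ξ => by rw [← SchwartzMap.fourier_coe, fourier_fourierInv_eq], le_rfl⟩

/-- The Fourier transform of the translates of a cutoff function, averaged over all translations. -/
lemma of_translates {χ : V → ℂ} (hχ : Continuous χ) {ρ R a : ℝ}
    (hχs : ∀ ξ, ρ ≤ ‖ξ‖ → χ ξ = 0) (hχ1 : ∫ ξ, χ ξ ≠ 0)
    (c : V) (hm : Continuous m)
    (hms : ∀ ξ, R < ‖ξ - c‖ → m ξ = 0) (h : ∀ y, FourierL1 (fun ξ => χ (ξ - y) * m ξ) a) :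
    FourierL1 m (‖∫ ξ, χ ξ‖⁻¹ * (volume.real (Metric.closedBall c (R + ρ)) * a)) := by
  set ν : Measure V := volume.restrict (Metric.closedBall c (R + ρ))
  have hfin : IsFiniteMeasure ν := ⟨by
    simpa [ν] using (isCompact_closedBall c (R + ρ)).measure_lt_top⟩
  set M : V → V → ℂ := fun y ξ => χ (ξ - y) * m ξ
  have hmc : HasCompactSupport m := by
    refine HasCompactSupport.intro (isCompact_closedBall c R) fun ξ hξ => hms ξ ?_
    simpa [dist_eq_norm] using hξ
  have hMi : ∀ y, Integrable (M y) := fun y =>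
    (by fun_prop : Continuous (M y)).integrable_of_hasCompactSupport hmc.mul_left
  -- Kernels picked separately for each `y` need not be jointly measurable; the inverse Fourier
  -- integral depends on the parameters through a continuous integrand.
  set K : V → V → ℂ := fun y => 𝓕⁻ (M y) with hK
  have hKm : AEStronglyMeasurable (Function.uncurry K) (ν.prod volume) := by
    have hc : Continuous (Function.uncurry fun (z : V × V) (ξ : V) =>
        Real.fourierChar (inner ℝ ξ z.2) • (χ (ξ - z.1) * m ξ)) := by
      have h1 : Continuous fun z : (V × V) × V => inner ℝ z.2 z.1.2 := by fun_prop
      exact (Real.continuous_fourierChar.comp h1).smul (by fun_prop)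
    have h2 := (hc.stronglyMeasurable.integral_prod_right (ν := (volume : Measure V)))
    refine h2.aestronglyMeasurable.congr (ae_of_all _ fun z => ?_)
    simp only [Function.uncurry, hK, Real.fourierInv_eq, M]
  have hKi : Integrable (Function.uncurry K) (ν.prod volume) := by
    rw [integrable_prod_iff hKm]
    refine ⟨ae_of_all _ fun y => ((h y).integrable_fourierInv (hMi y)).1, ?_⟩
    refine Integrable.mono' (integrable_const a) hKm.norm.integral_prod_right'
      (ae_of_all _ fun y => ?_)
    rw [Real.norm_of_nonneg (integral_nonneg fun _ => norm_nonneg _)]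
    exact ((h y).integrable_fourierInv (hMi y)).2
  have key := (superposition hKi).const_mul (∫ ξ, χ ξ)⁻¹
  refine (key.mono ?_).congr fun ξ => ?_
  · rw [norm_inv]
    gcongr
    calc ∫ y, (∫ x, ‖K y x‖) ∂ν ≤ ∫ _, a ∂ν :=
          integral_mono hKi.norm.integral_prod_left (integrable_const a) fun y =>
            ((h y).integrable_fourierInv (hMi y)).2
      _ = _ := by simp [ν, integral_const]
  · have h1 : ∀ y, 𝓕 (K y) ξ = χ (ξ - y) * m ξ := fun y => by
      rw [hK, (h y).fourier_fourierInv (hMi y)]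
    simp only [h1]
    by_cases hξ : R < ‖ξ - c‖
    · simp [hms ξ hξ]
    -- For ‖ξ - c‖ ≤ R the translates centred outside the ball of radius R + ρ vanish at ξ, so the
    -- average may be taken over the whole space, where it equals ∫ χ.
    · rw [integral_mul_const, setIntegral_eq_integral_of_forall_compl_eq_zero,
        integral_sub_left_eq_self, ← mul_assoc, inv_mul_cancel₀ hχ1, one_mul]
      intro y hy
      refine hχs _ ?_
      rw [Metric.mem_closedBall, dist_eq_norm, not_le] at hy
      have := norm_sub_le (ξ - c) (ξ - y)
      rw [sub_sub_sub_cancel_left] at this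
      push Not at hξ
      linarith

end FourierL1

end FourierAlgebra


/-! ### Plancherel's theorem and the L² bound for convolutions. -/

section Plancherel

variable {V : Type*} [NormedAddCommGroup V] [InnerProductSpace ℝ V] [FiniteDimensional ℝ V]
  [MeasurableSpace V] [BorelSpace V]

/-- The Fourier integral and the Fourier transform of L² agree as distributions, hence almost
everywhere, so the isometry of L² carries over to the integral. -/
lemma eLpNorm_fourier_eq {f : V → ℂ} (hf : Integrable f) (hf2 : MemLp f 2) :
    MemLp (𝓕 f) 2 ∧ eLpNorm (𝓕 f) 2 = eLpNorm f 2 := by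
  set F : Lp ℂ 2 (volume : Measure V) := hf2.toLp f with hF
  have h1 : 𝓕 f =ᵐ[volume] (𝓕 F : Lp ℂ 2 (volume : Measure V)) := by
    refine ae_eq_of_forall_integral_mul
      (Real.continuous_fourier_of_integrable hf).locallyIntegrable
      ((Lp.memLp (μ := (volume : Measure V)) (𝓕 F)).locallyIntegrable (by norm_num)) fun Φ _ => ?_
    have h2 : Lp.toTemperedDistribution (𝓕 F) Φ = Lp.toTemperedDistribution F (𝓕 Φ) := by
      rw [← Lp.fourier_toTemperedDistribution_eq]
      rfl
    rw [Lp.toTemperedDistribution_apply, Lp.toTemperedDistribution_apply] at h2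
    simp only [smul_eq_mul] at h2
    rw [h2]
    have h3 : ∫ x, (𝓕 Φ) x * F x = ∫ x, (𝓕 Φ) x * f x := by
      refine integral_congr_ae ?_
      filter_upwards [hf2.coeFn_toLp] with x hx
      rw [hF, hx]
    rw [h3, SchwartzMap.fourier_coe, integral_fourier_mul Φ.integrable hf]
  refine ⟨(Lp.memLp (𝓕 F)).ae_eq h1.symm, ?_⟩
  rw [eLpNorm_congr_ae h1, ← eLpNorm_congr_ae hf2.coeFn_toLp]
  have := Lp.norm_fourier_eq F
  rw [Lp.norm_def, Lp.norm_def] at this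
  exact (ENNReal.toReal_eq_toReal_iff' (Lp.eLpNorm_ne_top _) (Lp.eLpNorm_ne_top _)).1 this

/-- Here `f` is not assumed to be in L²: this suits a convolution, which is a priori only integrable
and whose Fourier transform is seen to be in L². -/
lemma eLpNorm_eq_of_memLp_fourier {f : V → ℂ} (hf : Integrable f) (hf2 : MemLp (𝓕 f) 2) :
    eLpNorm f 2 = eLpNorm (𝓕 f) 2 := by
  set F : Lp ℂ 2 (volume : Measure V) := hf2.toLp (𝓕 f : V → ℂ) with hF
  have h1 : f =ᵐ[volume] (𝓕⁻ F : Lp ℂ 2 (volume : Measure V)) := by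
    refine ae_eq_of_forall_integral_mul hf.locallyIntegrable
      ((Lp.memLp (μ := (volume : Measure V)) (𝓕⁻ F)).locallyIntegrable (by norm_num)) fun Φ _ => ?_
    have h2 : Lp.toTemperedDistribution (𝓕⁻ F) Φ = Lp.toTemperedDistribution F (𝓕⁻ Φ) := by
      rw [← Lp.fourierInv_toTemperedDistribution_eq]
      rfl
    rw [Lp.toTemperedDistribution_apply, Lp.toTemperedDistribution_apply] at h2
    simp only [smul_eq_mul] at h2
    rw [h2]
    have h3 : ∫ x, (𝓕⁻ Φ : 𝓢(V, ℂ)) x * F x = ∫ x, 𝓕 f x * (𝓕⁻ Φ : 𝓢(V, ℂ)) x := by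
      refine integral_congr_ae ?_
      filter_upwards [hf2.coeFn_toLp] with x hx
      rw [hF, hx, mul_comm]
    rw [h3, integral_fourier_mul hf (𝓕⁻ Φ : 𝓢(V, ℂ)).integrable, ← SchwartzMap.fourier_coe,
      fourier_fourierInv_eq]
    simp only [mul_comm]
  rw [eLpNorm_congr_ae h1, ← eLpNorm_congr_ae hf2.coeFn_toLp]
  have := Lp.norm_fourier_eq (𝓕⁻ F)
  rw [fourier_fourierInv_eq, Lp.norm_def, Lp.norm_def] at this
  exact ((ENNReal.toReal_eq_toReal_iff' (Lp.eLpNorm_ne_top _) (Lp.eLpNorm_ne_top _)).1 this).symm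

/-- The integrand of `conv K F x` is integrable. -/
abbrev ConvAt (K F : V → ℂ) (x : V) : Prop :=
  ConvolutionExistsAt K F x (ContinuousLinearMap.mul ℂ ℂ) volume

lemma conv_apply (K F : V → ℂ) (x : V) : conv K F x = ∫ t, K t * F (x - t) := rfl

lemma convAt_iff {K F : V → ℂ} {x : V} : ConvAt K F x ↔ Integrable fun t => K t * F (x - t) :=
  Iff.rfl

lemma eLpNorm_conv_two_le_of_integrable {K F : V → ℂ} (hK : Integrable K) (hK1 : ∀ ξ, ‖𝓕 K ξ‖ ≤ 1)
    (hF : Integrable F) (hF2 : MemLp F 2) : eLpNorm (conv K F) 2 ≤ eLpNorm F 2 := by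
  have hc : Integrable (conv K F) := hK.integrable_convolution _ hF
  have h1 : 𝓕 (conv K F) = fun ξ => 𝓕 K ξ * 𝓕 F ξ :=
    funext fun ξ => Real.fourier_mul_convolution_eq hK hF ξ
  obtain ⟨hF3, hF4⟩ := eLpNorm_fourier_eq hF hF2
  have hle : ∀ ξ, ‖𝓕 K ξ * 𝓕 F ξ‖ ≤ ‖𝓕 F ξ‖ := fun ξ => by
    rw [norm_mul]
    exact mul_le_of_le_one_left (norm_nonneg _) (hK1 ξ)
  have h2 : MemLp (𝓕 (conv K F)) 2 := by
    rw [h1]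
    refine hF3.mono ?_ (ae_of_all _ hle)
    exact (Real.continuous_fourier_of_integrable hK).aestronglyMeasurable.mul hF3.1
  rw [eLpNorm_eq_of_memLp_fourier hc h2, ← hF4, h1]
  exact eLpNorm_mono hle

lemma tendsto_conv_indicator {K F : V → ℂ} {x : V} (h : ConvAt K F x)
    (hKm : AEStronglyMeasurable K) (hF : AEStronglyMeasurable F) :
    Tendsto (fun N : ℕ => conv K ((Metric.closedBall 0 (N : ℝ)).indicator F) x) atTop
      (𝓝 (conv K F x)) := by
  simp only [conv_apply]
  refine tendsto_integral_of_dominated_convergence (fun t => ‖K t * F (x - t)‖) (fun N => ?_)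
    (convAt_iff.1 h).norm (fun N => ae_of_all _ fun t => ?_) (ae_of_all _ fun t => ?_)
  · refine hKm.mul ?_
    refine (hF.indicator measurableSet_closedBall).comp_quasiMeasurePreserving ?_
    exact quasiMeasurePreserving_sub_left_of_right_invariant volume x
  · rw [norm_mul, norm_mul]
    gcongr
    exact norm_indicator_le_norm_self _ _
  · refine tendsto_const_nhds.congr' ?_
    filter_upwards [eventually_ge_atTop ⌈‖x - t‖⌉₊] with N hN
    rw [Set.indicator_of_mem]
    simpa using (Nat.le_ceil _).trans (Nat.cast_le.2 hN)

/-- `F` is cut off to balls of radius `N`, where it is integrable and Plancherel applies. The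
convolutions converge pointwise almost everywhere, and Fatou's lemma passes the bound to the limit.
-/
lemma eLpNorm_conv_two_le {K F : V → ℂ} (hK : Integrable K) (hK1 : ∀ ξ, ‖𝓕 K ξ‖ ≤ 1)
    (hF : MemLp F 2) (h : ∀ᵐ x, ConvAt K F x) : eLpNorm (conv K F) 2 ≤ eLpNorm F 2 := by
  have hN2 : ∀ N : ℕ, MemLp ((Metric.closedBall 0 (N : ℝ)).indicator F) 2 := fun N =>
    hF.indicator measurableSet_closedBall
  have hN1 : ∀ N : ℕ, Integrable ((Metric.closedBall 0 (N : ℝ)).indicator F) := fun N => by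
    rw [integrable_indicator_iff measurableSet_closedBall]
    have : IsFiniteMeasure ((volume : Measure V).restrict (Metric.closedBall 0 (N : ℝ))) :=
      ⟨by simpa using (isCompact_closedBall (0 : V) (N : ℝ)).measure_lt_top⟩
    exact (hF.restrict _).integrable (by norm_num)
  have hlim := Lp.eLpNorm_lim_le_liminf_eLpNorm (p := 2) (μ := (volume : Measure V))
    (f := fun N : ℕ => conv K ((Metric.closedBall 0 (N : ℝ)).indicator F))
    (fun N => (hK.integrable_convolution _ (hN1 N)).1) (conv K F) (by
      filter_upwards [h] with x hx
      exact tendsto_conv_indicator hx hK.1 hF.1)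
  refine hlim.trans ?_
  refine (liminf_le_liminf (v := fun _ => eLpNorm F 2) (Eventually.of_forall fun N => ?_)).trans
    (by simp)
  exact (eLpNorm_conv_two_le_of_integrable hK hK1 (hN1 N) (hN2 N)).trans
    (eLpNorm_indicator_le F)

lemma norm_conv_le {K F : V → ℂ} (hK : Integrable K) {B : ℝ} (hB : ∀ᵐ y, ‖F y‖ ≤ B)  (x : V) :
    ‖conv K F x‖ ≤ (∫ t, ‖K t‖) * B := by
  rw [conv_apply]
  refine (norm_integral_le_of_norm_le (hK.norm.mul_const B) ?_).trans
    (by rw [integral_mul_const])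
  have := (quasiMeasurePreserving_sub_left_of_right_invariant (volume : Measure V) x).ae hB
  filter_upwards [this] with t ht
  rw [norm_mul]
  gcongr

lemma convAt_of_bounded {K F : V → ℂ} (hK : Integrable K) (hF : AEStronglyMeasurable F) {B : ℝ}
    (hB : ∀ᵐ y, ‖F y‖ ≤ B) (x : V) : ConvAt K F x := by
  rw [convAt_iff]
  refine hK.mul_bdd (c := B) ?_ ?_
  · exact hF.comp_quasiMeasurePreserving
      (quasiMeasurePreserving_sub_left_of_right_invariant volume x)
  · exact (quasiMeasurePreserving_sub_left_of_right_invariant (volume : Measure V) x).ae hB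

lemma lintegral_enorm_conv_le {K F : V → ℂ} (hK : Integrable K) (hF : Integrable F) :
    ∫⁻ x, ‖conv K F x‖ₑ ≤ ENNReal.ofReal (∫ x, ‖K x‖) * ∫⁻ x, ‖F x‖ₑ := by
  rw [← ofReal_integral_norm_eq_lintegral_enorm hF,
    ← ofReal_integral_norm_eq_lintegral_enorm (hK.integrable_convolution _ hF),
    ← ENNReal.ofReal_mul (integral_nonneg fun _ => norm_nonneg _)]
  refine ENNReal.ofReal_le_ofReal ?_
  exact integral_norm_conv_le hK hF

end Plancherel


/-! ### Layer cake integrals over super- and sublevel sets. -/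

section LayerCake

variable {X : Type*} [MeasurableSpace X]

/-- This is the layer cake formula for the function f/c and the exponent r - k, with respect to the
measure f^k dμ. The product f^k f^(r-k) is not merged, since exponents of real powers need not add
up where f = 0. -/
lemma lintegral_layercake_above (μ : Measure X) {f : X → ℝ} (hf : Measurable f)
    (hf0 : ∀ x, 0 ≤ f x) {c r k : ℝ} (hc : 0 < c) (hkr : k < r) :
    ∫⁻ t in Set.Ioi (0 : ℝ), (∫⁻ x in {x | c * t < f x}, ENNReal.ofReal (f x ^ k) ∂μ) *
        ENNReal.ofReal (t ^ (r - k - 1)) =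
      ENNReal.ofReal ((r - k)⁻¹ * c ^ (k - r)) * ∫⁻ x, ENNReal.ofReal (f x ^ k * f x ^ (r - k)) ∂μ
      := by
  have hrk : 0 < r - k := by linarith
  set ν := μ.withDensity fun x => ENNReal.ofReal (f x ^ k)
  have hm : Measurable fun x => ENNReal.ofReal (f x ^ k) := by fun_prop
  have h := lintegral_rpow_eq_lintegral_meas_lt_mul ν (f := fun x => f x / c) (p := r - k)
    (ae_of_all _ fun x => div_nonneg (hf0 x) hc.le) (by fun_prop) hrk
  rw [lintegral_withDensity_eq_lintegral_mul _ hm (by fun_prop)] at h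
  have h1 : ∀ t, ν {x | t < f x / c} = ∫⁻ x in {x | c * t < f x}, ENNReal.ofReal (f x ^ k) ∂μ :=
    fun t => by
      have h2 : {x | t < f x / c} = {x | c * t < f x} := by
        ext x
        simp only [Set.mem_ofPred_eq, lt_div_iff₀ hc, mul_comm c]
      rw [h2, withDensity_apply _ (measurableSet_lt measurable_const hf)]
  simp only [h1] at h
  have h3 : ∀ x, ((fun x => ENNReal.ofReal (f x ^ k)) * fun x => ENNReal.ofReal
      ((f x / c) ^ (r - k))) x = ENNReal.ofReal (c ^ (k - r)) *
        ENNReal.ofReal (f x ^ k * f x ^ (r - k)) := fun x => by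
    have h0 := hf0 x
    rw [Pi.mul_apply, ← ENNReal.ofReal_mul (by positivity), ← ENNReal.ofReal_mul (by positivity),
      Real.div_rpow h0 hc.le, show k - r = -(r - k) by ring, Real.rpow_neg hc.le]
    congr 1
    ring
  simp only [h3] at h
  rw [lintegral_const_mul _ (by fun_prop)] at h
  rw [ENNReal.ofReal_mul (by positivity), mul_assoc, h, ← mul_assoc,
    ← ENNReal.ofReal_mul (by positivity), inv_mul_cancel₀ hrk.ne', ENNReal.ofReal_one, one_mul]

/-- After Tonelli, the inner integral is that of t^(r-k-1) over t ≥ f/c, which converges because r <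
k. -/
lemma lintegral_layercake_below (μ : Measure X) [SFinite μ] {f : X → ℝ} (hf : Measurable f)
    (hf0 : ∀ x, 0 ≤ f x) {c r k : ℝ} (hc : 0 < c) (hkr : r < k) (hr : 0 < r) :
    ∫⁻ t in Set.Ioi (0 : ℝ), (∫⁻ x in {x | f x ≤ c * t}, ENNReal.ofReal (f x ^ k) ∂μ) *
        ENNReal.ofReal (t ^ (r - k - 1)) ≤
      ENNReal.ofReal ((k - r)⁻¹ * c ^ (k - r)) * ∫⁻ x, ENNReal.ofReal (f x ^ r) ∂μ := by
  have hkr' : 0 < k - r := by linarith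
  have hs : MeasurableSet {z : ℝ × X | f z.2 ≤ c * z.1} :=
    measurableSet_le (hf.comp measurable_snd) (by fun_prop)
  have h1 : ∀ t, (∫⁻ x in {x | f x ≤ c * t}, ENNReal.ofReal (f x ^ k) ∂μ) *
        ENNReal.ofReal (t ^ (r - k - 1)) = ∫⁻ x, {z : ℝ × X | f z.2 ≤ c * z.1}.indicator
          (fun z => ENNReal.ofReal (f z.2 ^ k) * ENNReal.ofReal (z.1 ^ (r - k - 1))) (t, x) ∂μ :=
    fun t => by
      rw [← lintegral_indicator (measurableSet_le hf measurable_const),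
        ← lintegral_mul_const _ ((by fun_prop : Measurable fun x => ENNReal.ofReal
          (f x ^ k)).indicator (measurableSet_le hf measurable_const))]
      refine lintegral_congr fun x => ?_
      by_cases hx : f x ≤ c * t
      · rw [Set.indicator_of_mem (by exact hx), Set.indicator_of_mem (by exact hx)]
      · rw [Set.indicator_of_notMem (by exact hx), Set.indicator_of_notMem (by exact hx), zero_mul]
  simp only [h1]
  have hm := (by fun_prop : Measurable fun z : ℝ × X => ENNReal.ofReal
    (f z.2 ^ k) * ENNReal.ofReal (z.1 ^ (r - k - 1))).indicator hs
  rw [lintegral_lintegral_swap (f := fun t x => {z : ℝ × X | f z.2 ≤ c * z.1}.indicator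
    (fun z => ENNReal.ofReal (f z.2 ^ k) * ENNReal.ofReal (z.1 ^ (r - k - 1))) (t, x))
    hm.aemeasurable, ← lintegral_const_mul _ (by fun_prop)]
  refine lintegral_mono fun x => ?_
  rcases (hf0 x).eq_or_lt with h0 | h0
  · have : ∀ t, {z : ℝ × X | f z.2 ≤ c * z.1}.indicator
          (fun z => ENNReal.ofReal (f z.2 ^ k) * ENNReal.ofReal (z.1 ^ (r - k - 1))) (t, x) = 0 :=
      fun t => by
        refine Set.indicator_apply_eq_zero.2 fun _ => ?_
        simp only [← h0]
        rw [Real.zero_rpow (by linarith)]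
        simp
    simp only [this]
    simp
  · have ha : 0 < f x / c := div_pos h0 hc
    have hle : ∀ t, {z : ℝ × X | f z.2 ≤ c * z.1}.indicator
          (fun z => ENNReal.ofReal (f z.2 ^ k) * ENNReal.ofReal (z.1 ^ (r - k - 1))) (t, x) =
          (Set.Ici (f x / c)).indicator (fun t => ENNReal.ofReal (f x ^ k) *
            ENNReal.ofReal (t ^ (r - k - 1))) t := fun t => by
      by_cases hx : f x ≤ c * t
      · rw [Set.indicator_of_mem (by exact hx), Set.indicator_of_mem]
        rwa [Set.mem_Ici, div_le_iff₀ hc, mul_comm]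
      · rw [Set.indicator_of_notMem (by exact hx), Set.indicator_of_notMem]
        rwa [Set.mem_Ici, div_le_iff₀ hc, mul_comm]
    simp only [hle]
    refine (setLIntegral_le_lintegral _ _).trans ?_
    rw [lintegral_indicator measurableSet_Ici, lintegral_const_mul _ (by fun_prop),
      setLIntegral_congr Ioi_ae_eq_Ici.symm]
    have h2 := integral_Ioi_rpow_of_lt (a := r - k - 1) (by linarith) ha
    rw [← ofReal_integral_eq_lintegral_ofReal (integrableOn_Ioi_rpow_of_lt (by linarith) ha)
      ((ae_restrict_mem measurableSet_Ioi).mono fun t ht =>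
        Real.rpow_nonneg (ha.le.trans (le_of_lt ht)) _), h2, ← ENNReal.ofReal_mul (by positivity),
      ← ENNReal.ofReal_mul (by positivity)]
    refine ENNReal.ofReal_le_ofReal (le_of_eq ?_)
    rw [show r - k - 1 + 1 = -(k - r) by ring, Real.rpow_neg ha.le, Real.div_rpow h0.le hc.le,
      show r = k - (k - r) by ring, Real.rpow_sub h0, show k - (k - (k - r)) = k - r by ring]
    have : 0 < f x ^ (k - r) := Real.rpow_pos_of_pos h0 _
    have : 0 < c ^ (k - r) := Real.rpow_pos_of_pos hc _
    field_simp

end LayerCake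

/-! ### Splitting a function at a level. -/

section Truncation

variable {X : Type*}

/-- The part of `F` above the level `τ`. -/
def upperPart (F : X → ℂ) (τ : ℝ) : X → ℂ := {x | τ < ‖F x‖}.indicator F

/-- The part of `F` below the level `τ`. -/
def lowerPart (F : X → ℂ) (τ : ℝ) : X → ℂ := {x | ‖F x‖ ≤ τ}.indicator F

lemma upperPart_add_lowerPart (F : X → ℂ) (τ : ℝ) :
    upperPart F τ + lowerPart F τ = F := by
  have : {x | ‖F x‖ ≤ τ} = {x | τ < ‖F x‖}ᶜ := by
    ext x
    simp
  rw [upperPart, lowerPart, this, Set.indicator_self_add_compl]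

lemma norm_lowerPart_le (F : X → ℂ) {τ : ℝ} (hτ : 0 ≤ τ) (x : X) : ‖lowerPart F τ x‖ ≤ τ := by
  rw [lowerPart]
  by_cases h : x ∈ {x | ‖F x‖ ≤ τ}
  · rwa [Set.indicator_of_mem h]
  · rwa [Set.indicator_of_notMem h, norm_zero]

lemma measurableSet_upper [MeasurableSpace X] {F : X → ℂ} (hF : StronglyMeasurable F) (τ : ℝ) :
    MeasurableSet {x | τ < ‖F x‖} :=
  measurableSet_lt measurable_const hF.norm.measurable

lemma measurableSet_lower [MeasurableSpace X] {F : X → ℂ} (hF : StronglyMeasurable F) (τ : ℝ) :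
    MeasurableSet {x | ‖F x‖ ≤ τ} :=
  measurableSet_le hF.norm.measurable measurable_const

end Truncation

/-! ### Marcinkiewicz interpolation between L¹, L² and L^∞. -/

section Interpolation

variable {V : Type*} [NormedAddCommGroup V] [InnerProductSpace ℝ V] [FiniteDimensional ℝ V]
  [MeasurableSpace V] [BorelSpace V]

/-- By Chebyshev a superlevel set at a positive level has finite measure, and on it a larger
exponent of integrability implies a smaller one. -/
lemma memLp_upperPart {F : V → ℂ} (hFm : StronglyMeasurable F) {p q : ℝ≥0∞} (hF : MemLp F p)
    (hp0 : p ≠ 0) (hp : p ≠ ∞) (hqp : q ≤ p) {τ : ℝ} (hτ : 0 < τ) :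
    MemLp (upperPart F τ) q := by
  rw [upperPart, memLp_indicator_iff_restrict (measurableSet_upper hFm τ)]
  have : IsFiniteMeasure ((volume : Measure V).restrict {x | τ < ‖F x‖}) := ⟨by
    rw [Measure.restrict_apply_univ]
    refine lt_of_le_of_lt (measure_mono fun x hx => ?_)
      (hF.meas_ge_lt_top hp0 hp (ε := τ.toNNReal) (by simpa using hτ))
    rw [Set.mem_ofPred_eq] at hx ⊢
    rw [← NNReal.coe_le_coe, Real.coe_toNNReal _ hτ.le, coe_nnnorm]
    exact hx.le⟩
  exact (hF.restrict _).mono_exponent hqp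

lemma lintegral_enorm_upperPart_rpow {F : V → ℂ} (hF : StronglyMeasurable F) (τ : ℝ) {k : ℝ}
    (hk : 0 < k) : ∫⁻ x, ‖upperPart F τ x‖ₑ ^ k =
      ∫⁻ x in {x | τ < ‖F x‖}, ENNReal.ofReal (‖F x‖ ^ k) := by
  rw [← lintegral_indicator (measurableSet_upper hF τ)]
  refine lintegral_congr fun x => ?_
  rw [upperPart]
  by_cases h : x ∈ {x | τ < ‖F x‖}
  · rw [Set.indicator_of_mem h, Set.indicator_of_mem h, ← ofReal_norm,
      ENNReal.ofReal_rpow_of_nonneg (norm_nonneg _) hk.le]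
  · rw [Set.indicator_of_notMem h, Set.indicator_of_notMem h, enorm_zero, ENNReal.zero_rpow_of_pos hk]

lemma lintegral_enorm_lowerPart_rpow {F : V → ℂ} (hF : StronglyMeasurable F) (τ : ℝ) {k : ℝ}
    (hk : 0 < k) : ∫⁻ x, ‖lowerPart F τ x‖ₑ ^ k =
      ∫⁻ x in {x | ‖F x‖ ≤ τ}, ENNReal.ofReal (‖F x‖ ^ k) := by
  rw [← lintegral_indicator (measurableSet_lower hF τ)]
  refine lintegral_congr fun x => ?_
  rw [lowerPart]
  by_cases h : x ∈ {x | ‖F x‖ ≤ τ}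
  · rw [Set.indicator_of_mem h, Set.indicator_of_mem h, ← ofReal_norm,
      ENNReal.ofReal_rpow_of_nonneg (norm_nonneg _) hk.le]
  · rw [Set.indicator_of_notMem h, Set.indicator_of_notMem h, enorm_zero, ENNReal.zero_rpow_of_pos hk]

/-- Below the level τ one has |F|² ≤ τ^(2-r) |F|^r. -/
lemma memLp_two_lowerPart {F : V → ℂ} (hFm : StronglyMeasurable F) {r : ℝ}
    (hF : MemLp F (ENNReal.ofReal r)) (hr0 : 0 < r) (hr : r ≤ 2) {τ : ℝ} (hτ : 0 < τ) :
    MemLp (lowerPart F τ) 2 := by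
  refine ⟨(hFm.indicator (measurableSet_lower hFm τ)).aestronglyMeasurable, ?_⟩
  rw [eLpNorm_lt_top_iff_lintegral_rpow_enorm_lt_top (by norm_num) (by norm_num),
    show ENNReal.toReal 2 = 2 by norm_num, lintegral_enorm_lowerPart_rpow hFm τ two_pos]
  have h1 := (eLpNorm_lt_top_iff_lintegral_rpow_enorm_lt_top (by simpa using hr0)
    ENNReal.ofReal_ne_top).1 hF.2
  rw [ENNReal.toReal_ofReal hr0.le] at h1
  calc ∫⁻ x in {x | ‖F x‖ ≤ τ}, ENNReal.ofReal (‖F x‖ ^ (2 : ℝ))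
      ≤ ∫⁻ x in {x | ‖F x‖ ≤ τ}, ENNReal.ofReal (τ ^ (2 - r)) * ‖F x‖ₑ ^ r := by
        refine setLIntegral_mono' (measurableSet_lower hFm τ) fun x hx => ?_
        rw [← ofReal_norm, ENNReal.ofReal_rpow_of_nonneg (norm_nonneg _) hr0.le,
          ← ENNReal.ofReal_mul (by positivity)]
        refine ENNReal.ofReal_le_ofReal ?_
        rw [show (2 : ℝ) = (2 - r) + r by ring, Real.rpow_add_of_nonneg (norm_nonneg _)
          (by linarith) hr0.le, show (2 : ℝ) - r + r - r = 2 - r by ring]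
        have hx' : ‖F x‖ ≤ τ := hx
        have : 0 ≤ 2 - r := by linarith
        gcongr
    _ ≤ ∫⁻ x, ENNReal.ofReal (τ ^ (2 - r)) * ‖F x‖ₑ ^ r := setLIntegral_le_lintegral _ _
    _ < ∞ := by
        rw [lintegral_const_mul' _ _ ENNReal.ofReal_ne_top]
        exact ENNReal.mul_lt_top ENNReal.ofReal_lt_top h1

/-- The part of `F` above level 1 is integrable and the part below is bounded; the convolution with
`K` exists almost everywhere for the first and everywhere for the second. -/
lemma ae_convAt {K F : V → ℂ} (hK : Integrable K) (hFm : StronglyMeasurable F) {p : ℝ≥0∞}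
    (hp1 : 1 ≤ p) (hF : MemLp F p) : ∀ᵐ x, ConvAt K F x := by
  rcases eq_or_ne p ∞ with rfl | hp
  · refine ae_of_all _ fun x => convAt_of_bounded hK hF.1 (B := (eLpNorm F ∞).toReal) ?_ x
    filter_upwards [ae_le_eLpNormEssSup (f := F) (μ := (volume : Measure V))] with y hy
    rw [← toReal_enorm]
    exact ENNReal.toReal_mono hF.2.ne (by simpa using hy)
  · have h1 : Integrable (upperPart F 1) := memLp_one_iff_integrable.1
      (memLp_upperPart hFm hF (zero_lt_one.trans_le hp1).ne' hp hp1 one_pos)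
    filter_upwards [hK.ae_convolution_exists (ContinuousLinearMap.mul ℂ ℂ) h1] with x hx
    rw [← upperPart_add_lowerPart F 1]
    have h2 := convAt_of_bounded hK
      (hFm.indicator (measurableSet_lower hFm 1)).aestronglyMeasurable
      (ae_of_all _ (norm_lowerPart_le F zero_le_one)) x
    rw [convAt_iff] at h2 ⊢
    refine ((convAt_iff.1 hx).add h2).congr (ae_of_all _ fun t => ?_)
    simp only [Pi.add_apply, mul_add]
    rfl

lemma aestronglyMeasurable_conv {K F : V → ℂ} (hK : Integrable K) (hF : AEStronglyMeasurable F) :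
    AEStronglyMeasurable (conv K F) :=
  (hK.1.convolution_integrand (ContinuousLinearMap.mul ℂ ℂ) hF).integral_prod_right'

lemma conv_eq_upper_add_lower {K F : V → ℂ} (hK : Integrable K) (hFm : StronglyMeasurable F)
    {p : ℝ≥0∞} (hp1 : 1 ≤ p) (hp : p ≠ ∞) (hF : MemLp F p) {τ : ℝ} (hτ : 0 < τ) :
    ∀ᵐ x, conv K F x = conv K (upperPart F τ) x + conv K (lowerPart F τ) x := by
  have h1 : Integrable (upperPart F τ) := memLp_one_iff_integrable.1
    (memLp_upperPart hFm hF (zero_lt_one.trans_le hp1).ne' hp hp1 hτ)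
  filter_upwards [hK.ae_convolution_exists (ContinuousLinearMap.mul ℂ ℂ) h1] with x hx
  conv_lhs => rw [← upperPart_add_lowerPart F τ]
  exact hx.distrib_add (convAt_of_bounded hK
      (hFm.indicator (measurableSet_lower hFm τ)).aestronglyMeasurable
      (ae_of_all _ (norm_lowerPart_le F hτ.le)) x)

/-- Chebyshev's inequality in `L²` for a convolution. -/
lemma meas_conv_ge_le {K G : V → ℂ} (hK : Integrable K) (hK1 : ∀ ξ, ‖𝓕 K ξ‖ ≤ 1)
    (hG : MemLp G 2) (h : ∀ᵐ x, ConvAt K G x) {t : ℝ} (ht : 0 < t) :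
    volume {x | t ≤ ‖conv K G x‖} ≤ ENNReal.ofReal (t ^ (-2 : ℝ)) * ∫⁻ x, ‖G x‖ₑ ^ (2 : ℝ) := by
  have hm := aestronglyMeasurable_conv hK hG.1
  have h2 := eLpNorm_conv_two_le hK hK1 hG h
  have h3 := meas_ge_le_mul_pow_eLpNorm_enorm volume (p := 2) (by norm_num) (by norm_num) hm
    (ε := ENNReal.ofReal t) (by simpa using ht) (by simp)
  have h4 : eLpNorm (conv K G) 2 ^ (2 : ℝ) ≤ ∫⁻ x, ‖G x‖ₑ ^ (2 : ℝ) := by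
    refine (ENNReal.rpow_le_rpow h2 zero_le_two).trans (le_of_eq ?_)
    rw [eLpNorm_eq_lintegral_rpow_enorm_toReal (by norm_num) (by norm_num), ← ENNReal.rpow_mul]
    norm_num
  have h5 : {x | t ≤ ‖conv K G x‖} = {x | ENNReal.ofReal t ≤ ‖conv K G x‖ₑ} := by
    ext x
    simp only [Set.mem_ofPred_eq, ← ofReal_norm]
    rw [ENNReal.ofReal_le_ofReal_iff (norm_nonneg _)]
  rw [h5]
  refine h3.trans ?_
  rw [show ENNReal.toReal 2 = 2 by norm_num, ← ENNReal.ofReal_inv_of_pos ht,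
    ENNReal.ofReal_rpow_of_nonneg (by positivity) zero_le_two, Real.inv_rpow ht.le,
    ← Real.rpow_neg ht.le]
  gcongr

/-- At height t the function is split at level t/(2A). The low part convolves to at most t/2, by the
L^∞ bound, so only the high part counts; it is estimated by Chebyshev in L². Integration over t
produces the factor A^(r-2). -/
lemma lintegral_conv_rpow_le_of_two_lt {r : ℝ} (hr : 2 < r) {K F : V → ℂ} (hK : Integrable K)
    (hK1 : ∀ ξ, ‖𝓕 K ξ‖ ≤ 1) {A : ℝ} (hA : 0 < A) (hKA : ∫ x, ‖K x‖ ≤ A)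
    (hFm : StronglyMeasurable F) (hF : MemLp F (ENNReal.ofReal r)) :
    ∫⁻ x, ENNReal.ofReal (‖conv K F x‖ ^ r) ≤
      ENNReal.ofReal (r * 4 * (r - 2)⁻¹ * 2 ^ (r - 2) * A ^ (r - 2)) *
        ∫⁻ x, ENNReal.ofReal (‖F x‖ ^ r) := by
  have hr0 : 0 < r := by linarith
  have hm := aestronglyMeasurable_conv hK hF.1
  -- With this level, A times the bound c·t of the low part is exactly t/2.
  set c : ℝ := (2 * A)⁻¹ with hc
  have hc0 : 0 < c := by positivity
  have hr1 : 1 ≤ ENNReal.ofReal r := by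
    rw [← ENNReal.ofReal_one]
    exact ENNReal.ofReal_le_ofReal (by linarith)
  have hr2 : 2 ≤ ENNReal.ofReal r := by
    rw [← ENNReal.ofReal_ofNat]
    exact ENNReal.ofReal_le_ofReal hr.le
  have key : ∀ t : ℝ, 0 < t → volume {x | t < ‖conv K F x‖} ≤ ENNReal.ofReal (4 * t ^ (-2 : ℝ)) *
      ∫⁻ x in {x | c * t < ‖F x‖}, ENNReal.ofReal (‖F x‖ ^ (2 : ℝ)) := fun t ht => by
    have hτ : 0 < c * t := by positivity
    have hU2 : MemLp (upperPart F (c * t)) 2 :=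
      memLp_upperPart hFm hF (by simpa using hr0) ENNReal.ofReal_ne_top hr2 hτ
    have hU1 : Integrable (upperPart F (c * t)) := memLp_one_iff_integrable.1
      (memLp_upperPart hFm hF (by simpa using hr0) ENNReal.ofReal_ne_top hr1 hτ)
    have h1 : volume {x | t < ‖conv K F x‖} ≤
        volume {x | t / 2 ≤ ‖conv K (upperPart F (c * t)) x‖} := by
      refine measure_mono_ae ?_
      filter_upwards [conv_eq_upper_add_lower hK hFm hr1 ENNReal.ofReal_ne_top hF hτ] with x hx hxt
      have hxt' : t < ‖conv K F x‖ := hxt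
      change t / 2 ≤ ‖conv K (upperPart F (c * t)) x‖
      have h2 : ‖conv K (lowerPart F (c * t)) x‖ ≤ A * (c * t) :=
        (norm_conv_le hK (ae_of_all _ (norm_lowerPart_le F hτ.le)) x).trans (by gcongr)
      have h3 : A * (c * t) = t / 2 := by
        rw [hc]
        field_simp
      rw [hx] at hxt'
      have := norm_add_le (conv K (upperPart F (c * t)) x) (conv K (lowerPart F (c * t)) x)
      linarith
    refine h1.trans ((meas_conv_ge_le hK hK1 hU2 (hK.ae_convolution_exists _ hU1)
      (half_pos ht)).trans ?_)
    rw [lintegral_enorm_upperPart_rpow hFm _ two_pos, Real.div_rpow ht.le zero_le_two]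
    gcongr
    rw [Real.rpow_neg zero_le_two]
    norm_num
    linarith
  rw [lintegral_rpow_eq_lintegral_meas_lt_mul volume (ae_of_all _ fun x => norm_nonneg _)
    hm.norm.aemeasurable hr0]
  have h2 := lintegral_layercake_above (volume : Measure V) hFm.norm.measurable
    (fun x => norm_nonneg (F x)) hc0 hr
  have h3 : ∀ x, ENNReal.ofReal (‖F x‖ ^ (2 : ℝ) * ‖F x‖ ^ (r - 2)) = ENNReal.ofReal (‖F x‖ ^ r) :=
    fun x => by
      rw [← Real.rpow_add_of_nonneg (norm_nonneg _) zero_le_two (by linarith)]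
      ring_nf
  simp only [h3] at h2
  calc _ ≤ ENNReal.ofReal r * ∫⁻ t in Set.Ioi (0 : ℝ), ENNReal.ofReal 4 *
        ((∫⁻ x in {x | c * t < ‖F x‖}, ENNReal.ofReal (‖F x‖ ^ (2 : ℝ))) *
        ENNReal.ofReal (t ^ (r - 2 - 1))) := by
        gcongr ENNReal.ofReal r * ?_
        refine setLIntegral_mono' measurableSet_Ioi fun t ht => ?_
        have ht' : 0 < t := ht
        refine (mul_le_mul_left (key t ht') _).trans (le_of_eq ?_)
        rw [ENNReal.ofReal_mul (by norm_num), show r - 2 - 1 = -2 + (r - 1) by ring,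
          Real.rpow_add ht', ENNReal.ofReal_mul (by positivity)]
        ring
    _ = _ := by
        rw [lintegral_const_mul' _ _ ENNReal.ofReal_ne_top, h2, ← mul_assoc, ← mul_assoc,
          ← ENNReal.ofReal_mul (by positivity), ← ENNReal.ofReal_mul (by positivity)]
        congr 2
        rw [hc, Real.inv_rpow (by positivity), ← Real.rpow_neg (by positivity), neg_sub,
          Real.mul_rpow zero_le_two hA.le]
        ring

/-- At height t the function is split at level At. The high part uses the L¹ bound, with constant A,
and the low part the L² bound, with constant 1. This level balances the two contributions: both
scale like A^(2-r). -/
lemma lintegral_conv_rpow_le_of_lt_two {r : ℝ} (hr1 : 1 < r) (hr : r < 2) {K F : V → ℂ}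
    (hK : Integrable K) (hK1 : ∀ ξ, ‖𝓕 K ξ‖ ≤ 1) {A : ℝ} (hA : 0 < A) (hKA : ∫ x, ‖K x‖ ≤ A)
    (hFm : StronglyMeasurable F) (hF : MemLp F (ENNReal.ofReal r)) :
    ∫⁻ x, ENNReal.ofReal (‖conv K F x‖ ^ r) ≤
      ENNReal.ofReal (r * (2 * (r - 1)⁻¹ + 4 * (2 - r)⁻¹) * A ^ (2 - r)) *
        ∫⁻ x, ENNReal.ofReal (‖F x‖ ^ r) := by
  have hr0 : 0 < r := by linarith
  have hm := aestronglyMeasurable_conv hK hF.1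
  have hr1' : 1 ≤ ENNReal.ofReal r := by
    rw [← ENNReal.ofReal_one]
    exact ENNReal.ofReal_le_ofReal (by linarith)
  have key : ∀ t : ℝ, 0 < t → volume {x | t < ‖conv K F x‖} ≤
      ENNReal.ofReal (2 * A * t ^ (-1 : ℝ)) *
        (∫⁻ x in {x | A * t < ‖F x‖}, ENNReal.ofReal (‖F x‖ ^ (1 : ℝ))) +
      ENNReal.ofReal (4 * t ^ (-2 : ℝ)) *
        ∫⁻ x in {x | ‖F x‖ ≤ A * t}, ENNReal.ofReal (‖F x‖ ^ (2 : ℝ)) := fun t ht => by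
    have hτ : 0 < A * t := by positivity
    have hL2 : MemLp (lowerPart F (A * t)) 2 := memLp_two_lowerPart hFm hF hr0 hr.le hτ
    have hU1 : Integrable (upperPart F (A * t)) := memLp_one_iff_integrable.1
      (memLp_upperPart hFm hF (by simpa using hr0) ENNReal.ofReal_ne_top hr1' hτ)
    have h1 : volume {x | t < ‖conv K F x‖} ≤
        volume ({x | ENNReal.ofReal (t / 2) ≤ ‖conv K (upperPart F (A * t)) x‖ₑ} ∪
          {x | t / 2 ≤ ‖conv K (lowerPart F (A * t)) x‖}) := by
      refine measure_mono_ae ?_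
      filter_upwards [conv_eq_upper_add_lower hK hFm hr1' ENNReal.ofReal_ne_top hF hτ] with x hx hxt
      have hxt' : t < ‖conv K F x‖ := hxt
      rw [hx] at hxt'
      have := norm_add_le (conv K (upperPart F (A * t)) x) (conv K (lowerPart F (A * t)) x)
      by_cases h2 : t / 2 ≤ ‖conv K (upperPart F (A * t)) x‖
      · left
        change ENNReal.ofReal (t / 2) ≤ ‖conv K (upperPart F (A * t)) x‖ₑ
        rw [← ofReal_norm]
        exact ENNReal.ofReal_le_ofReal h2
      · right
        change t / 2 ≤ ‖conv K (lowerPart F (A * t)) x‖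
        linarith
    refine (h1.trans (measure_union_le _ _)).trans (add_le_add ?_ ?_)
    · have hmU := aestronglyMeasurable_conv hK hU1.1
      refine (meas_ge_le_lintegral_div hmU.enorm (by simpa using ht) ENNReal.ofReal_ne_top).trans ?_
      have h3 := lintegral_enorm_conv_le hK hU1
      have h4 := lintegral_enorm_upperPart_rpow hFm (A * t) one_pos
      simp only [ENNReal.rpow_one] at h4
      rw [h4] at h3
      rw [div_eq_mul_inv, ← ENNReal.ofReal_inv_of_pos (half_pos ht), mul_comm]
      refine (mul_le_mul_right h3 _).trans ?_
      rw [← mul_assoc, ← ENNReal.ofReal_mul (by positivity)]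
      gcongr ENNReal.ofReal ?_ * _
      rw [Real.rpow_neg_one, inv_div, div_mul_eq_mul_div, div_eq_mul_inv]
      gcongr
    · refine (meas_conv_ge_le hK hK1 hL2 (ae_of_all _ fun x => convAt_of_bounded hK hL2.1
        (ae_of_all _ (norm_lowerPart_le F hτ.le)) x) (half_pos ht)).trans ?_
      rw [lintegral_enorm_lowerPart_rpow hFm _ two_pos, Real.div_rpow ht.le zero_le_two]
      gcongr
      rw [Real.rpow_neg zero_le_two]
      norm_num
      linarith
  rw [lintegral_rpow_eq_lintegral_meas_lt_mul volume (ae_of_all _ fun x => norm_nonneg _)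
    hm.norm.aemeasurable hr0]
  have h2 := lintegral_layercake_above (volume : Measure V) hFm.norm.measurable
    (fun x => norm_nonneg (F x)) hA hr1
  have h2' := lintegral_layercake_below (volume : Measure V) hFm.norm.measurable
    (fun x => norm_nonneg (F x)) hA hr hr0
  have h3 : ∀ x, ENNReal.ofReal (‖F x‖ ^ (1 : ℝ) * ‖F x‖ ^ (r - 1)) = ENNReal.ofReal (‖F x‖ ^ r) :=
    fun x => by
      rw [← Real.rpow_add_of_nonneg (norm_nonneg _) zero_le_one (by linarith)]
      ring_nf
  simp only [h3] at h2
  -- Splitting the integral of a sum requires one measurable summand; the integral over the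
  -- superlevel set is antitone in t.
  have hmeas : Measurable fun t : ℝ => ENNReal.ofReal (2 * A) *
        ((∫⁻ x in {x | A * t < ‖F x‖}, ENNReal.ofReal (‖F x‖ ^ (1 : ℝ))) *
        ENNReal.ofReal (t ^ (r - 1 - 1))) := by
    have : Antitone fun t : ℝ => ∫⁻ x in {x | A * t < ‖F x‖}, ENNReal.ofReal (‖F x‖ ^ (1 : ℝ)) :=
      fun s t hst => lintegral_mono_set fun x (hx : A * t < ‖F x‖) =>
        lt_of_le_of_lt (by gcongr : A * s ≤ A * t) hx
    have := this.measurable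
    fun_prop
  calc _ ≤ ENNReal.ofReal r * ∫⁻ t in Set.Ioi (0 : ℝ), (ENNReal.ofReal (2 * A) *
        ((∫⁻ x in {x | A * t < ‖F x‖}, ENNReal.ofReal (‖F x‖ ^ (1 : ℝ))) *
        ENNReal.ofReal (t ^ (r - 1 - 1))) + ENNReal.ofReal 4 *
        ((∫⁻ x in {x | ‖F x‖ ≤ A * t}, ENNReal.ofReal (‖F x‖ ^ (2 : ℝ))) *
        ENNReal.ofReal (t ^ (r - 2 - 1)))) := by
        gcongr ENNReal.ofReal r * ?_
        refine setLIntegral_mono' measurableSet_Ioi fun t ht => ?_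
        have ht' : 0 < t := ht
        refine (mul_le_mul_left (key t ht') _).trans (le_of_eq ?_)
        rw [ENNReal.ofReal_mul (p := 2 * A) (by positivity), ENNReal.ofReal_mul (p := 4) (by positivity),
          show r - 2 - 1 = -2 + (r - 1) by ring, show r - 1 - 1 = -1 + (r - 1) by ring,
          Real.rpow_add ht', Real.rpow_add ht',
          ENNReal.ofReal_mul (p := t ^ (-2 : ℝ)) (by positivity),
          ENNReal.ofReal_mul (p := t ^ (-1 : ℝ)) (by positivity)]
        ring
    _ ≤ ENNReal.ofReal r * (ENNReal.ofReal (2 * A) * (ENNReal.ofReal ((r - 1)⁻¹ * A ^ (1 - r)) *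
          ∫⁻ x, ENNReal.ofReal (‖F x‖ ^ r)) + ENNReal.ofReal 4 *
          (ENNReal.ofReal ((2 - r)⁻¹ * A ^ (2 - r)) * ∫⁻ x, ENNReal.ofReal (‖F x‖ ^ r))) := by
        rw [lintegral_add_left hmeas, lintegral_const_mul' _ _ ENNReal.ofReal_ne_top,
          lintegral_const_mul' _ _ ENNReal.ofReal_ne_top, h2]
        gcongr
    _ = _ := by
        have e1 : 0 < r - 1 := by linarith
        have e2 : 0 < 2 - r := by linarith
        rw [← mul_assoc (ENNReal.ofReal (2 * A)), ← mul_assoc (ENNReal.ofReal 4), ← add_mul,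
          ← ENNReal.ofReal_mul (by positivity), ← ENNReal.ofReal_mul (by positivity),
          ← ENNReal.ofReal_add (by positivity) (by positivity), ← mul_assoc,
          ← ENNReal.ofReal_mul (by positivity)]
        congr 2
        rw [show (2 : ℝ) - r = 1 + (1 - r) by ring, Real.rpow_add hA, Real.rpow_one]
        ring

lemma eLpNorm_le_of_lintegral_le {f g : V → ℂ} {r : ℝ} (hr : 0 < r) {B : ℝ} (hB : 0 ≤ B)
    (h : ∫⁻ x, ENNReal.ofReal (‖f x‖ ^ r) ≤ ENNReal.ofReal B * ∫⁻ x, ENNReal.ofReal (‖g x‖ ^ r)) :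
    eLpNorm f (ENNReal.ofReal r) ≤
      ENNReal.ofReal (B ^ (1 / r)) * eLpNorm g (ENNReal.ofReal r) := by
  have h1 : ∀ x : ℂ, ENNReal.ofReal (‖x‖ ^ r) = ‖x‖ₑ ^ r := fun x => by
    rw [← ofReal_norm, ENNReal.ofReal_rpow_of_nonneg (norm_nonneg _) hr.le]
  simp only [h1] at h
  have hr0 : ENNReal.ofReal r ≠ 0 := by simpa using hr
  rw [eLpNorm_eq_lintegral_rpow_enorm_toReal hr0 ENNReal.ofReal_ne_top,
    eLpNorm_eq_lintegral_rpow_enorm_toReal hr0 ENNReal.ofReal_ne_top,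
    ENNReal.toReal_ofReal hr.le, ← ENNReal.ofReal_rpow_of_nonneg hB (by positivity),
    ← ENNReal.mul_rpow_of_nonneg _ _ (by positivity)]
  exact ENNReal.rpow_le_rpow h (by positivity)

/-- Convolution with an integrable kernel whose Fourier transform is bounded by one: the `Lᵖ` bound
obtained by interpolation between `L¹`, `L²` and `L^∞`. -/
theorem exists_eLpNorm_conv_le (p : ℝ≥0∞) (hp : 1 ≤ p) : ∃ C : ℝ, 0 < C ∧
    ∀ (K F : V → ℂ) (A : ℝ), Integrable K → (∀ ξ, ‖𝓕 K ξ‖ ≤ 1) → 0 < A → ∫ x, ‖K x‖ ≤ A →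
      MemLp F p → eLpNorm (conv K F) p ≤
        ENNReal.ofReal (C * A ^ (2 * |(p⁻¹).toReal - 1 / 2|)) * eLpNorm F p := by
  -- A strongly measurable representative makes the level sets of `F` measurable.
  suffices H : ∃ C : ℝ, 0 < C ∧ ∀ (K F : V → ℂ) (A : ℝ), Integrable K → (∀ ξ, ‖𝓕 K ξ‖ ≤ 1) →
      0 < A → ∫ x, ‖K x‖ ≤ A → StronglyMeasurable F → MemLp F p → eLpNorm (conv K F) p ≤
        ENNReal.ofReal (C * A ^ (2 * |(p⁻¹).toReal - 1 / 2|)) * eLpNorm F p by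
    obtain ⟨C, hC, h⟩ := H
    refine ⟨C, hC, fun K F A hK hK1 hA hKA hF => ?_⟩
    have h1 : conv K F = conv K (hF.1.mk F) :=
      convolution_congr _ (ae_eq_refl K) hF.1.ae_eq_mk
    have := h K (hF.1.mk F) A hK hK1 hA hKA hF.1.stronglyMeasurable_mk (hF.ae_eq hF.1.ae_eq_mk)
    rwa [← h1, ← eLpNorm_congr_ae hF.1.ae_eq_mk] at this
  rcases eq_or_ne p ∞ with rfl | hp'
  · refine ⟨1, one_pos, fun K F A hK hK1 hA hKA hFm hF => ?_⟩
    rw [ENNReal.inv_top, ENNReal.toReal_zero, show 2 * |(0 : ℝ) - 1 / 2| = 1 by norm_num [abs_of_neg],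
      Real.rpow_one, one_mul]
    have hb : ∀ᵐ y, ‖F y‖ ≤ (eLpNorm F ∞).toReal := by
      filter_upwards [ae_le_eLpNormEssSup (f := F) (μ := (volume : Measure V))] with y hy
      rw [← toReal_enorm]
      exact ENNReal.toReal_mono hF.2.ne (by simpa using hy)
    have h1 : ∀ x, ‖conv K F x‖ ≤ A * (eLpNorm F ∞).toReal := fun x =>
      (norm_conv_le hK hb x).trans (by gcongr)
    refine (eLpNormEssSup_le_of_ae_bound (ae_of_all _ h1)).trans (le_of_eq ?_)
    rw [ENNReal.ofReal_mul hA.le, ENNReal.ofReal_toReal hF.2.ne]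
  obtain ⟨r, rfl⟩ : ∃ r : ℝ, p = ENNReal.ofReal r := ⟨p.toReal, (ENNReal.ofReal_toReal hp').symm⟩
  have hr : 1 ≤ r := by
    rw [← ENNReal.ofReal_one, ENNReal.ofReal_le_ofReal_iff'] at hp
    rcases hp with h | h
    · exact h
    · linarith
  have hr0 : 0 < r := by linarith
  have hinv : ((ENNReal.ofReal r)⁻¹).toReal = 1 / r := by
    rw [ENNReal.toReal_inv, ENNReal.toReal_ofReal hr0.le, one_div]
  rw [hinv]
  rcases hr.eq_or_lt with rfl | hr1
  · refine ⟨1, one_pos, fun K F A hK hK1 hA hKA hFm hF => ?_⟩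
    rw [ENNReal.ofReal_one] at hF ⊢
    rw [show 2 * |(1 : ℝ) / 1 - 1 / 2| = 1 by norm_num [abs_of_pos], Real.rpow_one, one_mul,
      eLpNorm_one_eq_lintegral_enorm, eLpNorm_one_eq_lintegral_enorm]
    refine (lintegral_enorm_conv_le hK (memLp_one_iff_integrable.1 hF)).trans ?_
    gcongr
  -- The constants contain 1/(r - 1) and 1/|r - 2|, so the exponents 1, 2 and ∞ use the endpoint
  -- bounds directly.
  rcases lt_trichotomy r 2 with h2 | rfl | h2
  · have e1 : 0 < r - 1 := by linarith
    have e2 : 0 < 2 - r := by linarith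
    refine ⟨(r * (2 * (r - 1)⁻¹ + 4 * (2 - r)⁻¹)) ^ (1 / r), by positivity,
      fun K F A hK hK1 hA hKA hFm hF => ?_⟩
    refine (eLpNorm_le_of_lintegral_le hr0 (by positivity)
      (lintegral_conv_rpow_le_of_lt_two hr1 h2 hK hK1 hA hKA hFm hF)).trans (le_of_eq ?_)
    rw [Real.mul_rpow (by positivity) (by positivity), ← Real.rpow_mul hA.le, abs_of_nonneg]
    · congr 4
      field_simp
    · rw [sub_nonneg]
      exact one_div_le_one_div_of_le hr0 h2.le
  · refine ⟨1, one_pos, fun K F A hK hK1 hA hKA hFm hF => ?_⟩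
    rw [ENNReal.ofReal_ofNat] at hF ⊢
    simpa using eLpNorm_conv_two_le hK hK1 hF (ae_convAt hK hFm (by norm_num) hF)
  · have e2 : 0 < r - 2 := by linarith
    refine ⟨(r * 4 * (r - 2)⁻¹ * 2 ^ (r - 2)) ^ (1 / r), by positivity,
      fun K F A hK hK1 hA hKA hFm hF => ?_⟩
    refine (eLpNorm_le_of_lintegral_le hr0 (by positivity)
      (lintegral_conv_rpow_le_of_two_lt h2 hK hK1 hA hKA hFm hF)).trans (le_of_eq ?_)
    rw [Real.mul_rpow (by positivity) (by positivity), ← Real.rpow_mul hA.le, abs_of_nonpos]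
    · congr 4
      field_simp
      ring
    · rw [sub_nonpos]
      exact one_div_le_one_div_of_le two_pos h2.le

end Interpolation


/-! ### Exponentials of phases which are nearly affine. -/

section LocalPhase

variable {n : ℕ}

/-- The product of a Schwartz function with a quadratic monomial. -/
def quadraticMul (b : 𝓢(E n, ℂ)) (i j : Fin n) : 𝓢(E n, ℂ) :=
  SchwartzMap.smulLeftCLM ℂ (fun ξ : E n => ((ξ i * ξ j : ℝ) : ℂ)) b

lemma quadraticMul_apply (b : 𝓢(E n, ℂ)) (i j : Fin n) (ξ : E n) :
    quadraticMul b i j ξ = ((ξ i * ξ j : ℝ) : ℂ) * b ξ := by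
  have h : ∀ i : Fin n, Function.HasTemperateGrowth fun ξ : E n => ((ξ i : ℝ) : ℂ) := fun i =>
    (Complex.ofRealCLM.comp (EuclideanSpace.proj i : E n →L[ℝ] ℝ)).hasTemperateGrowth
  have h2 : Function.HasTemperateGrowth fun ξ : E n => ((ξ i * ξ j : ℝ) : ℂ) := by
    simpa only [Complex.ofReal_mul] using! (h i).mul (h j)
  rw [quadraticMul, SchwartzMap.smulLeftCLM_apply_apply h2, smul_eq_mul]

/-- On the support of `χ` the phase is its affine part plus the quadratic remainder. With `b`
inserted, each coordinate monomial is a Schwartz function and each Taylor average lies in 𝓕L¹, so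
the remainder lies in the algebra, with a bound that does not see the affine part. -/
lemma exists_fourierL1_exp_of_quadratic_remainder (χ b : 𝓢(E n, ℂ))
    (hχ : ∀ ζ, χ ζ ≠ 0 → ‖ζ‖ ≤ 1) (hb : ∀ ζ, ‖ζ‖ ≤ 1 → b ζ = 1) (A : ℝ) :
    ∃ C : ℝ, ∀ (ν : E n → ℝ) (c : ℝ) (w : E n) (h : Fin n → Fin n → E n → ℂ),
      (∀ v, ‖v‖ ≤ 1 → (ν v : ℂ) = c + (inner ℝ w v : ℝ) +
        ∑ i, ∑ j, ((v i * v j : ℝ) : ℂ) *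
          ∫ t in (0 : ℝ)..1, ((1 - t : ℝ) : ℂ) * h i j (t • v)) →
      (∀ i j, FourierL1 (fun ξ => b ξ * h i j ξ) A) →
      FourierL1 (fun ξ => χ ξ * Complex.exp (Complex.I * ν ξ)) C := by
  set B : Fin n → Fin n → ℝ := fun i j => ∫ x, ‖(𝓕⁻ (quadraticMul b i j) : 𝓢(E n, ℂ)) x‖
  refine ⟨(∫ x, ‖(𝓕⁻ χ : 𝓢(E n, ℂ)) x‖) * Real.exp (∑ i, ∑ j, B i j * A),
    fun ν c w h hν hh => ?_⟩
  have hR := FourierL1.sum Finset.univ fun i _ => FourierL1.sum Finset.univ fun j _ =>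
    (FourierL1.of_schwartz (quadraticMul b i j)).mul (hh i j).taylor_average
  -- The characters are e^{2πi x·ξ}, so the linear phase ⟨w, ξ⟩ is the character at w/(2π).
  have h1 := (((FourierL1.of_schwartz χ).mul_exp (hR.const_mul Complex.I)).const_mul
    (Complex.exp (Complex.I * c))).mul_character ((2 * Real.pi)⁻¹ • w)
  rw [mul_comm Complex.I, Complex.norm_exp_ofReal_mul_I, Complex.norm_I, one_mul, one_mul] at h1
  refine h1.congr fun ξ => ?_
  by_cases hξ : χ ξ = 0
  · simp [hξ]
  have hξ1 := hχ ξ hξ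
  -- The whole segment from 0 to ξ lies in the unit ball, where `b` is 1, so inserting `b` changes
  -- nothing.
  have hint : ∀ i j, ∫ t in (0 : ℝ)..1, ((1 - t : ℝ) : ℂ) * (b (t • ξ) * h i j (t • ξ)) =
      ∫ t in (0 : ℝ)..1, ((1 - t : ℝ) : ℂ) * h i j (t • ξ) := fun i j => by
    refine intervalIntegral.integral_congr fun t ht => ?_
    rw [Set.uIcc_of_le zero_le_one] at ht
    have : ‖t • ξ‖ ≤ 1 := by
      rw [norm_smul, Real.norm_of_nonneg ht.1]
      exact mul_le_one₀ ht.2 (norm_nonneg _) hξ1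
    simp only [hb _ this, one_mul]
  simp only [hint, quadraticMul_apply, hb ξ hξ1, mul_one]
  rw [hν ξ hξ1, mul_add, mul_add, Complex.exp_add, Complex.exp_add, Real.fourierChar_apply,
    inner_smul_left]
  have h2 : ((2 * Real.pi * ((starRingEnd ℝ) (2 * Real.pi)⁻¹ * inner ℝ w ξ) : ℝ) : ℂ) * Complex.I
      = Complex.I * (inner ℝ w ξ : ℝ) := by
    rw [conj_trivial, ← mul_assoc, mul_inv_cancel₀ (by positivity), one_mul, mul_comm]
  rw [h2, mul_comm (c : ℂ) Complex.I]
  ring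

lemma iteratedFDeriv_two_eq_sum (μ : E n → ℝ) (x v : E n) :
    iteratedFDeriv ℝ 2 μ x (fun _ => v) = ∑ i, ∑ j, v i * v j *
      iteratedFDeriv ℝ 2 μ x ![EuclideanSpace.single i 1, EuclideanSpace.single j 1] := by
  simp only [iteratedFDeriv_two_apply]
  have hv : v = ∑ i, v i • (EuclideanSpace.single i (1 : ℝ) : E n) := by
    have := (EuclideanSpace.basisFun (Fin n) ℝ).sum_repr v
    simpa using this.symm
  conv_lhs => rw [hv]
  simp only [map_sum, map_smul, FunLike.coe_sum, Finset.sum_apply,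
    FunLike.coe_smul, Pi.smul_apply, smul_eq_mul, Finset.mul_sum, mul_assoc]
  rw [Finset.sum_comm]
  refine Finset.sum_congr rfl fun i _ => Finset.sum_congr rfl fun j _ => ?_
  simp
  ring

lemma continuous_secondPartial {μ : E n → ℝ} (hμ : ContDiff ℝ 2 μ) (i j : Fin n) :
    Continuous (secondPartial μ i j) := by
  have h := hμ.continuous_iteratedFDeriv (m := 2) le_rfl
  exact Complex.continuous_ofReal.comp
    ((ContinuousMultilinearMap.apply ℝ (fun _ : Fin 2 => E n) ℝ
      ![EuclideanSpace.single i 1, EuclideanSpace.single j 1]).continuous.comp h)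

lemma taylor_two {μ : E n → ℝ} (hμ : ContDiff ℝ 2 μ) (y v : E n) :
    (μ (y + v) : ℂ) = μ y + (fderiv ℝ μ y v : ℝ) + ∑ i, ∑ j, ((v i * v j : ℝ) : ℂ) *
      ∫ t in (0 : ℝ)..1, ((1 - t : ℝ) : ℂ) * secondPartial μ i j (y + t • v) := by
  have h := map_add_eq_sum_add_integral_iteratedFDeriv (f := μ) (x := y) (y := v) (n := 1)
    fun t _ => by simpa [one_add_one_eq_two] using hμ.contDiffAt
  rw [Finset.sum_range_succ, Finset.sum_range_one] at h
  simp only [Nat.factorial_zero, Nat.factorial_one, Nat.cast_one, inv_one, one_smul,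
    iteratedFDeriv_zero_apply, iteratedFDeriv_one_apply, pow_one, Nat.reduceAdd,
    iteratedFDeriv_two_eq_sum] at h
  rw [h, Complex.ofReal_add, Complex.ofReal_add, ← intervalIntegral.integral_ofReal]
  congr 1
  have hint : ∀ i j, IntervalIntegrable (fun t : ℝ => ((v i * v j : ℝ) : ℂ) *
      (((1 - t : ℝ) : ℂ) * secondPartial μ i j (y + t • v))) volume 0 1 := fun i j => by
    have := continuous_secondPartial hμ i j
    exact Continuous.intervalIntegrable (by fun_prop) _ _
  have hint2 : ∀ i, IntervalIntegrable (fun t : ℝ => ∑ j, ((v i * v j : ℝ) : ℂ) *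
      (((1 - t : ℝ) : ℂ) * secondPartial μ i j (y + t • v))) volume 0 1 := fun i => by
    have := continuous_secondPartial hμ i
    exact Continuous.intervalIntegrable
      (continuous_finsetSum _ fun j _ => by have := this j; fun_prop) _ _
  simp only [← intervalIntegral.integral_const_mul]
  rw [← intervalIntegral.integral_congr (f := fun t : ℝ => ∑ i, ∑ j, ((v i * v j : ℝ) : ℂ) *
      (((1 - t : ℝ) : ℂ) * secondPartial μ i j (y + t • v))),
    intervalIntegral.integral_finsetSum fun i _ => hint2 i]
  · refine Finset.sum_congr rfl fun i _ => ?_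
    rw [intervalIntegral.integral_finsetSum fun j _ => hint i j]
  · intro t _
    simp only [secondPartial, smul_eq_mul, Finset.mul_sum]
    push_cast
    refine Finset.sum_congr rfl fun i _ => Finset.sum_congr rfl fun j _ => ?_
    ring

/-- If the second derivatives of the phase `μ` are of size `ρ⁻²` on a ball of radius `ρ`, then
`e^{iμ}`, localized to this ball, is the Fourier transform of an integrable function. -/
theorem exists_fourierL1_exp_local (χ b : 𝓢(E n, ℂ))
    (hχ : ∀ ζ, χ ζ ≠ 0 → ‖ζ‖ ≤ 1) (hb : ∀ ζ, ‖ζ‖ ≤ 1 → b ζ = 1) (A : ℝ) :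
    ∃ C : ℝ, ∀ (μ : E n → ℝ) (y : E n) (ρ : ℝ), ContDiff ℝ 2 μ → 0 < ρ →
      (∀ i j, FourierL1 (fun ξ => b (ρ⁻¹ • (ξ - y)) * secondPartial μ i j ξ) (A / ρ ^ 2)) →
      FourierL1 (fun ξ => χ (ρ⁻¹ • (ξ - y)) * Complex.exp (Complex.I * μ ξ)) C := by
  obtain ⟨C, hC⟩ := exists_fourierL1_exp_of_quadratic_remainder χ b hχ hb A
  refine ⟨C, fun μ y ρ hμ hρ hh => ?_⟩
  -- Rescaling to the unit ball multiplies the second derivatives by ρ², which cancels the ρ⁻² of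
  -- the hypothesis; affine substitutions preserve the norm of 𝓕L¹.
  have key := hC (fun v => μ (y + ρ • v)) (μ y)
    (ρ • (InnerProductSpace.toDual ℝ (E n)).symm (fderiv ℝ μ y))
    (fun i j v => (ρ ^ 2 : ℝ) * secondPartial μ i j (y + ρ • v)) (fun v _ => ?_) fun i j => ?_
  · have h2 := (key.comp_smul (inv_ne_zero hρ.ne')).comp_add (-y)
    refine h2.congr fun ξ => ?_
    rw [← sub_eq_add_neg, smul_inv_smul₀ hρ.ne', add_sub_cancel]
  · rw [taylor_two hμ, inner_smul_left, InnerProductSpace.toDual_symm_apply, map_smul]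
    congr 1
    refine Finset.sum_congr rfl fun i _ => Finset.sum_congr rfl fun j _ => ?_
    rw [← intervalIntegral.integral_const_mul, ← intervalIntegral.integral_const_mul]
    refine intervalIntegral.integral_congr fun t _ => ?_
    simp only [PiLp.smul_apply, smul_eq_mul, smul_comm t ρ v]
    push_cast
    ring
  · have h2 := (((hh i j).comp_add y).comp_smul hρ.ne').const_mul ((ρ ^ 2 : ℝ) : ℂ)
    refine (h2.mono (le_of_eq ?_)).congr fun ξ => ?_
    · rw [Complex.norm_real, Real.norm_of_nonneg (by positivity)]
      field_simp
    · rw [add_sub_cancel_right, inv_smul_smul₀ hρ.ne', add_comm y]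
      ring

end LocalPhase


/-! ### Pairing convolutions and multipliers with Schwartz functions. -/

section Pairing

variable {V : Type*} [NormedAddCommGroup V] [InnerProductSpace ℝ V] [FiniteDimensional ℝ V]
  [MeasurableSpace V] [BorelSpace V]

lemma exists_holderConjugate {p : ℝ≥0∞} (hp : 1 ≤ p) :
    ∃ p' : ℝ≥0∞, 1 ≤ p' ∧ ENNReal.HolderConjugate p p' := by
  have h : ENNReal.HolderConjugate p (1 - p⁻¹)⁻¹ := by
    constructor
    rw [inv_inv, inv_one, add_tsub_cancel_of_le (ENNReal.inv_le_one.2 hp)]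
  exact ⟨_, ENNReal.one_le_inv.2 tsub_le_self, h⟩

lemma integral_norm_mul_le {X : Type*} [MeasurableSpace X] {ν : Measure X} {p p' : ℝ≥0∞}
    [ENNReal.HolderConjugate p p']
    {F G : X → ℂ} (hF : MemLp F p ν) (hG : MemLp G p' ν) :
    ∫ x, ‖F x * G x‖ ∂ν ≤ (eLpNorm F p ν).toReal * (eLpNorm G p' ν).toReal := by
  have h : eLpNorm (F • G) 1 ν ≤ eLpNorm F p ν * eLpNorm G p' ν :=
    eLpNorm_smul_le_mul_eLpNorm hG.1 hF.1
  change ∫ x, ‖(F * G) x‖ ∂ν ≤ _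
  rw [integral_norm_eq_lintegral_enorm (hF.1.mul hG.1), ← ENNReal.toReal_mul,
    ← eLpNorm_one_eq_lintegral_enorm]
  exact ENNReal.toReal_mono (ENNReal.mul_ne_top hF.2.ne hG.2.ne) h

variable {p : ℝ≥0∞} {K F : V → ℂ}

/-- Hölder in the second variable, with a bound which is uniform in the first one because
translations preserve the norm of Φ. This justifies every use of Fubini below. -/
lemma integrable_pairing (hp : 1 ≤ p) (hK : Integrable K) (hF : MemLp F p) (Φ : 𝓢(V, ℂ)) :
    Integrable (fun z : V × V => K z.1 * (F z.2 * Φ (z.1 + z.2))) (volume.prod volume) := by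
  obtain ⟨p', hp', hpp⟩ := exists_holderConjugate hp
  have hm : AEStronglyMeasurable (fun z : V × V => K z.1 * (F z.2 * Φ (z.1 + z.2)))
      (volume.prod volume) := hK.1.comp_fst.mul (hF.1.comp_snd.mul
        (Φ.continuous.comp continuous_add).aestronglyMeasurable)
  have hΦ : ∀ x : V, MemLp (fun y => Φ (x + y)) p' ∧
      eLpNorm (fun y => Φ (x + y)) p' = eLpNorm Φ p' := fun x =>
    ⟨(Φ.memLp p').comp_measurePreserving (measurePreserving_add_left volume x),
      eLpNorm_comp_measurePreserving (Φ.memLp p').1 (measurePreserving_add_left volume x)⟩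
  rw [integrable_prod_iff hm]
  refine ⟨ae_of_all _ fun x => (hF.integrable_mul (hΦ x).1).const_mul (K x), ?_⟩
  refine Integrable.mono' (hK.norm.mul_const ((eLpNorm F p).toReal * (eLpNorm Φ p').toReal))
    hm.norm.integral_prod_right' (ae_of_all _ fun x => ?_)
  rw [Real.norm_of_nonneg (integral_nonneg fun _ => norm_nonneg _)]
  simp only [norm_mul (K x), integral_const_mul]
  gcongr
  rw [← (hΦ x).2]
  exact integral_norm_mul_le hF (hΦ x).1

lemma fourier_char_mul (f : V → ℂ) (x y : V) :
    𝓕 (fun ξ => (Real.fourierChar (inner ℝ x ξ) : ℂ) * f ξ) y = 𝓕 f (y - x) := by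
  rw [Real.fourier_eq, Real.fourier_eq]
  refine integral_congr_ae (ae_of_all _ fun ξ => ?_)
  simp only [Circle.smul_def, smul_eq_mul]
  rw [← mul_assoc, ← Circle.coe_mul, ← AddChar.map_add_eq_mul, inner_sub_right,
    real_inner_comm x ξ]
  congr 4
  ring

/-- Self-adjointness moves the transform from `K` to a modulation of 𝓕⁻ Φ, and modulation becomes
translation of Φ. -/
lemma fourier_fourier_mul_fourierInv (hK : Integrable K) (Φ : 𝓢(V, ℂ)) (y : V) :
    𝓕 (fun ξ => 𝓕 K ξ * (𝓕⁻ Φ : 𝓢(V, ℂ)) ξ) y = ∫ x, K x * Φ (x + y) := by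
  have hi : Integrable fun ξ => (Real.fourierChar (inner ℝ (-y) ξ) : ℂ) * (𝓕⁻ Φ : 𝓢(V, ℂ)) ξ := by
    refine (𝓕⁻ Φ).integrable.bdd_mul (c := 1) ?_ (ae_of_all _ fun ξ => (Circle.norm_coe _).le)
    exact (continuous_subtype_val.comp (Real.continuous_fourierChar.comp
      (by fun_prop))).aestronglyMeasurable
  have h := integral_fourier_mul hK hi
  simp only [fourier_char_mul, ← SchwartzMap.fourier_coe, fourier_fourierInv_eq,
    sub_neg_eq_add] at h
  rw [← h, Real.fourier_eq]
  refine integral_congr_ae (ae_of_all _ fun ξ => ?_)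
  simp only [Circle.smul_def, smul_eq_mul, inner_neg_left, real_inner_comm y ξ]
  ring

/-- Convolution with `K` is the Fourier multiplier with symbol `𝓕 K`. -/
lemma integral_conv_mul (hp : 1 ≤ p) (hK : Integrable K) (hF : MemLp F p) (Φ : 𝓢(V, ℂ)) :
    ∫ x, conv K F x * Φ x = ∫ y, F y * 𝓕 (fun ξ => 𝓕 K ξ * (𝓕⁻ Φ : 𝓢(V, ℂ)) ξ) y := by
  have h := integrable_pairing hp hK hF Φ
  -- The shear (x, z) ↦ (x, z - x) transports the integrability of the pairing to the integrand of
  -- the convolution.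
  have hs := (measurePreserving_prod_neg_add (volume : Measure V) (volume : Measure V))
  have h' : Integrable (fun z : V × V => K z.1 * (F (z.2 - z.1) * Φ z.2))
      (volume.prod volume) := by
    refine (hs.integrable_comp_of_integrable h).congr (ae_of_all _ fun z => ?_)
    simp [neg_add_eq_sub]
  simp only [fourier_fourier_mul_fourierInv hK, conv_apply, ← integral_mul_const,
    ← integral_const_mul]
  calc ∫ z, ∫ x, K x * F (z - x) * Φ z = ∫ z, ∫ x, K x * (F (z - x) * Φ z) := by
        simp only [mul_assoc]
    _ = ∫ x, ∫ z, K x * (F (z - x) * Φ z) := (integral_integral_swap h').symm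
    _ = ∫ x, ∫ y, K x * (F y * Φ (x + y)) := by
        refine integral_congr_ae (ae_of_all _ fun x => ?_)
        simp only
        rw [← integral_sub_right_eq_self (fun y => K x * (F y * Φ (x + y))) x]
        simp
    _ = ∫ y, ∫ x, K x * (F y * Φ (x + y)) := integral_integral_swap h
    _ = ∫ y, ∫ x, F y * (K x * Φ (x + y)) := by simp only [mul_left_comm]

/-- The pairing of `F` with the Fourier transform of `𝓕⁻ L · ψ`, as a superposition of the pairings
with the Fourier transforms of the modulations of `ψ`. -/
lemma integral_mul_fourier_mul (hp : 1 ≤ p) {L : V → ℂ} (hL : Integrable L) (hF : MemLp F p)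
    (ψ : 𝓢(V, ℂ)) :
    Integrable (fun x => L x *
      ∫ y, F y * 𝓕 (fun ξ => (Real.fourierChar (inner ℝ x ξ) : ℂ) * ψ ξ) y) ∧
    ∫ y, F y * 𝓕 (fun ξ => 𝓕⁻ L ξ * ψ ξ) y =
      ∫ x, L x * ∫ y, F y * 𝓕 (fun ξ => (Real.fourierChar (inner ℝ x ξ) : ℂ) * ψ ξ) y := by
  have hL' : Integrable fun x => L (-x) := hL.comp_neg
  have h := integrable_pairing hp hL' hF (𝓕 ψ)
  have key : ∀ x, L x * ∫ y, F y * 𝓕 (fun ξ => (Real.fourierChar (inner ℝ x ξ) : ℂ) * ψ ξ) y =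
      ∫ y, L (- -x) * (F y * (𝓕 ψ : 𝓢(V, ℂ)) (-x + y)) := fun x => by
    simp only [fourier_char_mul, ← SchwartzMap.fourier_coe, neg_neg, ← integral_const_mul,
      neg_add_eq_sub]
  simp only [key]
  have h1 := h.integral_prod_left
  refine ⟨h1.comp_neg, ?_⟩
  rw [integral_neg_eq_self (fun x => ∫ y, L (-x) * (F y * (𝓕 ψ : 𝓢(V, ℂ)) (x + y))),
    integral_integral_swap h]
  refine integral_congr_ae (ae_of_all _ fun y => ?_)
  have h2 := fourier_fourier_mul_fourierInv hL' (𝓕 ψ) y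
  rw [fourierInv_fourier_eq] at h2
  simp only [Real.fourierInv_eq_fourier_comp_neg, h2, ← integral_const_mul, mul_left_comm (F y)]

end Pairing

/-! ### Pieces of a distribution which are L^p functions. -/

section Distributions

variable {n : ℕ} {p : ℝ≥0∞} [Fact (1 ≤ p)]

/-- L^p embeds injectively into the tempered distributions, so the infimum runs over a single
function. -/
lemma distLpNorm_toTemperedDistribution (G : Lp ℂ p (volume : Measure (E n))) :
    distLpNorm p (Lp.toTemperedDistribution G) = ‖G‖ₑ := by
  refine le_antisymm (iInf₂_le_of_le G rfl le_rfl) (le_iInf₂ fun H hH => ?_)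
  have h : Lp.toTemperedDistributionCLM ℂ (volume : Measure (E n)) p (H - G) = 0 := by
    rw [map_sub, Lp.toTemperedDistributionCLM_apply, Lp.toTemperedDistributionCLM_apply, hH,
      sub_self]
  have h2 : H - G = 0 := by
    have := Lp.ker_toTemperedDistributionCLM_eq_bot (F := ℂ) (μ := (volume : Measure (E n))) (p := p)
    exact LinearMap.ker_eq_bot'.1 this _ h
  rw [sub_eq_zero.1 h2]

lemma integral_mul_eq_fourier_apply {η : 𝓢(E n, ℂ)} {f : 𝓢'(E n, ℂ)}
    {F : Lp ℂ p (volume : Measure (E n))}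
    (h : Lp.toTemperedDistribution F = TemperedDistribution.fourierMultiplierCLM ℂ η f)
    (Ψ : 𝓢(E n, ℂ)) :
    ∫ y, F y * 𝓕 (Ψ : E n → ℂ) y = 𝓕 f (SchwartzMap.smulLeftCLM ℂ η Ψ) := by
  have h1 := congrArg (fun u : 𝓢'(E n, ℂ) => u (𝓕 Ψ)) h
  simp only [TemperedDistribution.fourierMultiplierCLM_apply_apply, fourierInv_fourier_eq,
    Lp.toTemperedDistribution_apply, smul_eq_mul, mul_comm _ (F _)] at h1
  rw [TemperedDistribution.fourier_apply, ← h1, SchwartzMap.fourier_coe]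

end Distributions


/-! ### Gain of decay from high frequency cutoffs. -/

section SchwartzBounds

variable {V : Type*} [NormedAddCommGroup V] [NormedSpace ℝ V]

/-- `a` has derivatives bounded by `B` and is supported where `J ≤ A (1 + |ξ|)`. -/
structure IsCutoffAt (B : ℕ → ℝ) (A J : ℝ) (a : V → ℂ) : Prop where
  hasTemperateGrowth : a.HasTemperateGrowth
  norm_iteratedFDeriv_le : ∀ i ξ, ‖iteratedFDeriv ℝ i a ξ‖ ≤ B i
  pos : 0 < J
  le_of_mem_tsupport : ∀ ξ ∈ tsupport a, J ≤ A * (1 + ‖ξ‖)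

lemma continuous_finsetSup_schwartzSeminormFamily (s : Finset (ℕ × ℕ)) :
    Continuous (s.sup (schwartzSeminormFamily ℂ V ℂ) : Seminorm ℂ 𝓢(V, ℂ)) :=
  Seminorm.continuous_finsetSup fun i _ => (schwartz_withSeminorms ℂ V ℂ).continuous_seminorm i

/-- On the support of the cutoff, J^N is at most |A|^N (1 + |ξ|)^N, so it is paid for by N more
powers of decay of Ψ. Leibniz' rule and the uniform bounds `B` do the rest. -/
lemma exists_seminorm_smulLeft_le (k l N : ℕ) (B : ℕ → ℝ) (A : ℝ) :
    ∃ r : Seminorm ℂ 𝓢(V, ℂ), Continuous r ∧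
      ∀ (a : V → ℂ) (J : ℝ), IsCutoffAt B A J a → ∀ Ψ : 𝓢(V, ℂ),
        J ^ N * SchwartzMap.seminorm ℂ k l (SchwartzMap.smulLeftCLM ℂ a Ψ) ≤ r Ψ := by
  set b : ℝ := ∑ i ∈ Finset.range (l + 1), (l.choose i : ℝ) * |B i|
  set c : ℝ≥0 := ⟨|A| ^ N * (b * 2 ^ (N + k)), by positivity⟩
  refine ⟨c • (Finset.Iic (N + k, l)).sup (schwartzSeminormFamily ℂ V ℂ),
    (continuous_finsetSup_schwartzSeminormFamily _).const_smul c, fun a J ha Ψ => ?_⟩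
  have hJ := ha.pos
  set S := (Finset.Iic (N + k, l)).sup (schwartzSeminormFamily ℂ V ℂ) Ψ with hS
  have hS0 : 0 ≤ S := apply_nonneg _ _
  change _ ≤ |A| ^ N * (b * 2 ^ (N + k)) * S
  rw [← le_div_iff₀' (by positivity)]
  refine SchwartzMap.seminorm_le_bound ℂ k l _ (by positivity) fun ξ => ?_
  rw [le_div_iff₀' (by positivity)]
  have heq : ⇑(SchwartzMap.smulLeftCLM ℂ a Ψ) = fun ξ => a ξ * Ψ ξ :=
    funext fun ξ => SchwartzMap.smulLeftCLM_apply_apply ha.hasTemperateGrowth Ψ ξ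
  -- Off the closed support of `a` every derivative of the product vanishes.
  by_cases hξ : ξ ∈ tsupport a
  swap
  · have h0 : iteratedFDeriv ℝ l (⇑(SchwartzMap.smulLeftCLM ℂ a Ψ)) ξ = 0 := by
      by_contra hne
      refine hξ (closure_mono ?_ (support_iteratedFDeriv_subset l (Function.mem_support.2 hne)))
      rw [heq]
      exact fun x hx => left_ne_zero_of_mul hx
    rw [h0, norm_zero, mul_zero, mul_zero]
    positivity
  have hA : 0 ≤ A * (1 + ‖ξ‖) := hJ.le.trans (ha.le_of_mem_tsupport ξ hξ)
  have h1 : J ^ N ≤ |A| ^ N * (1 + ‖ξ‖) ^ N := by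
    rw [← mul_pow]
    refine pow_le_pow_left₀ hJ.le ((ha.le_of_mem_tsupport ξ hξ).trans ?_) N
    gcongr
    exact le_abs_self A
  have h2 : ‖iteratedFDeriv ℝ l (⇑(SchwartzMap.smulLeftCLM ℂ a Ψ)) ξ‖ ≤
      ∑ i ∈ Finset.range (l + 1), (l.choose i : ℝ) * |B i| * ‖iteratedFDeriv ℝ (l - i) Ψ ξ‖ := by
    rw [heq]
    refine (norm_iteratedFDeriv_mul_le (N := (l : ℕ∞)) (ha.hasTemperateGrowth.1.of_le (by exact_mod_cast le_top))
      (Ψ.smooth l) ξ le_rfl).trans ?_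
    gcongr with i _
    exact (ha.norm_iteratedFDeriv_le i ξ).trans (le_abs_self _)
  have h3 : ‖ξ‖ ^ k ≤ (1 + ‖ξ‖) ^ k := by gcongr; linarith
  calc J ^ N * (‖ξ‖ ^ k * ‖iteratedFDeriv ℝ l (⇑(SchwartzMap.smulLeftCLM ℂ a Ψ)) ξ‖)
      ≤ (|A| ^ N * (1 + ‖ξ‖) ^ N) * ((1 + ‖ξ‖) ^ k * ∑ i ∈ Finset.range (l + 1),
          (l.choose i : ℝ) * |B i| * ‖iteratedFDeriv ℝ (l - i) Ψ ξ‖) := by gcongr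
    _ = |A| ^ N * ∑ i ∈ Finset.range (l + 1), (l.choose i : ℝ) * |B i| *
          ((1 + ‖ξ‖) ^ (N + k) * ‖iteratedFDeriv ℝ (l - i) Ψ ξ‖) := by
        simp only [Finset.mul_sum, pow_add]
        exact Finset.sum_congr rfl fun i _ => by ring
    _ ≤ |A| ^ N * ∑ i ∈ Finset.range (l + 1), (l.choose i : ℝ) * |B i| * (2 ^ (N + k) * S) := by
        refine mul_le_mul_of_nonneg_left (Finset.sum_le_sum fun i _ => ?_) (by positivity)
        exact mul_le_mul_of_nonneg_left (SchwartzMap.one_add_le_sup_seminorm_apply (𝕜 := ℂ)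
          (m := (N + k, l)) le_rfl (Nat.sub_le l i) Ψ ξ) (by positivity)
    _ = |A| ^ N * (b * 2 ^ (N + k)) * S := by
        rw [← Finset.sum_mul]
        ring

/-- Multiplication by cutoffs which live at frequencies of size `J` gains every power of `J` in the
continuous seminorms of the Schwartz space. -/
lemma exists_seminorm_cutoff_le {q : Seminorm ℂ 𝓢(V, ℂ)} (hq : Continuous q) (N : ℕ)
    (B : ℕ → ℝ) (A : ℝ) : ∃ r : Seminorm ℂ 𝓢(V, ℂ), Continuous r ∧
      ∀ (a : V → ℂ) (J : ℝ), IsCutoffAt B A J a → ∀ Ψ : 𝓢(V, ℂ),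
        J ^ N * q (SchwartzMap.smulLeftCLM ℂ a Ψ) ≤ r Ψ := by
  obtain ⟨s, C, -, hC⟩ := Seminorm.bound_of_continuous (schwartz_withSeminorms ℂ V ℂ) q hq
  choose r hrc hr using fun i : ℕ × ℕ => exists_seminorm_smulLeft_le (V := V) i.1 i.2 N B A
  have hs : ∀ Ψ, (∑ i ∈ s, r i) Ψ = ∑ i ∈ s, r i Ψ := fun Ψ => by
    rw [FunLike.coe_sum, Finset.sum_apply]
  have hs' : ∀ Ψ, (∑ i ∈ s, schwartzSeminormFamily ℂ V ℂ i) Ψ =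
      ∑ i ∈ s, schwartzSeminormFamily ℂ V ℂ i Ψ := fun Ψ => by
    rw [FunLike.coe_sum, Finset.sum_apply]
  refine ⟨C • ∑ i ∈ s, r i, ?_, fun a J ha Ψ => ?_⟩
  · refine Continuous.const_smul ?_ C
    rw [funext hs]
    exact continuous_finsetSum _ fun i _ => hrc i
  · set Θ := SchwartzMap.smulLeftCLM ℂ a Ψ
    have hJ := ha.pos
    have h1 : q Θ ≤ C * ∑ i ∈ s, schwartzSeminormFamily ℂ V ℂ i Θ := by
      rw [← hs']
      exact (hC Θ).trans (mul_le_mul_of_nonneg_left (Seminorm.finset_sup_le_sum _ s Θ) C.2)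
    calc J ^ N * q Θ ≤ J ^ N * (C * ∑ i ∈ s, schwartzSeminormFamily ℂ V ℂ i Θ) := by gcongr
      _ = C * ∑ i ∈ s, J ^ N * schwartzSeminormFamily ℂ V ℂ i Θ := by
          simp only [Finset.mul_sum]
          exact Finset.sum_congr rfl fun i _ => by ring
      _ ≤ C * ∑ i ∈ s, r i Ψ := by
          gcongr with i _
          exact hr i a J ha Ψ
      _ = (C • ∑ i ∈ s, r i) Ψ := by rw [← hs]; rfl

end SchwartzBounds

/-- A pointwise convergent series of tempered distributions which is dominated by a continuous
seminorm defines a tempered distribution. -/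
lemma exists_hasSum_tempered {n : ℕ} {ι : Type*} (v : ι → 𝓢'(E n, ℂ))
    {r : Seminorm ℂ 𝓢(E n, ℂ)}
    (hr : Continuous r) {c : ι → ℝ} (hc : Summable c) (h : ∀ k Ψ, ‖v k Ψ‖ ≤ c k * r Ψ) :
    ∃ u : 𝓢'(E n, ℂ), ∀ Ψ, HasSum (fun k => v k Ψ) (u Ψ) := by
  have hs : ∀ Ψ, Summable fun k => v k Ψ := fun Ψ =>
    Summable.of_norm_bounded (hc.mul_right (r Ψ)) fun k => h k Ψ
  let L : 𝓢(E n, ℂ) →ₗ[ℂ] ℂ :=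
    { toFun := fun Ψ => ∑' k, v k Ψ
      map_add' := fun Ψ Φ => by simp only [map_add, (hs Ψ).tsum_add (hs Φ)]
      map_smul' := fun z Ψ => by simp only [map_smul, tsum_const_smul'', RingHom.id_apply] }
  have hL : ∀ Ψ, ‖L Ψ‖ ≤ (∑' k, c k) * r Ψ := fun Ψ =>
    tsum_of_norm_bounded (hc.hasSum.mul_right (r Ψ)) fun k => h k Ψ
  have hLc : Continuous L := by
    refine continuous_of_continuousAt_zero L ?_
    rw [ContinuousAt, map_zero]
    refine squeeze_zero_norm hL ?_
    have : Tendsto (fun Ψ => (∑' k, c k) * r Ψ) (𝓝 0) (𝓝 ((∑' k, c k) * r 0)) :=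
      (continuous_const.mul hr).tendsto 0
    rwa [map_zero, mul_zero] at this
  exact ⟨ContinuousLinearMap.toPointwiseConvergenceCLM _ _ _ _ ⟨L, hLc⟩, fun Ψ => (hs Ψ).hasSum⟩

/-- Schwartz bump functions: `1` on the ball of radius `r` and supported in the ball of radius
`R`. -/
lemma exists_schwartz_bump (n : ℕ) {r R : ℝ} (hr : 0 < r) (hR : r < R) : ∃ b : 𝓢(E n, ℂ),
    HasCompactSupport b ∧ (∀ ξ, ‖ξ‖ ≤ r → b ξ = 1) ∧ (∀ ξ, R ≤ ‖ξ‖ → b ξ = 0) ∧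
    (∀ ξ, ‖b ξ‖ ≤ 1 ∧ ‖1 - b ξ‖ ≤ 1) ∧ ∫ ξ, b ξ ≠ 0 := by
  let f : ContDiffBump (0 : E n) := ⟨r, R, hr, hR⟩
  have h1 : HasCompactSupport (Complex.ofRealCLM ∘ f) := f.hasCompactSupport.comp_left rfl
  have h2 : ContDiff ℝ (⊤ : ℕ∞) (Complex.ofRealCLM ∘ f) :=
    Complex.ofRealCLM.contDiff.comp f.contDiff
  refine ⟨h1.toSchwartzMap h2, h1, fun ξ hξ => ?_, fun ξ hξ => ?_, fun ξ => ?_, ?_⟩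
  · change ((f ξ : ℝ) : ℂ) = 1
    rw [f.one_of_mem_closedBall (by simpa [f] using hξ), Complex.ofReal_one]
  · change ((f ξ : ℝ) : ℂ) = 0
    rw [f.zero_of_le_dist (by simpa [f] using hξ), Complex.ofReal_zero]
  · change ‖((f ξ : ℝ) : ℂ)‖ ≤ 1 ∧ ‖1 - ((f ξ : ℝ) : ℂ)‖ ≤ 1
    rw [← Complex.ofReal_one, ← Complex.ofReal_sub, Complex.norm_real, Complex.norm_real,
      Real.norm_of_nonneg f.nonneg, Real.norm_of_nonneg (sub_nonneg.2 f.le_one)]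
    exact ⟨f.le_one, sub_le_self _ f.nonneg⟩
  · change ∫ ξ, ((f ξ : ℝ) : ℂ) ≠ 0
    rw [integral_complex_ofReal]
    exact_mod_cast (f.integral_pos (μ := volume)).ne'


/-- Cutoff functions adapted to a frequency decomposition: `inner k` is `1` on the support of
`symbol k`, and `outer k` is `1` on the support of `inner k`. The pieces have diameter at most
`weight k ^ α`, and each of them overlaps with boundedly many others of comparable weight. -/
structure CutoffSystem {n : ℕ} (α : ℝ) (D : FreqDecomp n) where
  inner : D.Index → 𝓢(E n, ℂ)
  outer : D.Index → 𝓢(E n, ℂ)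
  center : D.Index → E n
  near : D.Index → Finset D.Index
  size : D.Index → ℝ
  bound : ℝ
  maxCard : ℕ
  gap : ℝ
  derivBound : ℕ → ℝ
  growth : ℝ
  exponent : ℕ
  one_le_weight : ∀ k, 1 ≤ D.weight k
  hasSum_symbol : ∀ ξ, HasSum (fun k => D.symbol k ξ) 1
  inner_eq_one : ∀ k ξ, D.symbol k ξ ≠ 0 → inner k ξ = 1
  outer_eq_one : ∀ k ξ, inner k ξ ≠ 0 → outer k ξ = 1
  hasCompactSupport_outer : ∀ k, HasCompactSupport (outer k)
  norm_inner_le : ∀ k ξ, ‖inner k ξ‖ ≤ 1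
  bound_pos : 0 < bound
  fourierL1_inner : ∀ k, FourierL1 (inner k) bound
  inner_eq_zero : ∀ k ξ, bound * D.weight k ^ α < ‖ξ - center k‖ → inner k ξ = 0
  card_near_le : ∀ k, (near k).card ≤ maxCard
  weight_near_le : ∀ k, ∀ l ∈ near k, D.weight l ≤ bound * D.weight k
  weight_le_near : ∀ k, ∀ l ∈ near k, D.weight k ≤ bound * D.weight l
  gap_pos : 0 < gap
  sum_near : ∀ k ξ₀ ξ, inner k ξ₀ ≠ 0 → ‖ξ - ξ₀‖ ≤ gap * D.weight k ^ α →
    ∑ l ∈ near k, D.symbol l ξ = 1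
  isCutoffAt : ∀ k, IsCutoffAt derivBound growth (size k) (outer k)
  summable_size : Summable fun k => (size k ^ exponent)⁻¹

lemma le_lqNorm {ι : Type} {q : ℝ≥0∞} (hq : 1 ≤ q) (a : ι → ℝ≥0∞) (k : ι) : a k ≤ lqNorm q a := by
  unfold lqNorm
  split_ifs with h
  · exact le_iSup a k
  · have hq0 : 0 < q.toReal := ENNReal.toReal_pos (zero_lt_one.trans_le hq).ne' h
    calc a k = (a k ^ q.toReal) ^ (1 / q.toReal) := by
          rw [one_div, ENNReal.rpow_rpow_inv hq0.ne']
      _ ≤ _ := by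
          gcongr
          exact ENNReal.le_tsum k

lemma lqNorm_const_mul {ι : Type} {q : ℝ≥0∞} (hq : 1 ≤ q) (c : ℝ≥0∞) (a : ι → ℝ≥0∞) :
    lqNorm q (fun k => c * a k) = c * lqNorm q a := by
  unfold lqNorm
  split_ifs with h
  · rw [ENNReal.mul_iSup]
  · have hq0 : 0 < q.toReal := ENNReal.toReal_pos (zero_lt_one.trans_le hq).ne' h
    simp only [ENNReal.mul_rpow_of_nonneg _ _ hq0.le, ENNReal.tsum_mul_left]
    rw [ENNReal.mul_rpow_of_nonneg _ _ (by positivity), one_div, ENNReal.rpow_rpow_inv hq0.ne']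

lemma rpow_le_rpow_of_comparable {C x y : ℝ} (hC : 0 < C) (hx : 0 < x) (hy : 0 < y)
    (hxy : x ≤ C * y) (hyx : y ≤ C * x) (t : ℝ) : x ^ t ≤ C ^ |t| * y ^ t := by
  rcases le_total 0 t with ht | ht
  · rw [abs_of_nonneg ht, ← Real.mul_rpow hC.le hy.le]
    exact Real.rpow_le_rpow hx.le hxy ht
  · rw [abs_of_nonpos ht, Real.rpow_neg hC.le, ← Real.inv_rpow hC.le,
      ← Real.mul_rpow (by positivity) hy.le]
    refine Real.rpow_le_rpow_of_nonpos (by positivity) ?_ ht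
    rwa [inv_mul_le_iff₀ hC]

/-! ### What finiteness of the norms says about the individual pieces. -/

variable {n : ℕ}

lemma FreqDecomp.exists_toTemperedDistribution (D : FreqDecomp n) {p q : ℝ≥0∞} [Fact (1 ≤ p)]
    (hq : 1 ≤ q) {s : ℝ} {f : 𝓢'(E n, ℂ)} (hf : D.norm p q s f < ∞) {k : D.Index}
    (hW : 0 < D.weight k) : ∃ F : Lp ℂ p (volume : Measure (E n)),
      Lp.toTemperedDistribution F = TemperedDistribution.fourierMultiplierCLM ℂ (D.symbol k) f ∧
      ENNReal.ofReal (D.weight k ^ s) * ‖F‖ₑ ≤ D.norm p q s f := by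
  have h : ENNReal.ofReal (D.weight k ^ s) *
      distLpNorm p (TemperedDistribution.fourierMultiplierCLM ℂ (D.symbol k) f) ≤
      D.norm p q s f := le_lqNorm hq _ k
  have h0 : ENNReal.ofReal (D.weight k ^ s) ≠ 0 := by
    rw [ne_eq, ENNReal.ofReal_eq_zero, not_le]
    positivity
  obtain ⟨F, hF⟩ := distLpNorm_lt_top (ENNReal.lt_top_of_mul_ne_top_right
    (h.trans_lt hf).ne h0)
  refine ⟨F, hF, ?_⟩
  rwa [← hF, distLpNorm_toTemperedDistribution] at h

/-- The k-th piece of 𝓕⁻ u is an L¹ function whose Fourier transform is `D.symbol k` times `h`; the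
ℓ^∞ norm bounds all these L¹ norms, with the weight moved to the right. -/
lemma FreqDecomp.MemFourier.exists_fourierL1 {D : FreqDecomp n} {t : ℝ} {h : E n → ℂ}
    (hh : D.MemFourier 1 ∞ t h) (hc : Continuous h) (hW : ∀ k, 0 < D.weight k) :
    ∃ C : ℝ, 0 ≤ C ∧ ∀ k, FourierL1 (fun ξ => D.symbol k ξ * h ξ) (C * D.weight k ^ (-t)) := by
  obtain ⟨u, hu, huD⟩ := hh
  have huD' : D.norm 1 ∞ t (𝓕⁻ u) < ∞ := huD
  refine ⟨(D.norm 1 ∞ t (𝓕⁻ u)).toReal, ENNReal.toReal_nonneg, fun k => ?_⟩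
  obtain ⟨G, hG, hGn⟩ := D.exists_toTemperedDistribution le_top huD' (hW k)
  have hGi : Integrable G := memLp_one_iff_integrable.1 (Lp.memLp G)
  refine ⟨G, hGi, ?_, ?_⟩
  · have hc1 := Real.continuous_fourier_of_integrable hGi
    have hc2 : Continuous fun ξ => D.symbol k ξ * h ξ := (D.symbol k).continuous.mul hc
    -- Both sides are continuous, so testing against compactly supported functions gives equality at
    -- every point.
    refine congrFun ((hc1.ae_eq_iff_eq volume hc2).1 ?_)
    refine ae_eq_of_forall_integral_mul hc1.locallyIntegrable hc2.locallyIntegrable fun Φ hΦ => ?_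
    have h1 := integral_mul_eq_fourier_apply hG Φ
    rw [← integral_fourier_mul hGi Φ.integrable, fourier_fourierInv_eq, hu] at h1
    · simp only [mul_comm (Φ _), h1]
      refine integral_congr_ae (ae_of_all _ fun ξ => ?_)
      simp only [SchwartzMap.smulLeftCLM_apply_apply (D.symbol k).hasTemperateGrowth, smul_eq_mul]
      ring
    · refine hΦ.mono fun ξ hξ => ?_
      rw [Function.mem_support, SchwartzMap.smulLeftCLM_apply_apply
        (D.symbol k).hasTemperateGrowth] at hξ
      exact right_ne_zero_of_mul hξ
  · have hpos : 0 < D.weight k ^ t := Real.rpow_pos_of_pos (hW k) t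
    rw [Real.rpow_neg (hW k).le, ← div_eq_mul_inv, le_div_iff₀' hpos, ← L1.norm_eq_integral_norm,
      ← toReal_enorm, ← ENNReal.toReal_ofReal hpos.le, ← ENNReal.toReal_mul]
    exact ENNReal.toReal_mono huD'.ne hGn


/-! ### The multiplier e^{iμ} on a single piece. -/

variable {n : ℕ}

lemma FourierL1.of_schwartz_rescale (b : 𝓢(E n, ℂ)) {ρ : ℝ} (hρ : ρ ≠ 0) (y : E n) :
    FourierL1 (fun ξ => b (ρ⁻¹ • (ξ - y))) (∫ x, ‖(𝓕⁻ b : 𝓢(E n, ℂ)) x‖) :=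
  (((FourierL1.of_schwartz b).comp_smul (inv_ne_zero hρ)).comp_add (-y)).congr fun ξ => by
    rw [sub_eq_add_neg]

namespace CutoffSystem

variable {α : ℝ} {D : FreqDecomp n} (S : CutoffSystem α D)

lemma weight_pos (S : CutoffSystem α D) (k : D.Index) : 0 < D.weight k := zero_lt_one.trans_le (S.one_le_weight k)

/-- The radius of the balls on which the phase is close to an affine function. -/
def radius (s : ℝ) (k : D.Index) : ℝ := S.gap / 3 * D.weight k ^ (α - max s 0)

lemma radius_pos (s : ℝ) (k : D.Index) : 0 < S.radius s k :=
  mul_pos (div_pos S.gap_pos three_pos) (Real.rpow_pos_of_pos (S.weight_pos k) _)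

lemma three_mul_radius_le (s : ℝ) (k : D.Index) : 3 * S.radius s k ≤ S.gap * D.weight k ^ α := by
  have h := Real.rpow_le_rpow_of_exponent_le (S.one_le_weight k)
    (sub_le_self α (le_max_right s 0))
  have := mul_le_mul_of_nonneg_left h S.gap_pos.le
  rw [radius]
  linarith

/-- On a ball of this radius near the k-th piece the boundedly many neighbouring symbols sum to 1,
so `h` may be replaced by the sum of its pieces, each controlled by a comparable weight. -/
lemma exists_fourierL1_near (b : 𝓢(E n, ℂ)) (hb : ∀ ζ, 2 ≤ ‖ζ‖ → b ζ = 0) {s : ℝ} {h : E n → ℂ}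
    {C : ℝ} (hC : 0 ≤ C)
    (hh : ∀ k, FourierL1 (fun ξ => D.symbol k ξ * h ξ) (C * D.weight k ^ (-(2 * α - 2 * s)))) :
    ∃ A, 0 ≤ A ∧ ∀ k y ξ₀, S.inner k ξ₀ ≠ 0 → ‖ξ₀ - y‖ ≤ S.radius s k →
      FourierL1 (fun ξ => b ((S.radius s k)⁻¹ • (ξ - y)) * h ξ) (A / S.radius s k ^ 2) := by
  set I := ∫ x, ‖(𝓕⁻ b : 𝓢(E n, ℂ)) x‖
  have hI : 0 ≤ I := integral_nonneg fun _ => norm_nonneg _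
  set c := S.bound ^ |-(2 * α - 2 * s)|
  have hc : 0 ≤ c := Real.rpow_nonneg S.bound_pos.le _
  refine ⟨S.maxCard * (I * (C * c)) * (S.gap / 3) ^ 2, by positivity, fun k y ξ₀ hξ₀ hy => ?_⟩
  have hρ := S.radius_pos s k
  have hW := S.weight_pos k
  have h1 := FourierL1.sum (S.near k) fun l _ =>
    (FourierL1.of_schwartz_rescale b hρ.ne' y).mul (hh l)
  refine (h1.mono ?_).congr fun ξ => ?_
  · have h2 : ∀ l ∈ S.near k, I * (C * D.weight l ^ (-(2 * α - 2 * s))) ≤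
        I * (C * (c * D.weight k ^ (-(2 * α - 2 * s)))) := fun l hl => by
      gcongr
      exact rpow_le_rpow_of_comparable S.bound_pos (S.weight_pos l) hW (S.weight_near_le k l hl)
        (S.weight_le_near k l hl) _
    -- The exponents add up to 2(s - max(s,0)) ≤ 0; this is what dictates the choice of the radius.
    have h3 : D.weight k ^ (-(2 * α - 2 * s)) * S.radius s k ^ 2 ≤ (S.gap / 3) ^ 2 := by
      rw [radius, mul_pow, ← Real.rpow_mul_natCast hW.le, mul_left_comm, ← Real.rpow_add hW]
      refine mul_le_of_le_one_right (by positivity)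
        (Real.rpow_le_one_of_one_le_of_nonpos (S.one_le_weight k) ?_)
      have := le_max_left s 0
      push_cast
      linarith
    refine (Finset.sum_le_card_nsmul _ _ _ h2).trans ?_
    rw [nsmul_eq_mul, le_div_iff₀ (by positivity)]
    calc ((S.near k).card : ℝ) * (I * (C * (c * D.weight k ^ (-(2 * α - 2 * s))))) *
          S.radius s k ^ 2
        = (S.near k).card * (I * (C * c)) *
          (D.weight k ^ (-(2 * α - 2 * s)) * S.radius s k ^ 2) := by ring
      _ ≤ S.maxCard * (I * (C * c)) * (S.gap / 3) ^ 2 := by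
          gcongr
          exact S.card_near_le k
  · by_cases h0 : b ((S.radius s k)⁻¹ • (ξ - y)) = 0
    · simp [h0]
    have h4 : ‖ξ - y‖ < 2 * S.radius s k := by
      by_contra! hcon
      refine h0 (hb _ ?_)
      rw [norm_smul, norm_inv, Real.norm_of_nonneg hρ.le, inv_mul_eq_div, le_div_iff₀ hρ]
      exact hcon
    -- The support of the rescaled `b` has radius 2ρ about y, and y is within ρ of ξ₀; hence the 3
    -- in the definition of the radius.
    have h5 : ‖ξ - ξ₀‖ ≤ S.gap * D.weight k ^ α := by
      have := S.three_mul_radius_le s k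
      have h6 := norm_sub_le (ξ - y) (ξ₀ - y)
      rw [sub_sub_sub_cancel_right] at h6
      linarith
    rw [← Finset.mul_sum, ← Finset.sum_mul, S.sum_near k ξ₀ ξ hξ₀ h5, one_mul]

/-- On the `k`-th piece, `e^{iμ}` is the Fourier transform of an integrable function, with a norm
which is controlled by the number of balls on which the phase is close to an affine function. -/
lemma exists_fourierL1_exp {μ : E n → ℝ} (hμ : ContDiff ℝ 2 μ) {s : ℝ}
    (hμ₂ : ∀ i j : Fin n, D.MemFourier 1 ∞ (2 * α - 2 * s) (secondPartial μ i j)) :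
    ∃ C, 0 < C ∧ ∀ k, FourierL1 (fun ξ => S.inner k ξ * Complex.exp (Complex.I * μ ξ))
      (C * D.weight k ^ (max s 0 * n)) := by
  obtain ⟨b, -, hb1, hb0, -, -⟩ := exists_schwartz_bump n one_pos one_lt_two
  obtain ⟨χ, -, -, hχ0, -, hχi⟩ := exists_schwartz_bump n (one_half_pos (α := ℝ)) one_half_lt_one
  choose C hC hCh using fun i j => (hμ₂ i j).exists_fourierL1 (continuous_secondPartial hμ i j)
    S.weight_pos
  choose A hA hAh using fun i j => S.exists_fourierL1_near b hb0 (hC i j) (hCh i j)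
  set A' := ∑ i, ∑ j, A i j
  have hAA : ∀ i j, A i j ≤ A' := fun i j =>
    (Finset.single_le_sum (f := fun j => A i j) (fun j _ => hA i j) (Finset.mem_univ j)).trans
      (Finset.single_le_sum (f := fun i => ∑ j, A i j)
        (fun i _ => Finset.sum_nonneg fun j _ => hA i j) (Finset.mem_univ i))
  obtain ⟨C₀, hC₀⟩ := exists_fourierL1_exp_local χ b
    (fun ζ hζ => le_of_not_ge fun h => hζ (hχ0 ζ h)) hb1 A'
  set v := volume.real (Metric.ball (0 : E n) 1)
  set c := ‖∫ ξ, χ ξ‖⁻¹ * ((S.bound / (S.gap / 3) + 1) ^ n * (v * (S.bound * max C₀ 0)))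
  have hgap := S.gap_pos
  have hbd := S.bound_pos
  have hc : 0 ≤ c := by positivity
  -- Adding 1 makes the constant positive, as the later real powers of the bound require.
  refine ⟨c + 1, by positivity, fun k => ?_⟩
  have hρ := S.radius_pos s k
  set ρ := S.radius s k with hρd
  have hW := S.weight_pos k
  have hi : ∫ ξ, χ (ρ⁻¹ • ξ) = (ρ ^ n : ℝ) * ∫ ξ, χ ξ := by
    rw [Measure.integral_comp_inv_smul_of_nonneg volume (fun ξ => χ ξ) hρ.le, finrank_euclideanSpace_fin,
      Complex.real_smul]
  have hm : Continuous fun ξ => S.inner k ξ * Complex.exp (Complex.I * μ ξ) := by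
    have := hμ.continuous
    have := (S.inner k).continuous
    fun_prop
  -- The ratio of the volume of the enlarged piece to ρ^n ∫ χ counts the balls of radius ρ needed to
  -- cover it.
  have key := FourierL1.of_translates (χ := fun ξ => χ (ρ⁻¹ • ξ)) (ρ := ρ)
    (R := S.bound * D.weight k ^ α) (a := S.bound * max C₀ 0)
    (by have := χ.continuous; fun_prop) (fun ξ hξ => hχ0 _ ?_) ?_ (S.center k) hm
    (fun ξ hξ => by rw [S.inner_eq_zero k ξ hξ, zero_mul]) fun y => ?_
  · refine key.mono ?_
    rw [hi, Measure.addHaar_real_closedBall _ _ (by positivity), finrank_euclideanSpace_fin, norm_mul,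
      Complex.norm_real, Real.norm_of_nonneg (by positivity), mul_inv]
    have h1 : (S.bound * D.weight k ^ α + ρ) ^ n ≤
        ((S.bound / (S.gap / 3) + 1) ^ n * D.weight k ^ (max s 0 * n)) * ρ ^ n := by
      rw [Real.rpow_mul_natCast hW.le, ← mul_pow, ← mul_pow]
      refine pow_le_pow_left₀ (by positivity) ?_ n
      have h2 : D.weight k ^ (max s 0) * ρ = S.gap / 3 * D.weight k ^ α := by
        rw [hρd, radius, mul_left_comm, ← Real.rpow_add hW]
        congr 2
        ring
      have h3 : 1 ≤ D.weight k ^ (max s 0) :=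
        Real.one_le_rpow (S.one_le_weight k) (le_max_right s 0)
      calc S.bound * D.weight k ^ α + ρ
          = S.bound / (S.gap / 3) * (D.weight k ^ (max s 0) * ρ) + 1 * ρ := by
            rw [h2]
            field_simp
        _ ≤ S.bound / (S.gap / 3) * (D.weight k ^ (max s 0) * ρ) + D.weight k ^ (max s 0) * ρ := by
            gcongr
        _ = _ := by ring
    have h4 : 0 < ρ ^ n := by positivity
    calc (ρ ^ n)⁻¹ * ‖∫ ξ, χ ξ‖⁻¹ * ((S.bound * D.weight k ^ α + ρ) ^ n * v *
          (S.bound * max C₀ 0))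
        ≤ (ρ ^ n)⁻¹ * ‖∫ ξ, χ ξ‖⁻¹ * ((((S.bound / (S.gap / 3) + 1) ^ n *
          D.weight k ^ (max s 0 * n)) * ρ ^ n) * v * (S.bound * max C₀ 0)) := by gcongr
      _ = c * D.weight k ^ (max s 0 * n) := by
          have h5 := inv_mul_cancel₀ h4.ne'
          simp only [c]
          linear_combination (‖∫ ξ, χ ξ‖⁻¹ * (S.bound / (S.gap / 3) + 1) ^ n *
            D.weight k ^ (max s 0 * n) * v * (S.bound * max C₀ 0)) * h5
      _ ≤ (c + 1) * D.weight k ^ (max s 0 * n) := by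
          gcongr
          linarith
  · rw [norm_smul, norm_inv, Real.norm_of_nonneg hρ.le, inv_mul_eq_div, le_div_iff₀ hρ, one_mul]
    exact hξ
  · rw [hi]
    exact mul_ne_zero (by exact_mod_cast (pow_pos hρ n).ne') hχi
  -- A ball which misses the k-th piece contributes zero; on the others the local estimate for the
  -- phase applies with one common constant.
  · by_cases h0 : ∃ ξ₀, S.inner k ξ₀ ≠ 0 ∧ ‖ξ₀ - y‖ ≤ ρ
    · obtain ⟨ξ₀, hξ₀, hy⟩ := h0
      have h1 := (S.fourierL1_inner k).mul ((hC₀ μ y ρ hμ hρ fun i j =>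
        (hAh i j k y ξ₀ hξ₀ hy).mono (by gcongr; exact hAA i j)).mono (le_max_left C₀ 0))
      exact h1.congr fun ξ => by ring
    · push Not at h0
      refine (FourierL1.zero.mono (by positivity)).congr fun ξ => ?_
      by_cases h1 : S.inner k ξ = 0
      · simp [h1]
      · rw [hχ0, zero_mul]
        rw [norm_smul, norm_inv, Real.norm_of_nonneg hρ.le, inv_mul_eq_div, le_div_iff₀ hρ,
          one_mul]
        exact (h0 ξ h1).le

/-- The `Lᵖ` bound for the `k`-th piece of the multiplier `e^{iμ}`. -/
lemma exists_local_multiplier {μ : E n → ℝ} (hμ : ContDiff ℝ 2 μ) {s δ : ℝ}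
    (hμ₂ : ∀ i j : Fin n, D.MemFourier 1 ∞ (2 * α - 2 * s) (secondPartial μ i j))
    {p : ℝ≥0∞} [hp : Fact (1 ≤ p)] (hδ : |(p⁻¹).toReal - 1 / 2| * max (2 * s) 0 ≤ δ) :
    ∃ C : ℝ≥0, ∀ k (F : Lp ℂ p (volume : Measure (E n))),
      ∃ U : Lp ℂ p (volume : Measure (E n)),
        (∀ Φ : 𝓢(E n, ℂ), Lp.toTemperedDistribution U Φ = ∫ y, F y * 𝓕 (fun ξ =>
          (S.inner k ξ * Complex.exp (Complex.I * μ ξ)) * (𝓕⁻ Φ : 𝓢(E n, ℂ)) ξ) y) ∧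
        ‖U‖ₑ ≤ C * (ENNReal.ofReal (D.weight k ^ (δ * n)) * ‖F‖ₑ) := by
  obtain ⟨C₁, hC₁, h₁⟩ := S.exists_fourierL1_exp hμ hμ₂
  obtain ⟨C₂, hC₂, h₂⟩ := exists_eLpNorm_conv_le (V := E n) p hp.out
  set τ := |(p⁻¹).toReal - 1 / 2|
  have hτ : 0 ≤ τ := abs_nonneg _
  refine ⟨⟨C₂ * C₁ ^ (2 * τ), by positivity⟩, fun k F => ?_⟩
  obtain ⟨K, hK, hKm, hKa⟩ := h₁ k
  have hW := S.weight_pos k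
  have hF := Lp.memLp F
  -- The only use of the reality of μ in the L² bound: e^{iμ} is unimodular.
  have hnorm : ∀ ξ, ‖𝓕 K ξ‖ ≤ 1 := fun ξ => by
    rw [hKm, norm_mul, mul_comm Complex.I, Complex.norm_exp_ofReal_mul_I, mul_one]
    exact S.norm_inner_le k ξ
  have hle := h₂ K F _ hK hnorm (by positivity) hKa hF
  have hle' : eLpNorm (conv K F) p ≤ ENNReal.ofReal (C₂ * C₁ ^ (2 * τ)) *
      (ENNReal.ofReal (D.weight k ^ (δ * n)) * eLpNorm F p) := by
    refine hle.trans ?_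
    rw [← mul_assoc, ← ENNReal.ofReal_mul (by positivity)]
    refine mul_le_mul_left (ENNReal.ofReal_le_ofReal ?_) _
    rw [Real.mul_rpow hC₁.le (by positivity), ← Real.rpow_mul hW.le, ← mul_assoc]
    refine mul_le_mul_of_nonneg_left
      (Real.rpow_le_rpow_of_exponent_le (S.one_le_weight k) ?_) (by positivity)
    have h3 : 2 * max s 0 = max (2 * s) 0 := by
      rw [mul_max_of_nonneg _ _ zero_le_two, mul_zero]
    calc max s 0 * n * (2 * τ) = (τ * (2 * max s 0)) * n := by ring
      _ ≤ δ * n := by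
        rw [h3]
        gcongr
  have hU : MemLp (conv K F) p :=
    ⟨aestronglyMeasurable_conv hK hF.1, hle'.trans_lt (ENNReal.mul_lt_top ENNReal.ofReal_lt_top
      (ENNReal.mul_lt_top ENNReal.ofReal_lt_top hF.2))⟩
  refine ⟨hU.toLp _, fun Φ => ?_, ?_⟩
  · rw [Lp.toTemperedDistribution_apply]
    have h4 : ∫ x, Φ x • (hU.toLp _ : E n → ℂ) x = ∫ x, conv K F x * Φ x := by
      refine integral_congr_ae ?_
      filter_upwards [hU.coeFn_toLp] with x hx
      rw [hx, smul_eq_mul, mul_comm]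
    rw [h4, integral_conv_mul hp.out hK hF]
    simp only [hKm]
  · rw [Lp.enorm_toLp, Lp.enorm_def F]
    refine hle'.trans (le_of_eq ?_)
    rw [ENNReal.ofReal_eq_coe_nnreal (by positivity)]
    rfl

end CutoffSystem


/-! ### Uniqueness and linearity of the multiplier. -/

variable {n : ℕ}

lemma schwartzMul_apply (φ ψ : 𝓢(E n, ℂ)) (ξ : E n) :
    SchwartzMap.smulLeftCLM ℂ φ ψ ξ = φ ξ * ψ ξ :=
  SchwartzMap.smulLeftCLM_apply_apply φ.hasTemperateGrowth ψ ξ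

lemma modulate_apply (x : E n) (ψ : 𝓢(E n, ℂ)) (ξ : E n) :
    SchwartzMap.smulLeftCLM ℂ (character x) ψ ξ = character x ξ * ψ ξ :=
  SchwartzMap.smulLeftCLM_apply_apply (character_hasTemperateGrowth x) ψ ξ

lemma FourierL1.integrable_fourier {m : E n → ℂ} {a : ℝ} (h : FourierL1 m a) (hm : Integrable m) :
    Integrable (𝓕 m) ∧ 𝓕⁻ (𝓕 m) = m := by
  have h1 : Integrable (𝓕 m) := by
    have := (h.integrable_fourierInv hm).1.comp_neg
    simpa only [Real.fourierInv_eq_fourier_neg, neg_neg] using this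
  exact ⟨h1, h.continuous.fourierInv_fourier_eq hm h1⟩

/-- Translates between the L^p function that represents a piece of `f` and the pointwise cutoffs
used to define multipliers with a nonsmooth symbol. -/
lemma integral_mul_fourier_eq_integral {p : ℝ≥0∞} [hp : Fact (1 ≤ p)] {η : 𝓢(E n, ℂ)}
    {f : 𝓢'(E n, ℂ)} {F : Lp ℂ p (volume : Measure (E n))}
    (h : Lp.toTemperedDistribution F = TemperedDistribution.fourierMultiplierCLM ℂ η f)
    {L : E n → ℂ} (hL : Integrable L) (ψ : 𝓢(E n, ℂ)) :
    Integrable (fun x => L x *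
      𝓕 f (SchwartzMap.smulLeftCLM ℂ η (SchwartzMap.smulLeftCLM ℂ (character x) ψ))) ∧
    ∫ y, F y * 𝓕 (fun ξ => 𝓕⁻ L ξ * ψ ξ) y = ∫ x, L x *
      𝓕 f (SchwartzMap.smulLeftCLM ℂ η (SchwartzMap.smulLeftCLM ℂ (character x) ψ)) := by
  have key := integral_mul_fourier_mul hp.out hL (Lp.memLp F) ψ
  have h1 : ∀ x, ∫ y, F y * 𝓕 (fun ξ => (Real.fourierChar (inner ℝ x ξ) : ℂ) * ψ ξ) y =
      𝓕 f (SchwartzMap.smulLeftCLM ℂ η (SchwartzMap.smulLeftCLM ℂ (character x) ψ)) := fun x => by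
    rw [← integral_mul_eq_fourier_apply h, funext (modulate_apply x ψ)]
    rfl
  simpa only [h1] using key

/-- A tempered distribution is determined by its values on test functions. -/
lemma tempered_eq_zero {w : 𝓢'(E n, ℂ)} (hw : ∀ φ : 𝓢(E n, ℂ), HasCompactSupport φ → w φ = 0) :
    w = 0 := by
  ext Ψ
  obtain ⟨b, hbc, hb1, -, -, -⟩ := exists_schwartz_bump n one_pos one_lt_two
  have hq : Continuous ((normSeminorm ℂ ℂ).comp w.toLinearMap) :=
    continuous_norm.comp (map_continuous w)
  -- The 1 in the bound serves i = 0; the higher derivatives of the constant function vanish.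
  have hB : ∀ i, ∃ B, ∀ ξ, ‖iteratedFDeriv ℝ i (fun ξ => 1 - b ξ) ξ‖ ≤ B := fun i => by
    obtain ⟨C, hC⟩ := b.decay 0 i
    refine ⟨1 + C, fun ξ => ?_⟩
    have h1 : iteratedFDeriv ℝ i (fun ξ => 1 - b ξ) ξ =
        iteratedFDeriv ℝ i (fun _ : E n => (1 : ℂ)) ξ - iteratedFDeriv ℝ i b ξ :=
      iteratedFDeriv_sub_apply contDiff_const.contDiffAt (b.smooth i).contDiffAt
    rw [h1]
    refine (norm_sub_le _ _).trans (add_le_add ?_ (by simpa using hC.2 ξ))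
    rcases i.eq_zero_or_pos with rfl | hi
    · simp
    · simp [iteratedFDeriv_const_of_ne hi.ne']
  choose B hB using hB
  obtain ⟨r, -, hr⟩ := exists_seminorm_cutoff_le hq 1 B 1
  -- `w` vanishes on the truncation of Ψ to a ball of radius about R, so it sees only the tail,
  -- which lives at frequencies at least R and gains a factor 1/R. Letting R tend to infinity gives
  -- w Ψ = 0.
  have hbound : ∀ R : ℝ, 1 ≤ R → R * ‖w Ψ‖ ≤ r Ψ := fun R hR => by
    have hR0 : 0 < R := zero_lt_one.trans_le hR
    set a : E n → ℂ := fun ξ => 1 - b (R⁻¹ • ξ) with ha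
    have hsm : Function.HasTemperateGrowth fun ξ : E n => b (R⁻¹ • ξ) :=
      b.hasTemperateGrowth.comp (R⁻¹ • ContinuousLinearMap.id ℝ (E n)).hasTemperateGrowth
    have hat : a.HasTemperateGrowth := (Function.HasTemperateGrowth.const 1).sub hsm
    have hcut : IsCutoffAt B 1 R a := by
      refine ⟨hat, fun i ξ => ?_, hR0, fun ξ hξ => ?_⟩
      · have h2 : ContDiff ℝ i fun ξ => 1 - b ξ := contDiff_const.sub (b.smooth i)
        have h3 := congrFun (iteratedFDeriv_comp_const_smul R⁻¹ h2) ξ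
        simp only [ha]
        rw [h3, norm_smul, norm_pow, norm_inv, Real.norm_of_nonneg hR0.le]
        exact (mul_le_of_le_one_left (norm_nonneg _)
          (pow_le_one₀ (by positivity) (inv_le_one_of_one_le₀ hR))).trans (hB i _)
      · have h2 : tsupport a ⊆ {ξ | R ≤ ‖ξ‖} := by
          refine closure_minimal (fun ζ hζ => ?_) (isClosed_le continuous_const continuous_norm)
          by_contra hcon
          refine hζ ?_
          rw [Set.mem_ofPred_eq, not_le] at hcon
          simp only [ha]
          rw [hb1, sub_self]
          rw [norm_smul, norm_inv, Real.norm_of_nonneg hR0.le, inv_mul_eq_div, div_le_one hR0]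
          exact hcon.le
        have h3 : R ≤ ‖ξ‖ := h2 hξ
        linarith
    have hsplit : SchwartzMap.smulLeftCLM ℂ (fun ξ : E n => b (R⁻¹ • ξ)) Ψ +
        SchwartzMap.smulLeftCLM ℂ a Ψ = Ψ := by
      ext ξ
      rw [add_apply, SchwartzMap.smulLeftCLM_apply_apply hsm,
        SchwartzMap.smulLeftCLM_apply_apply hat]
      simp only [ha, smul_eq_mul]
      ring
    have hzero : w (SchwartzMap.smulLeftCLM ℂ (fun ξ : E n => b (R⁻¹ • ξ)) Ψ) = 0 := by
      refine hw _ ?_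
      have h4 : HasCompactSupport fun ξ : E n => b (R⁻¹ • ξ) :=
        hbc.comp_homeomorph (Homeomorph.smulOfNeZero R⁻¹ (inv_ne_zero hR0.ne'))
      refine h4.mono fun ξ hξ => ?_
      rw [Function.mem_support, SchwartzMap.smulLeftCLM_apply_apply hsm] at hξ
      exact left_ne_zero_of_mul hξ
    have h5 := hr a R hcut Ψ
    rw [pow_one] at h5
    have h6 := congrArg w hsplit
    rw [map_add, hzero, zero_add] at h6
    rw [← h6]
    exact h5
  have h6 : ‖w Ψ‖ = 0 := by
    refine le_antisymm ?_ (norm_nonneg _)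
    refine le_of_tendsto_of_tendsto' (f := fun _ : ℕ => ‖w Ψ‖)
      (g := fun N : ℕ => r Ψ * (1 / ((N : ℝ) + 1))) (b := atTop)
      tendsto_const_nhds (by simpa using tendsto_one_div_add_atTop_nhds_zero_nat.const_mul (r Ψ)) fun N => ?_
    rw [mul_one_div, le_div_iff₀' (by positivity)]
    exact hbound _ (by linarith [N.cast_nonneg (α := ℝ)])
  exact norm_eq_zero.1 h6

/-- Every test function φ equals χ φ for a bump χ which is 1 on its support, so the defining
identity prescribes 𝓕 g on all test functions. -/
lemma IsFourierMultiplier.unique {m : E n → ℂ} {f g g' : 𝓢'(E n, ℂ)}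
    (h : IsFourierMultiplier m f g) (h' : IsFourierMultiplier m f g') : g = g' := by
  have h1 : 𝓕 g - 𝓕 g' = 0 := by
    refine tempered_eq_zero fun φ hφ => ?_
    obtain ⟨R, hR, hφR⟩ : ∃ R : ℝ, 1 ≤ R ∧ ∀ ξ, φ ξ ≠ 0 → ‖ξ‖ ≤ R := by
      obtain ⟨R, hR⟩ := hφ.isBounded.exists_norm_le
      exact ⟨max R 1, le_max_right _ _, fun ξ hξ =>
        (hR ξ (subset_tsupport _ hξ)).trans (le_max_left _ _)⟩
    obtain ⟨χ, hχc, hχ1, -⟩ := exists_schwartz_bump n (r := R) (R := R + 1) (by linarith)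
      (by linarith)
    have h2 : SchwartzMap.smulLeftCLM ℂ χ φ = φ := by
      ext ξ
      rw [schwartzMul_apply]
      by_cases hξ : φ ξ = 0
      · simp [hξ]
      · rw [hχ1 ξ (hφR ξ hξ), one_mul]
    change 𝓕 g φ - 𝓕 g' φ = 0
    rw [← h2, (h χ φ hχc hφ).2, (h' χ φ hχc hφ).2, sub_self]
  have h2 := congrArg (fun u : 𝓢'(E n, ℂ) => (𝓕⁻ u : 𝓢'(E n, ℂ))) (sub_eq_zero.1 h1)
  simpa only [fourierInv_fourier_eq] using h2

lemma cutoff_add (ψ : 𝓢(E n, ℂ)) (f f' : 𝓢'(E n, ℂ)) (x : E n) :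
    cutoff ψ (f + f') x = cutoff ψ f x + cutoff ψ f' x := by
  simp only [cutoff, FourierTransform.fourier_add]
  rfl

lemma cutoff_smul (ψ : 𝓢(E n, ℂ)) (c : ℂ) (f : 𝓢'(E n, ℂ)) (x : E n) :
    cutoff ψ (c • f) x = c * cutoff ψ f x := by
  simp only [cutoff, FourierTransform.fourier_smul]
  rfl

lemma IsFourierMultiplier.add {m : E n → ℂ} {f f' g g' : 𝓢'(E n, ℂ)}
    (h : IsFourierMultiplier m f g) (h' : IsFourierMultiplier m f' g') :
    IsFourierMultiplier m (f + f') (g + g') := fun φ ψ hφ hψ => by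
  obtain ⟨h1, h2⟩ := h φ ψ hφ hψ
  obtain ⟨h1', h2'⟩ := h' φ ψ hφ hψ
  simp only [cutoff_add, mul_add]
  refine ⟨h1.add h1', ?_⟩
  rw [integral_add h1 h1', ← h2, ← h2', FourierTransform.fourier_add]
  rfl

lemma IsFourierMultiplier.smul {m : E n → ℂ} {f g : 𝓢'(E n, ℂ)}
    (h : IsFourierMultiplier m f g) (c : ℂ) : IsFourierMultiplier m (c • f) (c • g) :=
  fun φ ψ hφ hψ => by
  obtain ⟨h1, h2⟩ := h φ ψ hφ hψ
  simp only [cutoff_smul, mul_left_comm _ c]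
  refine ⟨h1.const_mul c, ?_⟩
  rw [integral_const_mul, ← h2, FourierTransform.fourier_smul]
  rfl


/-! ### Gluing the local images. -/

variable {n : ℕ}

namespace CutoffSystem

variable {α : ℝ} {D : FreqDecomp n} (S : CutoffSystem α D)

lemma inner_mul_symbol (k : D.Index) (ξ : E n) : S.inner k ξ * D.symbol k ξ = D.symbol k ξ := by
  by_cases h : D.symbol k ξ = 0
  · rw [h, mul_zero]
  · rw [S.inner_eq_one k ξ h, one_mul]

lemma outer_mul_inner (k : D.Index) (ξ : E n) : S.outer k ξ * S.inner k ξ = S.inner k ξ := by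
  by_cases h : S.inner k ξ = 0
  · rw [h, mul_zero]
  · rw [S.outer_eq_one k ξ h, one_mul]

lemma hasCompactSupport_inner (k : D.Index) : HasCompactSupport (S.inner k) :=
  (S.hasCompactSupport_outer k).mono fun ξ hξ => by
    rw [Function.mem_support, S.outer_eq_one k ξ hξ]
    exact one_ne_zero

lemma hasCompactSupport_symbol (S : CutoffSystem α D) (k : D.Index) : HasCompactSupport (D.symbol k) :=
  (S.hasCompactSupport_inner k).mono fun ξ hξ => by
    rw [Function.mem_support, S.inner_eq_one k ξ hξ]
    exact one_ne_zero

/-- A cutoff that meets a bounded set has bounded size, and summability of the inverse powers lets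
only finitely many sizes stay below a given bound. -/
lemma finite_setOf_outer_ne_zero {φ : 𝓢(E n, ℂ)} (hφ : HasCompactSupport φ) :
    {k | ∃ ξ, S.outer k ξ ≠ 0 ∧ φ ξ ≠ 0}.Finite := by
  obtain ⟨R, hR⟩ := hφ.isBounded.exists_norm_le
  have hG : 0 < |S.growth| * (1 + |R|) + 1 := by positivity
  set G := |S.growth| * (1 + |R|) + 1
  have h1 := S.summable_size.tendsto_cofinite_zero.eventually
    (gt_mem_nhds (inv_pos.2 (pow_pos hG S.exponent)))
  refine Set.Finite.subset h1 fun k hk => ?_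
  obtain ⟨ξ, hξ, hφξ⟩ := hk
  have hJ := (S.isCutoffAt k).pos
  have h2 := (S.isCutoffAt k).le_of_mem_tsupport ξ (subset_tsupport _ hξ)
  have h3 : S.size k ≤ G := by
    refine h2.trans ((mul_le_mul (le_abs_self _) ?_ (by positivity) (abs_nonneg _)).trans
      (le_add_of_nonneg_right zero_le_one))
    gcongr
    exact (hR ξ (subset_tsupport _ hφξ)).trans (le_abs_self R)
  change ¬ (S.size k ^ S.exponent)⁻¹ < (G ^ S.exponent)⁻¹
  rw [not_lt]
  exact inv_anti₀ (pow_pos hJ _) (pow_le_pow_left₀ hJ.le h3 _)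

lemma sum_symbol_mul {T : Finset D.Index} {ψ : 𝓢(E n, ℂ)}
    (hT : ∀ k ξ, S.outer k ξ ≠ 0 → ψ ξ ≠ 0 → k ∈ T) (ξ : E n) :
    ∑ k ∈ T, D.symbol k ξ * ψ ξ = ψ ξ := by
  by_cases h : ψ ξ = 0
  · simp [h]
  · have h1 : HasSum (fun k => D.symbol k ξ) (∑ k ∈ T, D.symbol k ξ) :=
      hasSum_sum_of_ne_finset_zero fun k hk => ?_
    · rw [← Finset.sum_mul, h1.unique (S.hasSum_symbol ξ), one_mul]
    by_contra hne
    have h1 := S.inner_eq_one k ξ hne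
    exact hk (hT k ξ (by rw [S.outer_eq_one k ξ (by simp [h1])]; exact one_ne_zero) h)

/-- On the support of φ finitely many symbols sum to 1, so φ m is a finite sum of products of
Schwartz functions with the localized symbols. -/
lemma exists_fourierL1_mul {m : E n → ℂ}
    (hm : ∀ k, ∃ a, FourierL1 (fun ξ => S.inner k ξ * m ξ) a) {φ : 𝓢(E n, ℂ)}
    (hφ : HasCompactSupport φ) : ∃ a, FourierL1 (fun ξ => φ ξ * m ξ) a := by
  choose a ha using hm
  refine ⟨_, (FourierL1.sum (S.finite_setOf_outer_ne_zero hφ).toFinset fun k _ =>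
    ((FourierL1.of_schwartz φ).mul (FourierL1.of_schwartz (D.symbol k))).mul (ha k)).congr
      fun ξ => ?_⟩
  have h1 := S.sum_symbol_mul (T := (S.finite_setOf_outer_ne_zero hφ).toFinset) (ψ := φ)
    (fun k ξ h h' => (Set.Finite.mem_toFinset _).2 ⟨ξ, h, h'⟩) ξ
  conv_lhs => rw [← h1, Finset.sum_mul]
  refine Finset.sum_congr rfl fun k _ => ?_
  conv_lhs => rw [← S.inner_mul_symbol]
  ring

lemma integrable_fourier_mul {m : E n → ℂ}
    (hm : ∀ k, ∃ a, FourierL1 (fun ξ => S.inner k ξ * m ξ) a) {φ : 𝓢(E n, ℂ)}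
    (hφ : HasCompactSupport φ) : Integrable (𝓕 fun ξ => φ ξ * m ξ) ∧
      𝓕⁻ (𝓕 fun ξ => φ ξ * m ξ) = fun ξ => φ ξ * m ξ := by
  obtain ⟨a, ha⟩ := S.exists_fourierL1_mul hm hφ
  exact ha.integrable_fourier (ha.continuous.integrable_of_hasCompactSupport hφ.mul_right)

variable {p q : ℝ≥0∞} [hp : Fact (1 ≤ p)] [hq : Fact (1 ≤ q)]

/-- `U` is the image of `F` under the multiplier `m`, localized to the `k`-th piece. -/
def IsLocalImage (m : E n → ℂ) (k : D.Index) (F U : Lp ℂ p (volume : Measure (E n))) : Prop :=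
  ∀ Φ : 𝓢(E n, ℂ), Lp.toTemperedDistribution U Φ =
    ∫ y, F y * 𝓕 (fun ξ => (S.inner k ξ * m ξ) * (𝓕⁻ Φ : 𝓢(E n, ℂ)) ξ) y

variable {S} {m : E n → ℂ} {k : D.Index} {F U : Lp ℂ p (volume : Measure (E n))} {f : 𝓢'(E n, ℂ)}

lemma IsLocalImage.fourier_apply (h : S.IsLocalImage m k F U) (Ψ : 𝓢(E n, ℂ)) :
    𝓕 (Lp.toTemperedDistribution U : 𝓢'(E n, ℂ)) Ψ =
      ∫ y, F y * 𝓕 (fun ξ => (S.inner k ξ * m ξ) * Ψ ξ) y := by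
  rw [TemperedDistribution.fourier_apply, h, fourierInv_fourier_eq]

lemma IsLocalImage.fourier_outer (h : S.IsLocalImage m k F U) (Ψ : 𝓢(E n, ℂ)) :
    𝓕 (Lp.toTemperedDistribution U : 𝓢'(E n, ℂ)) (SchwartzMap.smulLeftCLM ℂ (S.outer k) Ψ) =
      𝓕 (Lp.toTemperedDistribution U : 𝓢'(E n, ℂ)) Ψ := by
  rw [h.fourier_apply, h.fourier_apply]
  have h1 : (fun ξ => (S.inner k ξ * m ξ) * SchwartzMap.smulLeftCLM ℂ (S.outer k) Ψ ξ) =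
      fun ξ => (S.inner k ξ * m ξ) * Ψ ξ := funext fun ξ => by
    rw [schwartzMul_apply]
    conv_rhs => rw [← S.outer_mul_inner]
    ring
  rw [h1]

/-- The pairing with the localized image, in terms of the cutoffs of `f`. -/
lemma IsLocalImage.fourier_mul (h : S.IsLocalImage m k F U)
    (hm : ∀ k, ∃ a, FourierL1 (fun ξ => S.inner k ξ * m ξ) a)
    (hF : Lp.toTemperedDistribution F =
      TemperedDistribution.fourierMultiplierCLM ℂ (D.symbol k) f)
    {φ : 𝓢(E n, ℂ)} (hφ : HasCompactSupport φ) (ψ : 𝓢(E n, ℂ)) :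
    Integrable (fun x => 𝓕 (fun ξ => φ ξ * m ξ) x *
      cutoff (SchwartzMap.smulLeftCLM ℂ (D.symbol k) ψ) f x) ∧
    𝓕 (Lp.toTemperedDistribution U : 𝓢'(E n, ℂ)) (SchwartzMap.smulLeftCLM ℂ φ ψ) =
      ∫ x, 𝓕 (fun ξ => φ ξ * m ξ) x *
        cutoff (SchwartzMap.smulLeftCLM ℂ (D.symbol k) ψ) f x := by
  obtain ⟨h1, h2⟩ := S.integrable_fourier_mul hm hφ
  have key := integral_mul_fourier_eq_integral hF h1
    (SchwartzMap.smulLeftCLM ℂ (S.inner k) ψ)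
  have h3 : ∀ x, SchwartzMap.smulLeftCLM ℂ (D.symbol k) (SchwartzMap.smulLeftCLM ℂ (character x)
      (SchwartzMap.smulLeftCLM ℂ (S.inner k) ψ)) = SchwartzMap.smulLeftCLM ℂ (character x)
        (SchwartzMap.smulLeftCLM ℂ (D.symbol k) ψ) := fun x => by
    ext ξ
    simp only [schwartzMul_apply, modulate_apply]
    conv_rhs => rw [← S.inner_mul_symbol]
    ring
  simp only [h3, h2] at key
  refine ⟨key.1, Eq.trans ?_ key.2⟩
  rw [h.fourier_apply]
  have h4 : (fun ξ => S.inner k ξ * m ξ * SchwartzMap.smulLeftCLM ℂ φ ψ ξ) =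
      fun ξ => φ ξ * m ξ * SchwartzMap.smulLeftCLM ℂ (S.inner k) ψ ξ := funext fun ξ => by
    rw [schwartzMul_apply, schwartzMul_apply]
    ring
  rw [h4]

/-- The pieces of the image under a Fourier multiplier are the localized images. -/
lemma IsLocalImage.eq_of_isFourierMultiplier (h : S.IsLocalImage m k F U)
    (hm : ∀ k, ∃ a, FourierL1 (fun ξ => S.inner k ξ * m ξ) a)
    (hF : Lp.toTemperedDistribution F =
      TemperedDistribution.fourierMultiplierCLM ℂ (D.symbol k) f)
    {g : 𝓢'(E n, ℂ)} (hg : IsFourierMultiplier m f g) :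
    TemperedDistribution.fourierMultiplierCLM ℂ (D.symbol k) g = Lp.toTemperedDistribution U := by
  ext Φ
  set Ψ : 𝓢(E n, ℂ) := 𝓕⁻ Φ
  -- Two test pairs are compared for this φ: (φ, symbol) in the definition of the multiplier and (φ,
  -- outer) for the local image. Both produce the same cutoff of `f`, since outer is 1 where symbol
  -- is nonzero.
  set φ := SchwartzMap.smulLeftCLM ℂ (S.outer k) Ψ
  have hφ : HasCompactSupport φ := (S.hasCompactSupport_outer k).mono fun ξ hξ => by
    rw [Function.mem_support, schwartzMul_apply] at hξ
    exact left_ne_zero_of_mul hξ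
  have h1 := (h.fourier_mul hm hF hφ (S.outer k)).2
  have h0 : ∀ ξ, D.symbol k ξ * S.outer k ξ = D.symbol k ξ := fun ξ => by
    rw [← S.inner_mul_symbol]
    linear_combination (D.symbol k ξ) * S.outer_mul_inner k ξ
  have h2 : SchwartzMap.smulLeftCLM ℂ (D.symbol k) (S.outer k) = D.symbol k := by
    ext ξ
    rw [schwartzMul_apply, h0]
  have h3 : SchwartzMap.smulLeftCLM ℂ φ (D.symbol k) =
      SchwartzMap.smulLeftCLM ℂ (D.symbol k) Ψ := by
    ext ξ
    simp only [schwartzMul_apply, φ]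
    linear_combination (Ψ ξ) * h0 ξ
  have h4 : SchwartzMap.smulLeftCLM ℂ φ (S.outer k) = SchwartzMap.smulLeftCLM ℂ (S.outer k) φ := by
    ext ξ
    rw [schwartzMul_apply φ, schwartzMul_apply (S.outer k) φ, mul_comm]
  rw [h2, ← (hg φ (D.symbol k) hφ (S.hasCompactSupport_symbol k)).2, h3, h4, h.fourier_outer,
    h.fourier_outer, TemperedDistribution.fourier_apply, fourier_fourierInv_eq] at h1
  rw [h1, TemperedDistribution.fourierMultiplierCLM_apply_apply, TemperedDistribution.fourier_apply]

variable (S)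

/-- 𝓕 g is the sum of the 𝓕 (U k). By Hölder each term is bounded by the L^{p'} norm of the Fourier
transform of the test function, which may first be multiplied by `S.outer k`; this gains a summable
power of the size. A mere uniform bound on the `U k` therefore suffices. -/
lemma exists_isFourierMultiplier
    (hm : ∀ k, ∃ a, FourierL1 (fun ξ => S.inner k ξ * m ξ) a)
    {F U : D.Index → Lp ℂ p (volume : Measure (E n))} (h : ∀ k, S.IsLocalImage m k (F k) (U k))
    (hF : ∀ k, Lp.toTemperedDistribution (F k) =
      TemperedDistribution.fourierMultiplierCLM ℂ (D.symbol k) f)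
    {B : ℝ} (hU : ∀ k, ‖U k‖ ≤ B) : ∃ g, IsFourierMultiplier m f g := by
  obtain ⟨p', hp', hpp⟩ := exists_holderConjugate hp.out
  have : Fact (1 ≤ p') := ⟨hp'⟩
  set A : 𝓢(E n, ℂ) →L[ℂ] Lp ℂ p' (volume : Measure (E n)) :=
    (SchwartzMap.toLpCLM ℂ ℂ p' volume).comp (FourierTransform.fourierCLM ℂ 𝓢(E n, ℂ)) with hA
  have hAn : ∀ Ψ, ‖A Ψ‖ = (eLpNorm (𝓕 Ψ : 𝓢(E n, ℂ)) p').toReal := fun Ψ =>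
    SchwartzMap.norm_toLp
  set v : D.Index → 𝓢'(E n, ℂ) := fun k => 𝓕 (Lp.toTemperedDistribution (U k) : 𝓢'(E n, ℂ))
    with hv
  have hvA : ∀ k Ψ, ‖v k Ψ‖ ≤ ‖U k‖ * ‖A Ψ‖ := fun k Ψ => by
    rw [hv, TemperedDistribution.fourier_apply, Lp.toTemperedDistribution_apply, hAn, Lp.norm_def]
    refine (norm_integral_le_integral_norm _).trans (le_of_eq_of_le ?_
      (integral_norm_mul_le (Lp.memLp (U k)) ((𝓕 Ψ : 𝓢(E n, ℂ)).memLp p')))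
    simp only [smul_eq_mul, mul_comm]
  have hq : Continuous ((normSeminorm ℂ _).comp A.toLinearMap) := continuous_norm.comp A.continuous
  obtain ⟨r, hr, hrb⟩ := exists_seminorm_cutoff_le hq S.exponent S.derivBound S.growth
  have hB : 0 ≤ |B| := abs_nonneg B
  have hbound : ∀ k Ψ, ‖v k Ψ‖ ≤ |B| * (S.size k ^ S.exponent)⁻¹ * r Ψ := fun k Ψ => by
    have h1 := hrb _ _ (S.isCutoffAt k) Ψ
    have hJ := (S.isCutoffAt k).pos
    rw [← le_inv_mul_iff₀ (by positivity)] at h1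
    calc ‖v k Ψ‖ = ‖v k (SchwartzMap.smulLeftCLM ℂ (S.outer k) Ψ)‖ := by
          rw [hv]
          simp only
          rw [(h k).fourier_outer]
      _ ≤ ‖U k‖ * ‖A (SchwartzMap.smulLeftCLM ℂ (S.outer k) Ψ)‖ := hvA _ _
      _ ≤ |B| * ((S.size k ^ S.exponent)⁻¹ * r Ψ) :=
          mul_le_mul ((hU k).trans (le_abs_self B)) h1 (norm_nonneg _) hB
      _ = _ := by ring
  obtain ⟨w, hw⟩ := exists_hasSum_tempered v hr (S.summable_size.mul_left |B|) hbound
  refine ⟨𝓕⁻ w, fun φ ψ hφ hψ => ?_⟩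
  -- Against φ ψ only the finitely many pieces that meet the support of ψ contribute, and on them
  -- the cutoffs of `f` add up to the cutoff by ψ.
  set T := (S.finite_setOf_outer_ne_zero hψ).toFinset
  have hT : ∀ k ξ, S.outer k ξ ≠ 0 → ψ ξ ≠ 0 → k ∈ T := fun k ξ h h' =>
    (Set.Finite.mem_toFinset _).2 ⟨ξ, h, h'⟩
  have hcut : ∀ x, ∑ k ∈ T, cutoff (SchwartzMap.smulLeftCLM ℂ (D.symbol k) ψ) f x =
      cutoff ψ f x := fun x => by
    simp only [cutoff]
    rw [← map_sum, ← map_sum]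
    congr 2
    ext ξ
    rw [sum_apply]
    simp only [schwartzMul_apply]
    exact S.sum_symbol_mul hT ξ
  have key := fun k => (h k).fourier_mul hm (hF k) hφ ψ
  have hint : ∀ x, 𝓕 (fun ξ => φ ξ * m ξ) x * cutoff ψ f x = ∑ k ∈ T,
      𝓕 (fun ξ => φ ξ * m ξ) x * cutoff (SchwartzMap.smulLeftCLM ℂ (D.symbol k) ψ) f x :=
    fun x => by rw [← Finset.mul_sum, hcut]
  simp only [hint]
  refine ⟨integrable_finsetSum _ fun k _ => (key k).1, ?_⟩
  rw [integral_finsetSum _ fun k _ => (key k).1, fourier_fourierInv_eq]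
  simp only [← (key _).2]
  refine (hw _).unique (hasSum_sum_of_ne_finset_zero fun k hk => ?_)
  have h0 : SchwartzMap.smulLeftCLM ℂ (S.outer k) (SchwartzMap.smulLeftCLM ℂ φ ψ) = 0 := by
    ext ξ
    rw [schwartzMul_apply, schwartzMul_apply]
    by_cases h1 : S.outer k ξ = 0
    · simp [h1]
    by_cases h2 : ψ ξ = 0
    · simp [h2]
    exact absurd (hT k ξ h1 h2) hk
  rw [hv]
  simp only
  rw [← (h k).fourier_outer, h0, map_zero]

/-- A multiplier which is bounded on each piece of the decomposition is bounded between the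
spaces of the decomposition. -/
theorem exists_linearMap {t : ℝ} (hm : ∀ k, ∃ a, FourierL1 (fun ξ => S.inner k ξ * m ξ) a)
    {C : ℝ≥0} (hloc : ∀ k (F : Lp ℂ p (volume : Measure (E n))), ∃ U, S.IsLocalImage m k F U ∧
      ‖U‖ₑ ≤ C * (ENNReal.ofReal (D.weight k ^ t) * ‖F‖ₑ)) :
    ∃ (T : D.space p q t →ₗ[ℂ] D.space p q 0) (C : ℝ≥0),
      (∀ (f : D.space p q t) (g : 𝓢'(E n, ℂ)), IsFourierMultiplier m f g ↔ g = T f) ∧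
      ∀ f : D.space p q t, D.norm p q 0 (T f) ≤ C * D.norm p q t f := by
  choose U hU hUn using hloc
  have hex : ∀ f : D.space p q t, ∃ g, IsFourierMultiplier m f g := fun f => by
    have hf : D.norm p q t f < ∞ := f.2
    choose F hF hFn using fun k => D.exists_toTemperedDistribution hq.out hf (S.weight_pos k)
    have hB : C * D.norm p q t f ≠ ∞ := ENNReal.mul_ne_top ENNReal.coe_ne_top hf.ne
    refine S.exists_isFourierMultiplier hm (fun k => hU k (F k)) hF
      (B := (C * D.norm p q t f).toReal) fun k => ?_
    rw [← toReal_enorm]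
    exact ENNReal.toReal_mono hB ((hUn k (F k)).trans (by gcongr; exact hFn k))
  -- The pieces of any solution `g` are the local images, so the norm inequality holds term by term
  -- before taking ℓ^q norms.
  have hnorm : ∀ (f : D.space p q t) g, IsFourierMultiplier m f g →
      D.norm p q 0 g ≤ C * D.norm p q t f := fun f g hg => by
    have hf : D.norm p q t f < ∞ := f.2
    rw [FreqDecomp.norm, FreqDecomp.norm, ← lqNorm_const_mul hq.out]
    refine lqNorm_mono fun k => ?_
    obtain ⟨F, hF, -⟩ := D.exists_toTemperedDistribution hq.out hf (S.weight_pos k)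
    rw [(hU k F).eq_of_isFourierMultiplier hm hF hg, ← hF, distLpNorm_toTemperedDistribution,
      distLpNorm_toTemperedDistribution, Real.rpow_zero, ENNReal.ofReal_one, one_mul]
    exact hUn k F
  choose g hg using hex
  have hgs : ∀ f, g f ∈ D.space p q 0 := fun f =>
    (hnorm f _ (hg f)).trans_lt (ENNReal.mul_lt_top ENNReal.coe_lt_top f.2)
  refine ⟨{ toFun := fun f => ⟨g f, hgs f⟩
            map_add' := fun f f' => Subtype.ext ((hg (f + f')).unique ((hg f).add (hg f')))
            map_smul' := fun c f => Subtype.ext ((hg (c • f)).unique ((hg f).smul c)) }, C,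
    fun f g' => ⟨fun h => h.unique (hg f), fun h => h ▸ hg f⟩, fun f => hnorm f _ (hg f)⟩

end CutoffSystem

/-- The main result, for every decomposition which has a system of cutoff functions. -/
theorem CutoffSystem.exists_unimodular {α : ℝ} {D : FreqDecomp n} (S : CutoffSystem α D)
    {p q : ℝ≥0∞} [Fact (1 ≤ p)] [Fact (1 ≤ q)] {s δ : ℝ} {μ : E n → ℝ} (hμ : ContDiff ℝ 2 μ)
    (hμ₂ : ∀ i j : Fin n, D.MemFourier 1 ∞ (2 * α - 2 * s) (secondPartial μ i j))
    (hδ : |(p⁻¹).toReal - 1 / 2| * max (2 * s) 0 ≤ δ) :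
    ∃ (T : D.space p q (δ * n) →ₗ[ℂ] D.space p q 0) (C : ℝ≥0),
      (∀ (f : D.space p q (δ * n)) (g : 𝓢'(E n, ℂ)),
        IsFourierMultiplier (fun ξ => Complex.exp (Complex.I * μ ξ)) f g ↔ g = T f) ∧
      ∀ f : D.space p q (δ * n), D.norm p q 0 (T f) ≤ C * D.norm p q (δ * n) f := by
  obtain ⟨C₁, -, h₁⟩ := S.exists_fourierL1_exp hμ hμ₂
  obtain ⟨C, hC⟩ := S.exists_local_multiplier hμ hμ₂ (p := p) hδ
  exact S.exists_linearMap (fun k => ⟨_, h₁ k⟩) hC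


/-! ### Rescaled bump functions, and the cutoffs for α < 1. -/

variable {n : ℕ}

lemma exists_rescale {b : 𝓢(E n, ℂ)} (hb : HasCompactSupport b) (c : E n) {r : ℝ} (hr : r ≠ 0) :
    ∃ β : 𝓢(E n, ℂ), HasCompactSupport β ∧ ∀ ξ, β ξ = b (r⁻¹ • (ξ - c)) := by
  have h1 : HasCompactSupport fun ξ => b (r⁻¹ • (ξ - c)) :=
    hb.comp_homeomorph ((Homeomorph.subRight c).trans
      (Homeomorph.smulOfNeZero r⁻¹ (inv_ne_zero hr)))
  have h2 : ContDiff ℝ (⊤ : ℕ∞) fun ξ => b (r⁻¹ • (ξ - c)) :=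
    (b.smooth ⊤).comp (by fun_prop)
  exact ⟨h1.toSchwartzMap h2, h1, fun ξ => rfl⟩

/-- Each derivative costs a factor 1/r ≤ 1/r₀, and translations cost nothing, so large scales and
arbitrary centres are uniformly harmless. -/
lemma exists_iteratedFDeriv_rescale_le (b : 𝓢(E n, ℂ)) {r₀ : ℝ} (hr₀ : 0 < r₀) :
    ∃ B : ℕ → ℝ, ∀ (r : ℝ) (c ξ : E n) (i : ℕ), r₀ ≤ r →
      ‖iteratedFDeriv ℝ i (fun ξ => b (r⁻¹ • (ξ - c))) ξ‖ ≤ B i := by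
  have hB : ∀ i, ∃ C, ∀ ξ, ‖iteratedFDeriv ℝ i b ξ‖ ≤ C := fun i => by
    obtain ⟨C, hC⟩ := b.decay 0 i
    exact ⟨C, by simpa using hC.2⟩
  choose C hC using hB
  refine ⟨fun i => r₀⁻¹ ^ i * C i, fun r c ξ i hr => ?_⟩
  have hr' : 0 < r := hr₀.trans_le hr
  have h1 := congrFun (iteratedFDeriv_comp_sub' (𝕜 := ℝ) (f := fun ξ => b (r⁻¹ • ξ)) i c) ξ
  rw [h1, iteratedFDeriv_comp_const_smul r⁻¹ (b.smooth i), norm_smul, norm_pow, norm_inv,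
    Real.norm_of_nonneg hr'.le]
  have h2 : 0 ≤ C i := (norm_nonneg _).trans (hC i 0)
  exact mul_le_mul (by gcongr) (hC i _) (norm_nonneg _) (by positivity)

section Lattice

lemma one_le_japanese (x : E n) : 1 ≤ japanese x := by
  rw [japanese, Real.one_le_sqrt]
  linarith [sq_nonneg ‖x‖]

lemma japanese_pos (x : E n) : 0 < japanese x := zero_lt_one.trans_le (one_le_japanese x)

lemma norm_le_japanese (x : E n) : ‖x‖ ≤ japanese x :=
  Real.le_sqrt_of_sq_le (by linarith)

lemma japanese_le_add {x y : E n} {d : ℝ} (hd : 0 ≤ d) (h : ‖x‖ ≤ ‖y‖ + d) :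
    japanese x ≤ japanese y + d := by
  have hy := (japanese_pos y).le
  refine (Real.sqrt_le_left (by positivity)).2 ?_
  have h1 : japanese y ^ 2 = 1 + ‖y‖ ^ 2 := Real.sq_sqrt (by positivity)
  have h2 : ‖x‖ ^ 2 ≤ (‖y‖ + d) ^ 2 := pow_le_pow_left₀ (norm_nonneg x) h 2
  nlinarith [norm_le_japanese y, mul_le_mul_of_nonneg_right (norm_le_japanese y) hd]

lemma japanese_le_one_add_norm (x : E n) : japanese x ≤ 1 + ‖x‖ := by
  refine (Real.sqrt_le_left (by positivity)).2 ?_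
  nlinarith [norm_nonneg x]

lemma latticePt_sub (k l : Fin n → ℤ) :
    latticePt k - latticePt l = (latticePt (k - l) : E n) := by
  ext i
  simp [latticePt]

lemma norm_latticePt_le (k : Fin n → ℤ) {N : ℕ} (h : ∀ i, |k i| ≤ N) :
    ‖(latticePt k : E n)‖ ≤ n * N := by
  have h1 : (latticePt k : E n) = ∑ i, (k i : ℝ) • EuclideanSpace.single i (1 : ℝ) := by
    ext j
    simp [latticePt, Finset.sum_apply, Pi.single_apply]
  rw [h1]
  refine (norm_sum_le _ _).trans ((Finset.sum_le_card_nsmul _ _ (N : ℝ) fun i _ => ?_).trans ?_)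
  · rw [norm_smul, PiLp.norm_single, norm_one, mul_one, Real.norm_eq_abs, ← Int.cast_abs]
    exact_mod_cast h i
  · simp

lemma abs_apply_le_norm_latticePt (k : Fin n → ℤ) (i : Fin n) :
    |(k i : ℝ)| ≤ ‖(latticePt k : E n)‖ := by
  have := PiLp.norm_apply_le (latticePt k : E n) i
  simpa [latticePt] using this

lemma latticePt_injective : Function.Injective (latticePt : (Fin n → ℤ) → E n) := fun k l h => by
  funext i
  have := congrArg (fun x : E n => x i) h
  simpa [latticePt] using this

lemma exists_summable_japanese (n : ℕ) :
    ∃ M : ℕ, Summable fun k : Fin n → ℤ => (japanese (latticePt k : E n) ^ M)⁻¹ := by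
  set e := (EuclideanSpace.basisFun (Fin n) ℝ).toBasis
  set L : Submodule ℤ (E n) := Submodule.span ℤ (Set.range e)
  have hmem : ∀ k : Fin n → ℤ, (latticePt k : E n) ∈ L := fun k => by
    have h1 : (latticePt k : E n) = ∑ i, k i • e i := by
      ext j
      simp [latticePt, e, Finset.sum_apply, Pi.single_apply]
    rw [h1]
    exact Submodule.sum_mem _ fun i _ => Submodule.smul_mem _ _ (Submodule.subset_span ⟨i, rfl⟩)
  have hs := ZLattice.summable_norm_pow_inv L (Module.finrank ℤ L + 1) (Nat.lt_succ_self _)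
  have hi : Function.Injective fun k : Fin n → ℤ => (⟨latticePt k, hmem k⟩ : L) := fun k l h =>
    latticePt_injective (congrArg Subtype.val h)
  -- Powers of the bracket dominate powers of the norm except at the origin, which is one lattice
  -- point; hence the eventual comparison.
  refine ⟨Module.finrank ℤ L + 1, Summable.of_norm_bounded_eventually (hs.comp_injective hi) ?_⟩
  refine (Set.finite_singleton (0 : Fin n → ℤ)).subset fun k hk => ?_
  by_contra h0
  refine hk ?_
  have h1 : 0 < ‖(latticePt k : E n)‖ := norm_pos_iff.2 fun h => h0 <| by
    have h2 : (latticePt 0 : E n) = 0 := by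
      ext i
      simp [latticePt]
    exact latticePt_injective (h.trans h2.symm)
  have h2 := japanese_pos (latticePt k : E n)
  change ‖(japanese (latticePt k : E n) ^ (Module.finrank ℤ L + 1))⁻¹‖ ≤
    ‖(latticePt k : E n)‖⁻¹ ^ (Module.finrank ℤ L + 1)
  rw [Real.norm_of_nonneg (by positivity), ← inv_pow]
  gcongr
  exact norm_le_japanese _

/-- The difference of the squares is (A² - B²)|x|² - 2B(A - B)⟨x, y⟩, which is at least (A - B)²|x|²
because ⟨x, y⟩ ≤ |x|². -/
lemma mul_norm_sub_le {x y : E n} {A B : ℝ} (hB : 0 ≤ B) (hAB : B ≤ A) (hxy : ‖y‖ ≤ ‖x‖) :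
    B * ‖x - y‖ ≤ ‖A • x - B • y‖ := by
  refine (sq_le_sq₀ (by positivity) (norm_nonneg _)).1 ?_
  rw [mul_pow, norm_sub_sq_real, norm_sub_sq_real, norm_smul, norm_smul, inner_smul_left,
    inner_smul_right, Real.norm_of_nonneg hB, Real.norm_of_nonneg (hB.trans hAB)]
  simp only [conj_trivial]
  have h1 := real_inner_le_norm x y
  have h2 : inner ℝ x y ≤ ‖x‖ ^ 2 := h1.trans (by nlinarith [norm_nonneg x])
  nlinarith [mul_le_mul_of_nonneg_left h2 (mul_nonneg hB (sub_nonneg.2 hAB)),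
    mul_nonneg (mul_nonneg (sub_nonneg.2 hAB) (sub_nonneg.2 hAB)) (sq_nonneg ‖x‖)]

/-- The pieces of the `α`-covering only meet if their indices are close. -/
lemma norm_sub_le_of_close {β R : ℝ} (hβ : 0 ≤ β) (hR : 0 ≤ R) {x y : E n}
    (h : ‖japanese x ^ β • x - japanese y ^ β • y‖ ≤ R * (japanese x ^ β + japanese y ^ β)) :
    ‖x - y‖ ≤ R * (1 + (1 + 2 * R) ^ β) := by
  wlog hxy : ‖y‖ ≤ ‖x‖ generalizing x y
  · rw [norm_sub_rev]
    exact this (by rwa [norm_sub_rev, add_comm]) (le_of_not_ge hxy)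
  have hx0 := japanese_pos x
  have hy0 := japanese_pos y
  have hJ : japanese y ≤ japanese x := by
    simpa using japanese_le_add (x := y) (y := x) le_rfl (by simpa using hxy)
  have hAB : japanese y ^ β ≤ japanese x ^ β := Real.rpow_le_rpow hy0.le hJ hβ
  have hB : 0 < japanese y ^ β := by positivity
  have hA : 0 < japanese x ^ β := by positivity
  -- Comparing lengths alone shows that the norms differ by at most 2R. The brackets are then
  -- comparable up to the factor 1 + 2R, and so are the scales; dividing by the smaller scale gives
  -- the claim.
  have h1 : ‖x‖ ≤ ‖y‖ + 2 * R := by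
    have h2 := norm_sub_norm_le (japanese x ^ β • x) (japanese y ^ β • y)
    rw [norm_smul, norm_smul, Real.norm_of_nonneg hA.le, Real.norm_of_nonneg hB.le] at h2
    have h3 : japanese y ^ β * ‖y‖ ≤ japanese x ^ β * ‖y‖ := by gcongr
    have h4 : R * japanese y ^ β ≤ R * japanese x ^ β := by gcongr
    refine le_of_mul_le_mul_left ?_ hA
    nlinarith
  have h5 : japanese x ≤ japanese y * (1 + 2 * R) := by
    have := japanese_le_add (by positivity) h1
    nlinarith [one_le_japanese y]
  have h6 : japanese x ^ β ≤ japanese y ^ β * (1 + 2 * R) ^ β := by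
    rw [← Real.mul_rpow hy0.le (by positivity)]
    exact Real.rpow_le_rpow hx0.le h5 hβ
  refine le_of_mul_le_mul_left ((mul_norm_sub_le hB.le hAB hxy).trans (h.trans ?_)) hB
  calc R * (japanese x ^ β + japanese y ^ β)
      ≤ R * (japanese y ^ β * (1 + 2 * R) ^ β + japanese y ^ β) := by gcongr
    _ = japanese y ^ β * (R * (1 + (1 + 2 * R) ^ β)) := by ring

end Lattice

/-- The cutoff functions for the `α`-modulation spaces, `α < 1`. -/
theorem nonempty_cutoffSystem_alphaDecomp {α : ℝ} (hα : 0 ≤ α) (hα1 : α < 1)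
    {η : (Fin n → ℤ) → 𝓢(E n, ℂ)} (hη : IsAlphaPartition α η) :
    Nonempty (CutoffSystem α (alphaDecomp α η)) := by
  obtain ⟨⟨C₁, C, hC₁, hCC, -, hsupp⟩, hsum, -⟩ := hη
  have hC : 0 < C := hC₁.trans hCC
  obtain ⟨b, hbc, hb1, hb0, hbn, -⟩ := exists_schwartz_bump n one_pos one_lt_two
  have h1α : 0 < 1 - α := sub_pos.2 hα1
  set β := α / (1 - α)
  have hβ : 0 ≤ β := div_nonneg hα h1α.le
  have hr1 : ∀ k : Fin n → ℤ, 1 ≤ scale α k := fun k => Real.one_le_rpow (one_le_japanese _) hβ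
  have hr0 : ∀ k : Fin n → ℤ, 0 < scale α k := fun k => zero_lt_one.trans_le (hr1 k)
  set W : (Fin n → ℤ) → ℝ := fun k => japanese (latticePt k : E n) ^ (1 / (1 - α))
  have hW1 : ∀ k : Fin n → ℤ, 1 ≤ W k := fun k =>
    Real.one_le_rpow (one_le_japanese _) (by positivity)
  have hWr : ∀ k : Fin n → ℤ, W k ^ α = scale α k := fun k => by
    change (japanese (latticePt k) ^ (1 / (1 - α))) ^ α = japanese (latticePt k) ^ (α / (1 - α))
    rw [← Real.rpow_mul (japanese_pos _).le]
    congr 1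
    ring
  -- The outer cutoffs are rescaled by 2C times a scale which is at least 1.
  obtain ⟨B, hB⟩ := exists_iteratedFDeriv_rescale_le b (r₀ := 2 * C) (by positivity)
  obtain ⟨M, hM⟩ := exists_summable_japanese n
  -- In units of the scale, the symbols live in radius C, the inner cutoffs are 1 there and vanish
  -- beyond 2C, and the outer ones are 1 up to 2C and vanish beyond 4C.
  choose θ hθc hθ using fun k : Fin n → ℤ =>
    exists_rescale hbc (scale α k • latticePt k) (mul_pos hC (hr0 k)).ne'
  choose θ' hθc' hθ' using fun k : Fin n → ℤ =>
    exists_rescale hbc (scale α k • latticePt k) (mul_pos (mul_pos two_pos hC) (hr0 k)).ne'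
  have hscale : ∀ {ρ : ℝ} (x : E n), 0 < ρ → ‖ρ⁻¹ • x‖ = ‖x‖ / ρ := fun x hρ => by
    rw [norm_smul, norm_inv, Real.norm_of_nonneg hρ.le, inv_mul_eq_div]
  have hθs : ∀ k ξ, θ k ξ ≠ 0 → ‖ξ - scale α k • latticePt k‖ ≤ 2 * C * scale α k :=
    fun k ξ h => by
    by_contra! hcon
    refine h ?_
    rw [hθ, hb0]
    rw [hscale _ (mul_pos hC (hr0 k)), le_div_iff₀ (mul_pos hC (hr0 k))]
    linarith
  have hθs' : ∀ k ξ, θ' k ξ ≠ 0 → ‖ξ - scale α k • latticePt k‖ ≤ 4 * C * scale α k :=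
    fun k ξ h => by
    have hpos : 0 < 2 * C * scale α k := mul_pos (mul_pos two_pos hC) (hr0 k)
    by_contra! hcon
    refine h ?_
    rw [hθ', hb0]
    rw [hscale _ hpos, le_div_iff₀ hpos]
    linarith
  have hηs : ∀ k ξ, η k ξ ≠ 0 → ‖ξ - scale α k • latticePt k‖ ≤ C * scale α k := fun k ξ h =>
    hsupp k (subset_tsupport _ h)
  -- The inner support has radius 2C and the gap adds C.
  set R := 3 * C
  set Λ := R * (1 + (1 + 2 * R) ^ β)
  set N := ⌈Λ⌉₊
  have hclose : ∀ (k l : Fin n → ℤ) (ξ : E n), ‖ξ - scale α k • latticePt k‖ ≤ R * scale α k →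
      ‖ξ - scale α l • latticePt l‖ ≤ R * scale α l → ∀ i, |l i - k i| ≤ (N : ℤ) :=
    fun k l ξ hk hl i => by
    have h1 : ‖(latticePt l - latticePt k : E n)‖ ≤ Λ := by
      refine norm_sub_le_of_close hβ (by positivity) ?_
      change ‖scale α l • latticePt l - scale α k • latticePt k‖ ≤ R * (scale α l + scale α k)
      rw [← sub_sub_sub_cancel_left _ _ ξ]
      exact (norm_sub_le _ _).trans (by linarith)
    rw [latticePt_sub] at h1
    have h2 := (abs_apply_le_norm_latticePt (l - k) i).trans (h1.trans (Nat.le_ceil Λ))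
    rw [← Int.cast_abs] at h2
    exact_mod_cast h2
  set near : (Fin n → ℤ) → Finset (Fin n → ℤ) := fun k =>
    Fintype.piFinset fun i => Finset.Icc (k i - N) (k i + N) with hnear
  have hmem : ∀ k l, l ∈ near k ↔ ∀ i, |l i - k i| ≤ (N : ℤ) := fun k l => by
    simp only [hnear, Fintype.mem_piFinset, Finset.mem_Icc]
    refine forall_congr' fun i => ?_
    rw [abs_le]
    constructor <;> rintro ⟨h, h'⟩ <;> constructor <;> linarith
  set c := (1 + (n * N : ℝ)) ^ (1 / (1 - α))
  have hc : 0 ≤ c := by positivity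
  have hweight : ∀ k l : Fin n → ℤ, (∀ i, |l i - k i| ≤ (N : ℤ)) →
      W l ≤ c * W k := fun k l h => by
    have h1 : ‖(latticePt l : E n)‖ ≤ ‖(latticePt k : E n)‖ + n * N := by
      have h2 := norm_latticePt_le (l - k) h
      rw [← latticePt_sub] at h2
      have := norm_le_norm_add_norm_sub' (latticePt l : E n) (latticePt k)
      linarith
    have h3 : japanese (latticePt l : E n) ≤ (1 + n * N) * japanese (latticePt k : E n) := by
      have h4 := japanese_le_add (by positivity) h1
      have h5 : (n * N : ℝ) ≤ n * N * japanese (latticePt k : E n) :=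
        le_mul_of_one_le_right (by positivity) (one_le_japanese _)
      linarith
    change japanese (latticePt l) ^ (1 / (1 - α)) ≤ c * japanese (latticePt k) ^ (1 / (1 - α))
    rw [← Real.mul_rpow (by positivity) (japanese_pos _).le]
    exact Real.rpow_le_rpow (japanese_pos _).le h3 (by positivity)
  set I := ∫ x, ‖(𝓕⁻ b : 𝓢(E n, ℂ)) x‖
  have hI : 0 ≤ I := integral_nonneg fun _ => norm_nonneg _
  have S : CutoffSystem α ⟨Fin n → ℤ, W, η⟩ := {
    inner := θ
    outer := θ'
    center := fun k => scale α k • latticePt k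
    near := near
    size := fun k => japanese (latticePt k)
    -- One constant for three demands: the 𝓕L¹ norm of the inner cutoff, its support radius, and the
    -- comparability of neighbouring weights.
    bound := I + 2 * C + c
    maxCard := (2 * N + 1) ^ n
    gap := C
    derivBound := B
    growth := 1 + 4 * C
    exponent := M
    one_le_weight := hW1
    hasSum_symbol := hsum
    inner_eq_one := fun (k : Fin n → ℤ) ξ h => by
      rw [hθ, hb1]
      rw [hscale _ (mul_pos hC (hr0 k)), div_le_one (mul_pos hC (hr0 k))]
      exact hηs k ξ h
    outer_eq_one := fun (k : Fin n → ℤ) ξ h => by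
      rw [hθ', hb1]
      rw [hscale _ (mul_pos (mul_pos two_pos hC) (hr0 k)),
        div_le_one (mul_pos (mul_pos two_pos hC) (hr0 k))]
      exact hθs k ξ h
    hasCompactSupport_outer := hθc'
    norm_inner_le := fun (k : Fin n → ℤ) ξ => by
      rw [hθ]
      exact (hbn _).1
    bound_pos := by positivity
    fourierL1_inner := fun k => ((FourierL1.of_schwartz_rescale b
      (mul_pos hC (hr0 k)).ne' (scale α k • latticePt k)).mono (by linarith)).congr (hθ k)
    inner_eq_zero := fun (k : Fin n → ℤ) ξ (h : _ * W k ^ α < _) => by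
      by_contra hne
      have h1 := hθs k ξ hne
      rw [hWr] at h
      nlinarith [hr0 k]
    card_near_le := fun (k : Fin n → ℤ) => by
      simp only [hnear]
      rw [Fintype.card_piFinset]
      refine le_of_eq ?_
      simp only [Int.card_Icc]
      have : ∀ i, (k i + N + 1 - (k i - N)).toNat = 2 * N + 1 := fun i => by omega
      simp [this]
    weight_near_le := fun k l hl => (hweight k l ((hmem k l).1 hl)).trans
      (mul_le_mul_of_nonneg_right (by linarith) (zero_le_one.trans (hW1 k)))
    weight_le_near := fun k l hl => (hweight l k fun i => by
      rw [abs_sub_comm]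
      exact (hmem k l).1 hl i).trans
      (mul_le_mul_of_nonneg_right (by linarith) (zero_le_one.trans (hW1 l)))
    gap_pos := hC
    sum_near := fun (k : Fin n → ℤ) ξ₀ ξ h (hξ : _ ≤ _ * W k ^ α) => by
      rw [hWr] at hξ
      refine (hasSum_sum_of_ne_finset_zero fun l hl => ?_).unique (hsum ξ)
      by_contra hne
      refine hl ((hmem k l).2 (hclose k l ξ ?_ ?_))
      · have h1 := hθs k ξ₀ h
        have h2 := norm_add_le (ξ - ξ₀) (ξ₀ - scale α k • latticePt k)
        rw [sub_add_sub_cancel] at h2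
        linarith
      · have h1 := hηs l ξ hne
        nlinarith [mul_pos hC (hr0 l)]
    isCutoffAt := fun (k : Fin n → ℤ) => by
      refine ⟨(θ' k).hasTemperateGrowth, fun i ξ => ?_, japanese_pos _, fun ξ hξ => ?_⟩
      · rw [funext (hθ' k)]
        exact hB _ _ ξ i (le_mul_of_one_le_right (by positivity) (hr1 k))
      · have h1 : tsupport (θ' k) ⊆
            {ξ | ‖ξ - scale α k • latticePt k‖ ≤ 4 * C * scale α k} :=
          closure_minimal (hθs' k) (isClosed_le (by fun_prop) continuous_const)
        have h2 : ‖ξ - scale α k • latticePt k‖ ≤ 4 * C * scale α k := h1 hξ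
        have h3 := norm_sub_norm_le (scale α k • latticePt k) ξ
        rw [norm_smul, Real.norm_of_nonneg (hr0 k).le, norm_sub_rev] at h3
        have h4 : ‖(latticePt k : E n)‖ ≤ 4 * C + ‖ξ‖ := by
          refine le_of_mul_le_mul_left ?_ (hr0 k)
          have h5 : ‖ξ‖ ≤ scale α k * ‖ξ‖ := le_mul_of_one_le_left (norm_nonneg _) (hr1 k)
          linarith
        have h6 := japanese_le_one_add_norm (latticePt k : E n)
        have h7 : 0 ≤ 4 * C * ‖ξ‖ := by positivity
        linarith
    summable_size := hM }
  exact ⟨S⟩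


variable {n : ℕ}

/-! ### The cutoffs for the dyadic decomposition. -/

section Dyadic

lemma IsDyadicPartition.norm_le {φ : ℕ → 𝓢(E n, ℂ)} (hφ : IsDyadicPartition φ) {j : ℕ} {ξ : E n}
    (h : φ j ξ ≠ 0) : ‖ξ‖ ≤ 3 / 2 * 2 ^ j := by
  have h0 : ∀ ζ, φ 0 ζ ≠ 0 → ‖ζ‖ ≤ 3 / 2 := fun ζ hζ => hφ.2.1 (subset_tsupport _ hζ)
  rcases j with _ | j
  · simpa using h0 ξ h
  have hpos : (0 : ℝ) < 2 ^ (j + 1) := by positivity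
  have hn : ‖((2 : ℝ) ^ (j + 1))⁻¹ • ξ‖ = ‖ξ‖ / 2 ^ (j + 1) := by
    rw [norm_smul, norm_inv, Real.norm_of_nonneg hpos.le, inv_mul_eq_div]
  rw [← div_le_iff₀ hpos, ← hn]
  by_contra! hcon
  refine h ?_
  rw [hφ.2.2.2]
  have h1 : φ 0 (((2 : ℝ) ^ (j + 1))⁻¹ • ξ) = 0 := by
    by_contra hne
    exact absurd (h0 _ hne) (not_le.2 hcon)
  have h2 : φ 0 ((2 : ℝ) • ((2 : ℝ) ^ (j + 1))⁻¹ • ξ) = 0 := by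
    by_contra hne
    have h3 := h0 _ hne
    rw [norm_smul, Real.norm_of_nonneg zero_le_two] at h3
    linarith
  rw [h1, h2, sub_zero]

lemma IsDyadicPartition.le_norm {φ : ℕ → 𝓢(E n, ℂ)} (hφ : IsDyadicPartition φ) {j : ℕ} {ξ : E n}
    (h : φ (j + 1) ξ ≠ 0) : 2 / 3 * 2 ^ (j + 1) ≤ ‖ξ‖ := by
  have hpos : (0 : ℝ) < 2 ^ (j + 1) := by positivity
  have hn : ‖((2 : ℝ) ^ (j + 1))⁻¹ • ξ‖ = ‖ξ‖ / 2 ^ (j + 1) := by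
    rw [norm_smul, norm_inv, Real.norm_of_nonneg hpos.le, inv_mul_eq_div]
  by_contra! hcon
  rw [← div_lt_iff₀ hpos, ← hn] at hcon
  refine h ?_
  rw [hφ.2.2.2, hφ.2.2.1 _ (by linarith), hφ.2.2.1, sub_self]
  rw [norm_smul, Real.norm_of_nonneg zero_le_two]
  linarith

/-- The partial sums telescope to φ 0 (2^{-N} ξ), which is 1 once 2^N exceeds |ξ|; all later terms
vanish at ξ. -/
lemma IsDyadicPartition.hasSum {φ : ℕ → 𝓢(E n, ℂ)} (hφ : IsDyadicPartition φ) (ξ : E n) :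
    HasSum (fun j => φ j ξ) 1 := by
  obtain ⟨N, hN⟩ := pow_unbounded_of_one_lt ‖ξ‖ one_lt_two
  have hsum : ∀ N : ℕ, ∑ j ∈ Finset.range (N + 1), φ j ξ = φ 0 (((2 : ℝ) ^ N)⁻¹ • ξ) := fun N => by
    induction N with
    | zero => simp
    | succ N ih =>
      have h1 : (2 : ℝ) • ((2 : ℝ) ^ (N + 1))⁻¹ • ξ = ((2 : ℝ) ^ N)⁻¹ • ξ := by
        rw [smul_smul, pow_succ, mul_inv, mul_comm, mul_assoc, inv_mul_cancel₀ two_ne_zero, mul_one]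
      rw [Finset.sum_range_succ, ih, hφ.2.2.2, h1, add_sub_cancel]
  have h1 : ∑ j ∈ Finset.range (N + 1), φ j ξ = 1 := by
    rw [hsum, hφ.2.2.1]
    rw [norm_smul, norm_inv, Real.norm_of_nonneg (by positivity), inv_mul_eq_div,
      div_le_iff₀ (by positivity)]
    linarith [norm_nonneg ξ]
  rw [← h1]
  refine hasSum_sum_of_ne_finset_zero fun j hj => ?_
  obtain ⟨i, rfl⟩ : ∃ i, j = i + 1 := ⟨j - 1, by
    rw [Finset.mem_range] at hj
    omega⟩
  by_contra hne
  have h2 := hφ.le_norm hne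
  have h3 : N ≤ i := by
    rw [Finset.mem_range] at hj
    omega
  have h4 : (2 : ℝ) ^ N ≤ 2 ^ i := pow_le_pow_right₀ one_le_two h3
  rw [pow_succ] at h2
  linarith [pow_pos (two_pos : (0 : ℝ) < 2) i]

/-- A Schwartz function which is `1` for `r ≤ |ξ| ≤ R` and vanishes unless `r / 2 ≤ |ξ| ≤ 2 R`. -/
lemma exists_schwartz_annulus (n : ℕ) {r R : ℝ} (hr : 0 < r) (hR : r < R) :
    ∃ b : 𝓢(E n, ℂ), HasCompactSupport b ∧ (∀ ξ, r ≤ ‖ξ‖ → ‖ξ‖ ≤ R → b ξ = 1) ∧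
    (∀ ξ, b ξ ≠ 0 → r / 2 ≤ ‖ξ‖ ∧ ‖ξ‖ ≤ 2 * R) ∧ ∀ ξ, ‖b ξ‖ ≤ 1 := by
  obtain ⟨b, hbc, hb1, hb0, hbn, -⟩ := exists_schwartz_bump n (r := R) (R := 2 * R)
    (by linarith) (by linarith)
  obtain ⟨b', hbc', hb1', hb0', hbn', -⟩ := exists_schwartz_bump n (r := r / 2) (R := r)
    (by linarith) (by linarith)
  refine ⟨b - b', ?_, fun ξ h h' => ?_, fun ξ h => ⟨?_, ?_⟩, fun ξ => ?_⟩
  · exact hbc.sub hbc'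
  · rw [sub_apply, hb1 ξ h', hb0' ξ h, sub_zero]
  · by_contra! hcon
    refine h ?_
    rw [sub_apply, hb1 ξ (by linarith), hb1' ξ hcon.le, sub_self]
  · by_contra! hcon
    refine h ?_
    rw [sub_apply, hb0 ξ hcon.le, hb0' ξ (by linarith), sub_zero]
  · rw [sub_apply]
    rcases le_total r ‖ξ‖ with h | h
    · rw [hb0' ξ h, sub_zero]
      exact (hbn ξ).1
    · rw [hb1 ξ (by linarith)]
      exact (hbn' ξ).2

/-- The cutoff functions for the inhomogeneous Besov spaces. -/
theorem nonempty_cutoffSystem_dyadicDecomp {φ : ℕ → 𝓢(E n, ℂ)} (hφ : IsDyadicPartition φ) :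
    Nonempty (CutoffSystem 1 (dyadicDecomp φ)) := by
  -- Each radius doubles from symbol to inner to outer: balls of radii 3/2, 3, 6 for j = 0, and for
  -- j ≥ 1 annuli [2/3, 3/2], [1/3, 3], [1/6, 6] in units of 2^j. The annuli keep |ξ| comparable to
  -- 2^j.
  obtain ⟨b, hbc, hb1, hb0, hbn, -⟩ := exists_schwartz_bump n (r := 3 / 2) (R := 3)
    (by norm_num) (by norm_num)
  obtain ⟨b', hbc', hb1', hb0', -⟩ := exists_schwartz_bump n (r := 3) (R := 6)
    (by norm_num) (by norm_num)
  obtain ⟨g, hgc, hg1, hg0, hgn⟩ := exists_schwartz_annulus n (r := 2 / 3) (R := 3 / 2)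
    (by norm_num) (by norm_num)
  obtain ⟨g', hgc', hg1', hg0', -⟩ := exists_schwartz_annulus n (r := 1 / 3) (R := 3)
    (by norm_num) (by norm_num)
  have hpos : ∀ j : ℕ, (0 : ℝ) < 2 ^ j := fun j => by positivity
  have hone : ∀ j : ℕ, (1 : ℝ) ≤ 2 ^ j := fun j => one_le_pow₀ one_le_two
  have hscale : ∀ (j : ℕ) (ξ : E n), ‖((2 : ℝ) ^ j)⁻¹ • (ξ - 0)‖ = ‖ξ‖ / 2 ^ j := fun j ξ => by
    rw [norm_smul, norm_inv, Real.norm_of_nonneg (hpos j).le, inv_mul_eq_div, sub_zero]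
  set β : ℕ → 𝓢(E n, ℂ) := fun j => if j = 0 then b else g with hβ
  set β' : ℕ → 𝓢(E n, ℂ) := fun j => if j = 0 then b' else g' with hβ'
  have hβc : ∀ j, HasCompactSupport (β j) := fun j => by
    simp only [hβ]
    split_ifs <;> assumption
  have hβc' : ∀ j, HasCompactSupport (β' j) := fun j => by
    simp only [hβ']
    split_ifs <;> assumption
  choose θ hθc hθ using fun j : ℕ => exists_rescale (hβc j) 0 (hpos j).ne'
  choose θ' hθc' hθ' using fun j : ℕ => exists_rescale (hβc' j) 0 (hpos j).ne'
  have hθle : ∀ j ξ, θ j ξ ≠ 0 → ‖ξ‖ ≤ 3 * 2 ^ j := fun j ξ h => by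
    rw [← div_le_iff₀ (hpos j), ← hscale]
    rw [hθ] at h
    by_cases hj : j = 0
    · simp only [hβ, if_pos hj] at h
      exact le_of_not_ge fun h' => h (hb0 _ h')
    · simp only [hβ, if_neg hj] at h
      linarith [(hg0 _ h).2]
  have hθge : ∀ j ξ, j ≠ 0 → θ j ξ ≠ 0 → 2 ^ j ≤ 3 * ‖ξ‖ := fun j ξ hj h => by
    rw [hθ] at h
    simp only [hβ, if_neg hj] at h
    have h1 := (hg0 _ h).1
    rw [hscale, le_div_iff₀ (hpos j)] at h1
    linarith
  have hθge' : ∀ j ξ, θ' j ξ ≠ 0 → 2 ^ j ≤ 6 * (1 + ‖ξ‖) := fun j ξ h => by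
    by_cases hj : j = 0
    · rw [hj, pow_zero]
      linarith [norm_nonneg ξ]
    · rw [hθ'] at h
      simp only [hβ', if_neg hj] at h
      have h1 := (hg0' _ h).1
      rw [hscale, le_div_iff₀ (hpos j)] at h1
      linarith
  have hφθ : ∀ j ξ, φ j ξ ≠ 0 → θ j ξ = 1 := fun j ξ h => by
    have h1 := hφ.norm_le h
    rw [← div_le_iff₀ (hpos j), ← hscale] at h1
    rw [hθ]
    by_cases hj : j = 0
    · simp only [hβ, if_pos hj]
      exact hb1 _ h1
    · simp only [hβ, if_neg hj]
      refine hg1 _ ?_ h1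
      obtain ⟨i, rfl⟩ := Nat.exists_eq_succ_of_ne_zero hj
      rw [hscale, le_div_iff₀ (hpos _)]
      exact hφ.le_norm h
  have hθθ : ∀ j ξ, θ j ξ ≠ 0 → θ' j ξ = 1 := fun j ξ h => by
    have h1 := hθle j ξ h
    rw [← div_le_iff₀ (hpos j), ← hscale] at h1
    rw [hθ']
    by_cases hj : j = 0
    · simp only [hβ', if_pos hj]
      exact hb1' _ h1
    · simp only [hβ', if_neg hj]
      refine hg1' _ ?_ h1
      rw [hscale, le_div_iff₀ (hpos _)]
      linarith [hθge j ξ hj h]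
  -- Here |ξ| is at most (3 + 1/12) 2^j, and at least (1/3 - 1/12) 2^j = 2^j/4 if j ≥ 1. Against |ξ|
  -- ≤ (3/2) 2^l, and |ξ| ≥ (2/3) 2^l if l ≥ 1, this leaves factors below 8 = 2³ on both sides.
  have hnear : ∀ j l ξ₀ ξ, θ j ξ₀ ≠ 0 → ‖ξ - ξ₀‖ ≤ 1 / 12 * 2 ^ j → φ l ξ ≠ 0 →
      l ∈ Finset.Icc (j - 3) (j + 3) := fun j l ξ₀ ξ h hξ hl => by
    have h1 := norm_le_norm_add_norm_sub' ξ ξ₀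
    have h2 := norm_le_norm_add_norm_sub' ξ₀ ξ
    rw [norm_sub_rev] at h2
    have h3 := hθle j ξ₀ h
    have h4 := hφ.norm_le hl
    rw [Finset.mem_Icc]
    constructor
    · by_cases hj : j = 0
      · omega
      have h5 := hθge j ξ₀ hj h
      have h6 : (2 : ℝ) ^ j < 2 ^ (l + 3) := by
        rw [pow_add]
        linarith [hpos l]
      have := (pow_lt_pow_iff_right₀ (one_lt_two (α := ℝ))).1 h6
      omega
    · rcases l with _ | i
      · omega
      have h5 := hφ.le_norm hl
      have h6 : (2 : ℝ) ^ (i + 1) < 2 ^ (j + 3) := by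
        rw [pow_add _ j]
        linarith [hpos j]
      have := (pow_lt_pow_iff_right₀ (one_lt_two (α := ℝ))).1 h6
      omega
  obtain ⟨B, hB⟩ := exists_iteratedFDeriv_rescale_le b' one_pos
  obtain ⟨B', hB'⟩ := exists_iteratedFDeriv_rescale_le g' one_pos
  set I := ∫ x, ‖(𝓕⁻ b : 𝓢(E n, ℂ)) x‖
  set I' := ∫ x, ‖(𝓕⁻ g : 𝓢(E n, ℂ)) x‖
  have hI : 0 ≤ I := integral_nonneg fun _ => norm_nonneg _
  have hI' : 0 ≤ I' := integral_nonneg fun _ => norm_nonneg _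
  have hweight : ∀ j l : ℕ, j ≤ l + 3 → (2 : ℝ) ^ j ≤ (I + I' + 8) * 2 ^ l := fun j l h => by
    have h1 : (2 : ℝ) ^ j ≤ 2 ^ (l + 3) := pow_le_pow_right₀ one_le_two h
    rw [pow_add] at h1
    nlinarith [hpos l, mul_nonneg (add_nonneg hI hI') (hpos l).le]
  have S : CutoffSystem 1 ⟨ℕ, fun j => 2 ^ j, φ⟩ := {
    inner := θ
    outer := θ'
    center := fun _ => 0
    -- Truncated subtraction only cuts the window off at 0, so it never has more than 7 elements.
    near := fun j : ℕ => Finset.Icc (j - 3) (j + 3)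
    size := fun j : ℕ => 2 ^ j
    -- The 8 is the weight ratio of pieces three steps apart; it also exceeds the support radius 3
    -- of the inner cutoffs.
    bound := I + I' + 8
    maxCard := 7
    gap := 1 / 12
    derivBound := fun i => max (B i) (B' i)
    growth := 6
    exponent := 1
    one_le_weight := hone
    hasSum_symbol := hφ.hasSum
    inner_eq_one := hφθ
    outer_eq_one := hθθ
    hasCompactSupport_outer := hθc'
    norm_inner_le := fun (j : ℕ) ξ => by
      rw [hθ]
      simp only [hβ]
      split_ifs
      · exact (hbn _).1
      · exact hgn _
    bound_pos := by positivity
    fourierL1_inner := fun (j : ℕ) => by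
      refine FourierL1.congr (m := fun ξ => β j (((2 : ℝ) ^ j)⁻¹ • (ξ - 0))) ?_ (hθ j)
      simp only [hβ]
      split_ifs
      · exact (FourierL1.of_schwartz_rescale b (hpos j).ne' 0).mono (by linarith)
      · exact (FourierL1.of_schwartz_rescale g (hpos j).ne' 0).mono (by linarith)
    inner_eq_zero := fun (j : ℕ) ξ (h : _ * ((2 : ℝ) ^ j) ^ (1 : ℝ) < _) => by
      by_contra hne
      have h1 := hθle j ξ hne
      rw [Real.rpow_one, sub_zero] at h
      nlinarith [hpos j, mul_nonneg (add_nonneg hI hI') (hpos j).le]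
    card_near_le := fun (j : ℕ) => by
      rw [Nat.card_Icc]
      omega
    weight_near_le := fun (j : ℕ) (l : ℕ) hl => hweight l j (Finset.mem_Icc.1 hl).2
    weight_le_near := fun (j : ℕ) (l : ℕ) hl => hweight j l
      (by have : j - 3 ≤ l := (Finset.mem_Icc.1 hl).1; omega)
    gap_pos := by norm_num
    sum_near := fun (j : ℕ) ξ₀ ξ h (hξ : _ ≤ _ * ((2 : ℝ) ^ j) ^ (1 : ℝ)) => by
      rw [Real.rpow_one] at hξ
      refine (hasSum_sum_of_ne_finset_zero fun l hl => ?_).unique (hφ.hasSum ξ)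
      by_contra hne
      exact hl (hnear j l ξ₀ ξ h hξ hne)
    isCutoffAt := fun (j : ℕ) => by
      refine ⟨(θ' j).hasTemperateGrowth, fun i ξ => ?_, hpos j, fun ξ hξ => ?_⟩
      · rw [funext (hθ' j)]
        simp only [hβ']
        split_ifs
        · exact (hB _ _ ξ i (hone j)).trans (le_max_left _ _)
        · exact (hB' _ _ ξ i (hone j)).trans (le_max_right _ _)
      · have h1 : tsupport (θ' j) ⊆ {ξ | 2 ^ j ≤ 6 * (1 + ‖ξ‖)} :=
          closure_minimal (hθge' j) (isClosed_le continuous_const (by fun_prop))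
        exact h1 hξ
    summable_size := by
      simpa only [pow_one, ← inv_pow] using
        summable_geometric_of_lt_one (r := (2 : ℝ)⁻¹) (by norm_num) (by norm_num) }
  exact ⟨S⟩

end Dyadic

lemma FreqDecomp.IsAdmissible.nonempty_cutoffSystem {α : ℝ} {D : FreqDecomp n}
    (hD : D.IsAdmissible α) : Nonempty (CutoffSystem α D) := by
  rcases hD with ⟨hα, hα1, η, hη, rfl⟩ | ⟨rfl, φ, hφ, rfl⟩
  · exact nonempty_cutoffSystem_alphaDecomp hα hα1 hη
  · exact nonempty_cutoffSystem_dyadicDecomp hφ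

end AlphaMod

end

theorem theorem1p1 (n : ℕ) (p q : ℝ≥0∞) [Fact (1 ≤ p)] [Fact (1 ≤ q)] (s α δ : ℝ)
    (D : AlphaMod.FreqDecomp n) (hD : D.IsAdmissible α)
    (μ : AlphaMod.E n → ℝ) (hμ : ContDiff ℝ 2 μ)
    (hμ₂ : ∀ i j : Fin n, D.MemFourier 1 ∞ (2 * α - 2 * s) (AlphaMod.secondPartial μ i j))
    (hδ : |(p⁻¹).toReal - 1 / 2| * max (2 * s) 0 ≤ δ) :
    ∃ (T : D.space p q (δ * n) →ₗ[ℂ] D.space p q 0) (C : ℝ≥0),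
      (∀ (f : D.space p q (δ * n)) (g : 𝓢'(AlphaMod.E n, ℂ)),
        AlphaMod.IsFourierMultiplier (fun ξ => Complex.exp (Complex.I * μ ξ)) f g ↔ g = T f) ∧
      ∀ f : D.space p q (δ * n), D.norm p q 0 (T f) ≤ C * D.norm p q (δ * n) f := by
  obtain ⟨S⟩ := hD.nonempty_cutoffSystem
  exact S.exists_unimodular hμ hμ₂ hδ
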